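/- For a program with oracle access to an unknown Boolean function $f:\{0,1\}^n\to\{0,1\}$ and to an unknown probability distribution $\mathcal D$ on $\{0,1\}^n$, a membership query returns $f(x)$ for a string $x\in\{0,1\}^n$ chosen by the program, and an example query returns an independent random string drawn according to $\mathcal D$. The program may also flip fair coins. It is a two-sided distribution-free (adaptive) $\epsilon$-tester for a class $C$ of Boolean functions on $\{0,1\}^n$ if, for all $f$ and $\mathcal D$: if $f\in C$, it accepts with probability at least $2/3$; and if $\Pr_{x\sim\mathcal D}[f(x)\neq g(x)]\ge\epsilon$ for every $g\in C$, it rejects with probability at least $2/3$. $s$-Term Monotone $r$-DNF is the class of all functions that are disjunctions of at most $s$ terms, each of them a conjunction of at most $r$ unnegated variables. $s$-Term Unate $r$-DNF is the class of all $f$ such that for some $\xi\in\{0,1\}^n$ the function $f(x_1^{\xi_1},\ldots,x_n^{\xi_n})$ is in $s$-Term Monotone $r$-DNF, where $x^0=x$ and $x^1=\overline{x}$. **Theorem.** There is a probabilistic program that, given any $n\ge 0$, $s\ge1$, $r\ge1$ and $\epsilon>0$ as input, is a two-sided distribution-free adaptive $\epsilon$-tester for $s$-Term Monotone $r$-DNF,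 always halts in time polynomial in $n,s,r,1/\epsilon$, and always makes at most $\tilde O(rs^2/\epsilon)$ membership and example queries in total. The same holds for $s$-Term Unate $r$-DNF. Here $\tilde O(T)=O(T\cdot\mathrm{poly}(\log(T+2)))$ with absolute constants (in particular the number of queries does not depend on $n$). The distance parameter $\epsilon$ is given to the program as the numerator and denominator of a rational number $e$ with $e\le\epsilon\le 2e$ (for instance $e=\epsilon$ if $\epsilon$ is rational). Time is the number of steps of a random access program with registers and arrays of natural numbers whose only arithmetic operations are addition and truncated subtraction. -/

import Mathlib

namespace DistFree

/-! ### Boolean functions and DNF formulas -/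

/-- Boolean functions on `{0,1}^n`. -/
abbrev BoolFn (n : ℕ) := (Fin n → Bool) → Bool

/-- `(i, false)` is the literal `x_i` and `(i, true)` is its negation. -/
abbrev Literal (n : ℕ) := Fin n × Bool

def Literal.eval {n : ℕ} (l : Literal n) (x : Fin n → Bool) : Bool := xor (x l.1) l.2

/-- A term is the conjunction of a finite set of literals (the empty term is the constant `1`). -/
abbrev Term (n : ℕ) := Finset (Literal n)

def Term.eval {n : ℕ} (t : Term n) (x : Fin n → Bool) : Bool :=
  decide (∀ l ∈ t, Literal.eval l x = true)

/-- A DNF is the disjunction of a finite set of terms (the empty DNF is the constant `0`). -/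
abbrev DNF (n : ℕ) := Finset (Term n)

def DNF.eval {n : ℕ} (F : DNF n) : BoolFn n :=
  fun x => decide (∃ t ∈ F, Term.eval t x = true)

/-- Every term has at most `r` literals. -/
def DNF.IsRDNF {n : ℕ} (r : ℕ) (F : DNF n) : Prop := ∀ t ∈ F, t.card ≤ r

/-- No variable is negated. -/
def DNF.IsMonotone {n : ℕ} (F : DNF n) : Prop := ∀ t ∈ F, ∀ l ∈ t, l.2 = false

/-- The class `s`-Term Monotone `r`-DNF. -/
def sTermMonotoneRDNF (n s r : ℕ) : Set (BoolFn n) :=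
  {f | ∃ F : DNF n, F.card ≤ s ∧ F.IsRDNF r ∧ F.IsMonotone ∧ F.eval = f}

/-- The class `s`-Term Unate `r`-DNF: for some `ξ ∈ {0,1}^n` the function
`f(x_1^{ξ_1}, …, x_n^{ξ_n})` is an `s`-term monotone `r`-DNF, where `x^0 = x` and `x^1 = ¬ x`. -/
def sTermUnateRDNF (n s r : ℕ) : Set (BoolFn n) :=
  {f | ∃ ξ : Fin n → Bool, (fun x => f (fun i => xor (x i) (ξ i))) ∈ sTermMonotoneRDNF n s r}

/-! ### Distance with respect to a distribution -/

/-- The probability of the event `S` under `D`, as a real number. -/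
noncomputable def prob {α : Type} (D : PMF α) (S : Set α) : ℝ := (D.toOuterMeasure S).toReal

/-- `f` is `ε`-far from every function of the class `C` with respect to `D`. -/
def IsFarFromClass {n : ℕ} (D : PMF (Fin n → Bool)) (ε : ℝ) (f : BoolFn n)
    (C : Set (BoolFn n)) : Prop :=
  ∀ g ∈ C, ε ≤ prob D {x | f x ≠ g x}

/-! ### Probabilistic random access programs with two oracles

A program works on registers holding natural numbers and on finitely many arrays of natural
numbers (those that it mentions). Every elementary instruction and every test costs one step. The
only arithmetic is addition and truncated subtraction, so that in `t` steps the stored numbers grow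
by at most `t` bits and the unit cost measure is polynomially equivalent to Turing machine time;
a query involves only `n` array cells. -/

inductive Prog : Type
  /-- do nothing -/
  | skip : Prog
  /-- `x := c` -/
  | const (x c : ℕ) : Prog
  /-- `x := y + z` -/
  | add (x y z : ℕ) : Prog
  /-- `x := max (y - z) 0` -/
  | sub (x y z : ℕ) : Prog
  /-- `x := a[i]`, where `i` is the content of register `i` -/
  | load (x a i : ℕ) : Prog
  /-- `a[i] := x`, where `i` is the content of register `i` -/
  | store (a i x : ℕ) : Prog
  /-- `x :=` the outcome of a fair coin -/
  | coin (x : ℕ) : Prog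
  /-- membership query: `x := f(a[0], …, a[n-1])` -/
  | memQuery (x a : ℕ) : Prog
  /-- example query: `(a[0], …, a[n-1]) :=` a fresh random string drawn according to `D` -/
  | exQuery (a : ℕ) : Prog
  | seq (p q : Prog) : Prog
  /-- if register `x` is not zero then `p` else `q` -/
  | ite (x : ℕ) (p q : Prog) : Prog
  /-- while register `x` is not zero do `p` -/
  | loop (x : ℕ) (p : Prog) : Prog

/-- A configuration: the stack of programs still to be executed, the registers, the arrays, and the
number of queries (of both kinds) made so far. -/
structure Config where
  todo : List Prog
  reg : ℕ → ℕ
  arr : ℕ → ℕ → ℕ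
  queries : ℕ

/-- The string in the first `n` cells of an array; a cell represents `0` iff it holds zero. -/
def readString (n : ℕ) (cells : ℕ → ℕ) : Fin n → Bool := fun i => decide (cells i ≠ 0)

/-- Overwrite the first `n` cells of an array with a string. -/
def writeString {n : ℕ} (cells : ℕ → ℕ) (x : Fin n → Bool) : ℕ → ℕ :=
  fun i => if h : i < n then (x ⟨i, h⟩).toNat else cells i

/-- One step with the oracles for `f` and `D`. A configuration with an empty stack has halted. -/
noncomputable def step {n : ℕ} (f : BoolFn n) (D : PMF (Fin n → Bool)) : Config → PMF Config
  | ⟨[], ρ, α, m⟩ => PMF.pure ⟨[], ρ, α, m⟩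
  | ⟨.skip :: k, ρ, α, m⟩ => PMF.pure ⟨k, ρ, α, m⟩
  | ⟨.const x c :: k, ρ, α, m⟩ => PMF.pure ⟨k, Function.update ρ x c, α, m⟩
  | ⟨.add x y z :: k, ρ, α, m⟩ => PMF.pure ⟨k, Function.update ρ x (ρ y + ρ z), α, m⟩
  | ⟨.sub x y z :: k, ρ, α, m⟩ => PMF.pure ⟨k, Function.update ρ x (ρ y - ρ z), α, m⟩
  | ⟨.load x a i :: k, ρ, α, m⟩ => PMF.pure ⟨k, Function.update ρ x (α a (ρ i)), α, m⟩
  | ⟨.store a i x :: k, ρ, α, m⟩ =>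
      PMF.pure ⟨k, ρ, Function.update α a (Function.update (α a) (ρ i) (ρ x)), m⟩
  | ⟨.coin x :: k, ρ, α, m⟩ =>
      (PMF.uniformOfFintype Bool).map fun b => ⟨k, Function.update ρ x b.toNat, α, m⟩
  | ⟨.memQuery x a :: k, ρ, α, m⟩ =>
      PMF.pure ⟨k, Function.update ρ x (f (readString n (α a))).toNat, α, m + 1⟩
  | ⟨.exQuery a :: k, ρ, α, m⟩ =>
      D.map fun u => ⟨k, ρ, Function.update α a (writeString (α a) u), m + 1⟩
  | ⟨.seq p q :: k, ρ, α, m⟩ => PMF.pure ⟨p :: q :: k, ρ, α, m⟩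
  | ⟨.ite x p q :: k, ρ, α, m⟩ => PMF.pure ⟨(if ρ x ≠ 0 then p else q) :: k, ρ, α, m⟩
  | ⟨.loop x p :: k, ρ, α, m⟩ =>
      PMF.pure ⟨if ρ x ≠ 0 then p :: .loop x p :: k else k, ρ, α, m⟩

/-- The random configuration after `t` steps. -/
noncomputable def run {n : ℕ} (f : BoolFn n) (D : PMF (Fin n → Bool)) : ℕ → Config → PMF Config
  | 0, c => PMF.pure c
  | t + 1, c => (step f D c).bind (run f D t)

/-- The start configuration: the parameters `n`, `s`, `r` and the numerator and denominator of the
distance parameter `e` are in registers `0, …, 4`; everything else is zero. -/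
def start (P : Prog) (n s r : ℕ) (e : ℚ) : Config where
  todo := [P]
  reg := fun i => [n, s, r, e.num.toNat, e.den].getD i 0
  arr := fun _ _ => 0
  queries := 0

/-- The program has halted with answer "accept" (the answer is read off register `0`). -/
def accepting : Set Config := {c | c.todo = [] ∧ c.reg 0 = 1}

/-- The program has halted with answer "reject". -/
def rejecting : Set Config := {c | c.todo = [] ∧ c.reg 0 = 0}

/-- Started on `c₀`, with oracle access to any Boolean function `f` on `{0,1}^n` and any
distribution `D` on `{0,1}^n`, the program is a two-sided distribution-free `ε`-tester for `C` which
always halts within `t` steps and always makes at most `q` queries. -/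
structure IsTester {n : ℕ} (c₀ : Config) (C : Set (BoolFn n)) (ε : ℝ) (t : ℕ) (q : ℝ) : Prop where
  halts : ∀ (f : BoolFn n) (D : PMF (Fin n → Bool)), ∀ c ∈ (run f D t c₀).support, c.todo = []
  queries_le : ∀ (f : BoolFn n) (D : PMF (Fin n → Bool)),
    ∀ c ∈ (run f D t c₀).support, (c.queries : ℝ) ≤ q
  complete : ∀ (f : BoolFn n) (D : PMF (Fin n → Bool)), f ∈ C →
    2 / 3 ≤ prob (run f D t c₀) accepting
  sound : ∀ (f : BoolFn n) (D : PMF (Fin n → Bool)), IsFarFromClass D ε f C →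
    2 / 3 ≤ prob (run f D t c₀) rejecting

/-- One program, given `n`, `s`, `r` and `ε`, is for all values of these parameters a two-sided
distribution-free `ε`-tester for the class `C n s r`, runs in time polynomial in `n`, `s`, `r`,
`1/ε` and makes `O(T · poly(log T))` queries for `T = Q s r ε`. A real distance parameter `ε` is
given to the program as a rational number `e` with `e ≤ ε ≤ 2e` (so `e = ε` is allowed if `ε` is
rational). -/
def HasPolyTimeTester (C : (n s r : ℕ) → Set (BoolFn n)) (Q : ℕ → ℕ → ℝ → ℝ) : Prop :=
  ∃ (P : Prog) (A a B b : ℕ), ∀ (n s r : ℕ), 1 ≤ s → 1 ≤ r →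
    ∀ (ε : ℝ) (e : ℚ), 0 < e → (e : ℝ) ≤ ε → ε ≤ 2 * (e : ℝ) →
      IsTester (start P n s r e) (C n s r) ε
        (A * (n + s + r + ⌈1 / ε⌉₊ + 1) ^ a)
        (B * (Q s r ε * Real.log (Q s r ε + 2) ^ b))

end DistFree

/-! Put `k = s * r`, a bound for the number of relevant variables of a member of either class. The
variables are hashed at random into `2 ^ d` blocks with `4 * k ^ 2 ≤ 2 ^ d ≤ 8 * k ^ 2`. With
probability at least 3/4 the relevant variables of a member fall into distinct blocks
(`hash_not_injOn`). Each block then acts like at most one variable, and the number of queries does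
not involve `n`.

Phase one finds relevant blocks. It keeps a set `X` of blocks and a reference string `a`, and
compares `f` at a sample `x` with `f` at the string that is `x` on `X` and `a` elsewhere. A
disagreement yields, by binary search, a new block and a string at which changing this block changes
`f`. The reference is then arranged so that, for a member, the literal of the new block is false at
`a`. After `N` agreements in a row, `f` is probably close to the function `σ.fn` in which the blocks
outside `X` are frozen (`phase1_sound`).

Phase two learns `σ.fn`. The witness string of a block turns `f` into a tentative literal, a
function of that block alone. Every round applies to each tentative literal a linearity test, a test
for multiplicativity, and a comparison of its value at the sample with the self-corrected value. By
`lit_sound`, a function that survives is a constant or a literal, up to errors that the comparison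
detects with probability 1/2. The hypothesis is a disjunction of terms in the tentative literals. A
sample on which `σ.fn` is true and the hypothesis false yields a further term by `r` binary
searches: since the literals of `X` are false at `a`, the set of blocks found is, for a member,
exactly a term of `σ.fn` (`greedy_spec`). It differs from the earlier terms, so a member needs at
most `s` of them. A sample on which only the hypothesis is true leads to rejection.

For a member no error occurs once the hash is injective on its variables (`Represents.answer_eq`).
If `f` is far from the class and `σ.fn` is close to `f`, then `σ.fn` is far from the class. With the
tentative literals replaced by true literals or constants the hypothesis lies in the class
(`idealHyp_mem_cls`), so every round reveals a mistake with probability at least `ε / 64`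
(`no_mistake_le`). A mistake rejects or uses up one of `s` terms (`phase2_sound`). Phase one has
about `k * d / ε` rounds of `O(d)` queries and phase two about `s / ε` rounds of `O(k + r * d)`
queries, in total `r * s ^ 2 / ε` up to logarithms.

The rest is program verification. `Tri` bounds time and queries of a program and ties its final
state to the outcome of an abstract random process; a coupling (`Sim.exists_coupling`) carries the
probabilities over to the machine. -/

namespace DistFree

/-! ### A refinement calculus for programs -/

section Sim

variable {n : ℕ} (f : BoolFn n) (D : PMF (Fin n → Bool))

/-- `Sim f D R T c ν`: started on `c`, the machine reaches within `T` steps a configuration `R`-related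
to an outcome distributed according to `ν`. -/
inductive Sim {Ω : Type} (R : Ω → Config → Prop) : ℕ → Config → PMF Ω → Prop
  | ret (T : ℕ) (c : Config) (ω : Ω) : R ω c → Sim R T c (PMF.pure ω)
  | step {β : Type} (T : ℕ) (c : Config) (μ : PMF β) (s : β → Config) (g : β → PMF Ω) :
      step f D c = μ.map s → (∀ b, Sim R T (s b) (g b)) → Sim R (T + 1) c (μ.bind g)

variable {f D}

theorem Sim.mono {Ω : Type} {R R' : Ω → Config → Prop} {T T' : ℕ} {c : Config} {ν : PMF Ω}
    (h : Sim f D R T c ν) (hT : T ≤ T') (hR : ∀ ω c, R ω c → R' ω c) : Sim f D R' T' c ν := by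
  induction h generalizing T' with
  | ret T c ω h => exact .ret _ _ _ (hR _ _ h)
  | step T c μ s g h _ ih =>
    obtain ⟨T', rfl⟩ : ∃ u, T' = u + 1 := ⟨T' - 1, by omega⟩
    exact .step _ _ _ _ _ h fun b => ih b (by omega)

theorem Sim.bind {Ω Ω' : Type} {R : Ω → Config → Prop} {R' : Ω' → Config → Prop} {T T' : ℕ}
    {c : Config} {ν : PMF Ω} {ν' : Ω → PMF Ω'} (h : Sim f D R T c ν)
    (h' : ∀ ω c', R ω c' → Sim f D R' T' c' (ν' ω)) : Sim f D R' (T + T') c (ν.bind ν') := by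
  induction h with
  | ret T c ω h => rw [PMF.pure_bind]; exact (h' _ _ h).mono (by omega) fun _ _ h => h
  | step T c μ s g h _ ih =>
    rw [PMF.bind_bind, show T + 1 + T' = (T + T') + 1 by omega]
    exact .step _ _ _ _ _ h fun b => ih b

theorem Sim.pure_step {Ω : Type} {R : Ω → Config → Prop} {T : ℕ} {c c' : Config} {ν : PMF Ω}
    (hs : DistFree.step f D c = PMF.pure c') (h : Sim f D R T c' ν) : Sim f D R (T + 1) c ν := by
  have := Sim.step (f := f) (D := D) T c (PMF.pure ()) (fun _ => c') (fun _ => ν)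
    (by rw [hs, PMF.pure_map]) (fun _ => h)
  rwa [PMF.pure_bind] at this

/-- Halted configurations absorb all further steps; this is why an upper bound for the running time
is enough in `Sim`. -/
theorem run_halted {c : Config} (hc : c.todo = []) (t : ℕ) : run f D t c = PMF.pure c := by
  obtain ⟨k, ρ, α, m⟩ := c
  obtain rfl : k = [] := hc
  induction t with
  | zero => rfl
  | succ t ih => rw [run, DistFree.step, PMF.pure_bind, ih]

/-- A simulation that ends in halted configurations couples the abstract outcome with the run. -/
theorem Sim.exists_coupling {Ω : Type} {R : Ω → Config → Prop} {T : ℕ} {c : Config} {ν : PMF Ω}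
    (h : Sim f D R T c ν) (hR : ∀ ω c, R ω c → c.todo = []) :
    ∃ μ : PMF (Ω × Config), μ.map Prod.fst = ν ∧ μ.map Prod.snd = run f D T c ∧
      ∀ p ∈ μ.support, R p.1 p.2 := by
  induction h with
  | ret T c ω h =>
    refine ⟨PMF.pure (ω, c), by rw [PMF.pure_map], ?_, ?_⟩
    · rw [PMF.pure_map, run_halted (hR _ _ h)]
    · rintro p hp
      rw [PMF.mem_support_pure_iff] at hp
      subst hp; exact h
  | step T c μ s g h _ ih =>
    choose κ h1 h2 h3 using ih
    refine ⟨μ.bind κ, ?_, ?_, ?_⟩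
    · rw [PMF.map_bind]; simp only [h1]
    · rw [PMF.map_bind]; simp only [h2]
      rw [run, h, PMF.bind_map]; rfl
    · rintro p hp
      rw [PMF.mem_support_bind_iff] at hp
      obtain ⟨b, -, hb⟩ := hp
      exact h3 b p hb

end Sim

/-! ### Triples -/

/-- Registers and arrays. -/
@[ext] structure St where
  reg : ℕ → ℕ
  arr : ℕ → ℕ → ℕ

def St.set (σ : St) (x v : ℕ) : St := ⟨Function.update σ.reg x v, σ.arr⟩

def St.put (σ : St) (a : ℕ) (cells : ℕ → ℕ) : St := ⟨σ.reg, Function.update σ.arr a cells⟩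

@[simp] theorem St.set_reg (σ : St) (x v y : ℕ) :
    (σ.set x v).reg y = if y = x then v else σ.reg y := by
  simp [St.set, Function.update_apply]

@[simp] theorem St.set_arr (σ : St) (x v : ℕ) : (σ.set x v).arr = σ.arr := rfl

@[simp] theorem St.put_reg (σ : St) (a : ℕ) (c : ℕ → ℕ) : (σ.put a c).reg = σ.reg := rfl

@[simp] theorem St.put_arr (σ : St) (a : ℕ) (c : ℕ → ℕ) (b : ℕ) :
    (σ.put a c).arr b = if b = a then c else σ.arr b := by
  simp [St.put, Function.update_apply]

/-- The registers that a program can write to. -/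
def wr : Prog → List ℕ
  | .const x _ => [x]
  | .add x _ _ => [x]
  | .sub x _ _ => [x]
  | .load x _ _ => [x]
  | .coin x => [x]
  | .memQuery x _ => [x]
  | .seq p q => wr p ++ wr q
  | .ite _ p q => wr p ++ wr q
  | .loop _ p => wr p
  | _ => []

/-- The arrays that a program can write to. -/
def wa : Prog → List ℕ
  | .store a _ _ => [a]
  | .exQuery a => [a]
  | .seq p q => wa p ++ wa q
  | .ite _ p q => wa p ++ wa q
  | .loop _ p => wa p
  | _ => []

/-- The two states differ at most where `P` can write. -/
structure Fr (P : Prog) (σ σ' : St) : Prop where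
  reg : ∀ x, x ∉ wr P → σ'.reg x = σ.reg x
  arr : ∀ a, a ∉ wa P → σ'.arr a = σ.arr a

theorem Fr.refl (P : Prog) (σ : St) : Fr P σ σ := ⟨fun _ _ => rfl, fun _ _ => rfl⟩

theorem Fr.trans {P P' Q : Prog} {σ σ' σ'' : St} (h : Fr P σ σ') (h' : Fr P' σ' σ'')
    (hr : wr P ⊆ wr Q) (ha : wa P ⊆ wa Q) (hr' : wr P' ⊆ wr Q) (ha' : wa P' ⊆ wa Q) :
    Fr Q σ σ'' :=
  ⟨fun x hx => (h'.reg x fun h => hx (hr' h)).trans (h.reg x fun h => hx (hr h)),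
    fun x hx => (h'.arr x fun h => hx (ha' h)).trans (h.arr x fun h => hx (ha h))⟩

theorem Fr.mono {P Q : Prog} {σ σ' : St} (h : Fr P σ σ') (hr : wr P ⊆ wr Q) (ha : wa P ⊆ wa Q) :
    Fr Q σ σ' :=
  ⟨fun x hx => h.reg x fun h => hx (hr h), fun x hx => h.arr x fun h => hx (ha h)⟩

section Tri

variable {n : ℕ} (f : BoolFn n) (D : PMF (Fin n → Bool))

/-- From `σ`, the program `P` ends within `T` steps and `q` queries in a state that is `R`-related to
an outcome distributed according to `ν`. -/
def Tri {Ω : Type} (P : Prog) (T q : ℕ) (σ : St) (ν : PMF Ω) (R : Ω → St → Prop) : Prop :=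
  -- Quantifying over the continuation `k` and the counter `m` is what lets triples be composed.
  ∀ k m, Sim f D (fun ω c => ∃ σ' : St, ∃ m', c = ⟨k, σ'.reg, σ'.arr, m'⟩ ∧ m' ≤ m + q ∧
    Fr P σ σ' ∧ R ω σ') T ⟨P :: k, σ.reg, σ.arr, m⟩ ν

/-- Deterministic programs are the case of a one-point outcome, so that the rules for `Tri` serve
both. -/
def Det (P : Prog) (T q : ℕ) (σ : St) (R : St → Prop) : Prop :=
  Tri f D P T q σ (PMF.pure ()) fun _ => R

variable {f D}

theorem Tri.mono {Ω : Type} {P : Prog} {T q T' q' : ℕ} {σ : St} {ν : PMF Ω} {R R' : Ω → St → Prop}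
    (h : Tri f D P T q σ ν R) (hT : T ≤ T') (hq : q ≤ q')
    (hR : ∀ ω σ', Fr P σ σ' → R ω σ' → R' ω σ') : Tri f D P T' q' σ ν R' := by
  intro k m
  refine (h k m).mono hT ?_
  rintro ω c ⟨σ', m', rfl, hm, hf, hr⟩
  exact ⟨σ', m', rfl, by omega, hf, hR _ _ hf hr⟩

theorem Det.mono {P : Prog} {T q T' q' : ℕ} {σ : St} {R R' : St → Prop}
    (h : Det f D P T q σ R) (hT : T ≤ T') (hq : q ≤ q') (hR : ∀ σ', Fr P σ σ' → R σ' → R' σ') :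
    Det f D P T' q' σ R' :=
  Tri.mono h hT hq fun _ => hR

theorem Tri.map {Ω Ω' : Type} {P : Prog} {T q : ℕ} {σ : St} {ν : PMF Ω} (g : Ω → Ω')
    {R : Ω → St → Prop} {R' : Ω' → St → Prop} (h : Tri f D P T q σ ν R)
    (hR : ∀ ω σ', Fr P σ σ' → R ω σ' → R' (g ω) σ') :
    Tri f D P T q σ (ν.bind fun ω => PMF.pure (g ω)) R' := by
  intro k m
  refine (h k m).bind (T' := 0) (ν' := fun ω => PMF.pure (g ω)) ?_
  rintro ω c ⟨σ', m', rfl, hm, hf, hr⟩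
  exact .ret _ _ _ ⟨σ', m', rfl, hm, hf, hR _ _ hf hr⟩

theorem Det.tri {Ω : Type} {P : Prog} {T q : ℕ} {σ : St} {R : St → Prop} {R' : Ω → St → Prop}
    {ω : Ω} (h : Det f D P T q σ R) (hR : ∀ σ', Fr P σ σ' → R σ' → R' ω σ') :
    Tri f D P T q σ (PMF.pure ω) R' := by
  have := Tri.map (fun _ => ω) h fun _ => hR
  rwa [PMF.pure_bind] at this

theorem Tri.seq {Ω Ω' : Type} {P Q : Prog} {T q T' q' : ℕ} {σ : St} {ν : PMF Ω} {ν' : Ω → PMF Ω'}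
    {R : Ω → St → Prop} {R' : Ω' → St → Prop} (h : Tri f D P T q σ ν R)
    (h' : ∀ ω σ', Fr P σ σ' → R ω σ' → Tri f D Q T' q' σ' (ν' ω) R') :
    Tri f D (.seq P Q) (T + T' + 1) (q + q') σ (ν.bind ν') R' := by
  intro k m
  refine Sim.pure_step (by rw [step]) ?_
  refine (h (Q :: k) m).bind ?_
  rintro ω c ⟨σ', m', rfl, hm, hf, hr⟩
  refine (h' ω σ' hf hr k m').mono le_rfl ?_
  rintro ω c ⟨σ'', m'', rfl, hm', hf', hr'⟩
  exact ⟨σ'', m'', rfl, by omega, hf.trans hf' (by simp [wr]) (by simp [wa]) (by simp [wr])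
    (by simp [wa]), hr'⟩

theorem Det.seq_tri {Ω : Type} {P Q : Prog} {T q T' q' : ℕ} {σ : St} {ν : PMF Ω}
    {R : St → Prop} {R' : Ω → St → Prop} (h : Det f D P T q σ R)
    (h' : ∀ σ', Fr P σ σ' → R σ' → Tri f D Q T' q' σ' ν R') :
    Tri f D (.seq P Q) (T + T' + 1) (q + q') σ ν R' := by
  have := Tri.seq (ν' := fun _ => ν) h fun _ => h'
  rwa [PMF.pure_bind] at this

theorem Det.seq {P Q : Prog} {T q T' q' : ℕ} {σ : St} {R R' : St → Prop}
    (h : Det f D P T q σ R) (h' : ∀ σ', Fr P σ σ' → R σ' → Det f D Q T' q' σ' R') :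
    Det f D (.seq P Q) (T + T' + 1) (q + q') σ R' :=
  Det.seq_tri h h'

theorem Tri.ite {Ω : Type} {P Q : Prog} {x T q : ℕ} {σ : St} {ν : PMF Ω} {R : Ω → St → Prop}
    (h : σ.reg x ≠ 0 → Tri f D P T q σ ν R) (h' : σ.reg x = 0 → Tri f D Q T q σ ν R) :
    Tri f D (.ite x P Q) (T + 1) q σ ν R := by
  intro k m
  refine Sim.pure_step (by rw [step]) ?_
  by_cases hx : σ.reg x = 0
  · simp only [hx, ne_eq, not_true_eq_false, if_false]
    refine (h' hx k m).mono le_rfl ?_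
    rintro ω c ⟨σ'', m'', rfl, hm', hf', hr'⟩
    exact ⟨σ'', m'', rfl, by omega, hf'.mono (by simp [wr]) (by simp [wa]), hr'⟩
  · rw [if_pos hx]
    refine (h hx k m).mono le_rfl ?_
    rintro ω c ⟨σ'', m'', rfl, hm', hf', hr'⟩
    exact ⟨σ'', m'', rfl, by omega, hf'.mono (by simp [wr]) (by simp [wa]), hr'⟩

theorem Det.ite {P Q : Prog} {x T q : ℕ} {σ : St} {R : St → Prop}
    (h : σ.reg x ≠ 0 → Det f D P T q σ R) (h' : σ.reg x = 0 → Det f D Q T q σ R) :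
    Det f D (.ite x P Q) (T + 1) q σ R :=
  Tri.ite h h'

theorem Tri.loop_zero {Ω : Type} {P : Prog} {x : ℕ} {σ : St} {ω : Ω} {R : Ω → St → Prop}
    (hx : σ.reg x = 0) (h : R ω σ) : Tri f D (.loop x P) 1 0 σ (PMF.pure ω) R := by
  intro k m
  refine Sim.pure_step (by rw [step]) ?_
  exact .ret _ _ _ ⟨σ, m, by simp [hx], by omega, Fr.refl _ _, h⟩

theorem Tri.loop_succ {Ω Ω' : Type} {P : Prog} {x T q T' q' : ℕ} {σ : St} {ν : PMF Ω}
    {ν' : Ω → PMF Ω'} {R : Ω → St → Prop} {R' : Ω' → St → Prop} (hx : σ.reg x ≠ 0)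
    (h : Tri f D P T q σ ν R)
    (h' : ∀ ω σ', Fr P σ σ' → R ω σ' → Tri f D (.loop x P) T' q' σ' (ν' ω) R') :
    Tri f D (.loop x P) (T + T' + 1) (q + q') σ (ν.bind ν') R' := by
  intro k m
  refine Sim.pure_step (by rw [step]) ?_
  simp only [if_pos hx]
  refine (h (.loop x P :: k) m).bind ?_
  rintro ω c ⟨σ', m', rfl, hm, hf, hr⟩
  refine (h' ω σ' hf hr k m').mono le_rfl ?_
  rintro ω c ⟨σ'', m'', rfl, hm', hf', hr'⟩
  exact ⟨σ'', m'', rfl, by omega, hf.trans hf' (by simp [wr]) (by simp [wa]) (by simp [wr])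
    (by simp [wa]), hr'⟩

theorem Det.loop_succ {P : Prog} {x T q T' q' : ℕ} {σ : St} {R R' : St → Prop} (hx : σ.reg x ≠ 0)
    (h : Det f D P T q σ R) (h' : ∀ σ', Fr P σ σ' → R σ' → Det f D (.loop x P) T' q' σ' R') :
    Det f D (.loop x P) (T + T' + 1) (q + q') σ R' := by
  have := Tri.loop_succ (ν' := fun _ => PMF.pure ()) hx h fun _ => h'
  rwa [PMF.pure_bind] at this

theorem Tri.coin (x : ℕ) (σ : St) :
    Tri f D (.coin x) 1 0 σ (PMF.uniformOfFintype Bool) fun b σ' => σ' = σ.set x b.toNat := by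
  intro k m
  have := Sim.step (f := f) (D := D)
    (R := fun (b : Bool) c => ∃ σ' : St, ∃ m', c = ⟨k, σ'.reg, σ'.arr, m'⟩ ∧ m' ≤ m + 0 ∧
      Fr (.coin x) σ σ' ∧ σ' = σ.set x b.toNat) 0 ⟨.coin x :: k, σ.reg, σ.arr, m⟩
    (PMF.uniformOfFintype Bool) (fun b => ⟨k, (σ.set x b.toNat).reg, σ.arr, m⟩) PMF.pure
    (by rw [DistFree.step]; rfl) (fun b => .ret _ _ _ ⟨σ.set x b.toNat, m, rfl, le_rfl,
      ⟨fun y hy => by simp_all [wr], fun _ _ => rfl⟩, rfl⟩)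
  rwa [PMF.bind_pure] at this

theorem Tri.exQuery (a : ℕ) (σ : St) :
    Tri f D (.exQuery a) 1 1 σ D fun u σ' => σ' = σ.put a (writeString (σ.arr a) u) := by
  intro k m
  have := Sim.step (f := f) (D := D)
    (R := fun (u : Fin n → Bool) c => ∃ σ' : St, ∃ m', c = ⟨k, σ'.reg, σ'.arr, m'⟩ ∧ m' ≤ m + 1 ∧
      Fr (.exQuery a) σ σ' ∧ σ' = σ.put a (writeString (σ.arr a) u)) 0
    ⟨.exQuery a :: k, σ.reg, σ.arr, m⟩ D
    (fun u => ⟨k, σ.reg, (σ.put a (writeString (σ.arr a) u)).arr, m + 1⟩) PMF.pure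
    (by rw [DistFree.step]; rfl)
    (fun b => .ret _ _ _ ⟨σ.put a (writeString (σ.arr a) b), m + 1, rfl, le_rfl,
      ⟨fun _ _ => rfl, fun y hy => by simp_all [wa]⟩, rfl⟩)
  rwa [PMF.bind_pure] at this

/-! ### Straight-line programs and counting loops. -/

variable (f)

/-- The effect of a deterministic program without loops. -/
def ev : Prog → St → St
  | .const x c, σ => σ.set x c
  | .add x y z, σ => σ.set x (σ.reg y + σ.reg z)
  | .sub x y z, σ => σ.set x (σ.reg y - σ.reg z)
  | .load x a i, σ => σ.set x (σ.arr a (σ.reg i))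
  | .store a i x, σ => σ.put a (Function.update (σ.arr a) (σ.reg i) (σ.reg x))
  | .memQuery x a, σ => σ.set x (f (readString n (σ.arr a))).toNat
  | .seq p q, σ => ev q (ev p σ)
  | .ite x p q, σ => if σ.reg x ≠ 0 then ev p σ else ev q σ
  | _, σ => σ

variable {f}

def straight : Prog → Bool
  | .coin _ => false
  | .exQuery _ => false
  | .loop _ _ => false
  | .seq p q => straight p && straight q
  | .ite _ p q => straight p && straight q
  | _ => true

/-- Both branches of a test are charged: an overestimate, but one that can be read off the program
text. -/
def cost : Prog → ℕ
  | .seq p q => cost p + cost q + 1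
  | .ite _ p q => cost p + cost q + 1
  | _ => 1

def qcost : Prog → ℕ
  | .memQuery _ _ => 1
  | .seq p q => qcost p + qcost q
  | .ite _ p q => qcost p + qcost q
  | _ => 0

theorem ev_fr (P : Prog) (σ : St) : Fr P σ (ev f P σ) := by
  induction P generalizing σ with
  | seq p q ihp ihq =>
    exact (ihp σ).trans (ihq _) (by simp [wr]) (by simp [wa]) (by simp [wr]) (by simp [wa])
  | ite x p q ihp ihq =>
    rw [ev]
    split_ifs
    · exact (ihp σ).mono (by simp [wr]) (by simp [wa])
    · exact (ihq σ).mono (by simp [wr]) (by simp [wa])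
  | _ => exact ⟨fun y hy => by simp_all [wr, ev], fun y hy => by simp_all [wa, ev]⟩

theorem det_ev_exact (P : Prog) (σ : St) (R : St → Prop) (hP : straight P = true) (h : R (ev f P σ)) :
    Det f D P (cost P) (qcost P) σ R := by
  have base : ∀ P, (∀ k m, DistFree.step f D ⟨P :: k, σ.reg, σ.arr, m⟩ =
      PMF.pure ⟨k, (ev f P σ).reg, (ev f P σ).arr, m + qcost P⟩) → R (ev f P σ) →
      Det f D P 1 (qcost P) σ R := fun P hs hR k m =>
    .pure_step (hs k m) (.ret _ _ _ ⟨_, _, rfl, le_rfl, ev_fr _ _, hR⟩)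
  induction P generalizing σ R with
  | coin => simp [straight] at hP
  | exQuery => simp [straight] at hP
  | loop => simp [straight] at hP
  | seq p q ihp ihq =>
    simp only [straight, Bool.and_eq_true] at hP
    exact Det.seq (ihp σ (fun σ' => σ' = ev f p σ) hP.1 rfl
      fun P hs hR k m => .pure_step (hs k m) (.ret _ _ _ ⟨_, _, rfl, le_rfl, ev_fr _ _, hR⟩))
      (by
        rintro _ - rfl
        exact ihq _ _ hP.2 h
          fun P hs hR k m => .pure_step (hs k m) (.ret _ _ _ ⟨_, _, rfl, le_rfl, ev_fr _ _, hR⟩))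
  | ite x p q ihp ihq =>
    simp only [straight, Bool.and_eq_true] at hP
    by_cases hx : σ.reg x = 0
    · refine (Det.ite (T := cost q) (q := qcost q) (fun h' => absurd hx h') fun _ =>
        ihq σ R hP.2 (by simpa [ev, hx] using h) base).mono (by simp [cost]) (by simp [qcost])
        fun _ _ h => h
    · refine (Det.ite (T := cost p) (q := qcost p) (fun _ =>
        ihp σ R hP.1 (by simpa [ev, hx] using h) base) fun h' => absurd h' hx).mono
        (by simp [cost]) (by simp [qcost]) fun _ _ h => h
  | _ => exact base _ (fun k m => by rw [DistFree.step]; rfl) h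

/-- The side conditions form one Boolean equation, so that for a concrete program evaluation proves
it. -/
theorem det_ev (P : Prog) (σ : St) (R : St → Prop) {T q : ℕ}
    (hP : (straight P && (Nat.ble (cost P) T && Nat.ble (qcost P) q)) = true) (h : R (ev f P σ)) :
    Det f D P T q σ R := by
  simp only [Bool.and_eq_true, Nat.ble_eq] at hP
  exact (det_ev_exact P σ R hP.1 h).mono hP.2.1 hP.2.2 fun _ _ h => h

/-- `for i := 0 to N - 1 do body`, with auxiliary register `t`. -/
def forUp (i t N : ℕ) (body : Prog) : Prog :=
  .seq (.const i 0) (.seq (.sub t N i)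
    (.loop t (.seq body (.seq (.const t 1) (.seq (.add i i t) (.sub t N i))))))

noncomputable def itr {S : Type} (g : ℕ → S → PMF S) : ℕ → ℕ → S → PMF S
  | _, 0, s => PMF.pure s
  | k, N + 1, s => (g k s).bind (itr g (k + 1) N)

theorem itr_pure {S : Type} (g : ℕ → S → S) (k N : ℕ) (s : S) :
    ∃ s', itr (fun k s => PMF.pure (g k s)) k N s = PMF.pure s' := by
  induction N generalizing k s with
  | zero => exact ⟨s, rfl⟩
  | succ N ih => rw [itr, PMF.pure_bind]; exact ih _ _

/-- After the body the loop still changes `i` and `t`, so the body has to establish the invariant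
for every state that agrees with its final state off these two registers. The query budget `qb` may
vary with the round; this matters where only marked blocks cost queries. -/
theorem tri_for {S : Type} {i t N : ℕ} {body : Prog} {Tb : ℕ} {qb : ℕ → ℕ} {M : ℕ}
    {g : ℕ → S → PMF S} (Rel : ℕ → S → St → Prop) {σ : St} {s : S}
    (hit : i ≠ t) (hiN : i ≠ N) (htN : t ≠ N) (hib : i ∉ wr body) (hNb : N ∉ wr body)
    (hN : σ.reg N = M) (h0 : ∀ τ, Fr (forUp i t N body) σ τ → τ.arr = σ.arr →
      (∀ x, x ≠ i → x ≠ t → τ.reg x = σ.reg x) → Rel 0 s τ)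
    (hb : ∀ k < M, ∀ s τ, Fr (forUp i t N body) σ τ → Rel k s τ → τ.reg i = k → τ.reg N = M →
      Tri f D body Tb (qb k) τ (g k s) fun s' τ' => ∀ τ'', τ''.arr = τ'.arr →
        (∀ x, x ≠ i → x ≠ t → τ''.reg x = τ'.reg x) → Rel (k + 1) s' τ'') :
    Tri f D (forUp i t N body) (M * (Tb + 8) + 6) (∑ j ∈ Finset.range M, qb j) σ (itr g 0 M s)
      (Rel M) := by
  set F := forUp i t N body with hF
  have hwr : ∀ x, x ∉ wr F → x ≠ i ∧ x ≠ t ∧ x ∉ wr body := by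
    intro x hx
    simp [hF, forUp, wr] at hx
    tauto
  have hwa : ∀ x, x ∉ wa F → x ∉ wa body := by
    intro x hx
    simpa [hF, forUp, wa] using hx
  -- Induction on the number of remaining rounds. The test register holds `M - k`, so the loop ends
  -- exactly at `k = M`.
  have key : ∀ rem k s τ, Fr F σ τ → k + rem = M → Rel k s τ → τ.reg i = k → τ.reg N = M →
      τ.reg t = M - k →
      Tri f D (.loop t (.seq body (.seq (.const t 1) (.seq (.add i i t) (.sub t N i)))))
        (rem * (Tb + 8) + 1) (∑ j ∈ Finset.range rem, qb (k + j)) τ (itr g k rem s) (Rel M) := by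
    intro rem
    induction rem with
    | zero =>
      intro k s τ _ hk hR hi hN ht
      obtain rfl : k = M := by omega
      simpa [itr] using Tri.loop_zero (by omega) hR
    | succ rem ih =>
      intro k s τ hτ hk hR hi hN ht
      rw [itr, Finset.sum_range_succ']
      have h1 := hb k (by omega) s τ hτ hR hi hN
      refine Tri.mono (Tri.loop_succ (T := Tb + 6) (q := qb k) (T' := rem * (Tb + 8) + 1)
        (q' := ∑ j ∈ Finset.range rem, qb (k + 1 + j)) (ν := g k s)
        (R := fun s' τ' => Fr F τ τ' ∧ τ'.reg i = k + 1 ∧ τ'.reg N = M ∧ τ'.reg t = M - (k + 1) ∧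
          Rel (k + 1) s' τ') (by omega) ?_ ?_) (by ring_nf; omega) ?_ fun _ _ _ h => h
      · have h2 := Tri.seq (Q := .seq (.const t 1) (.seq (.add i i t) (.sub t N i)))
          (ν' := PMF.pure) (T' := 5) (q' := 0) (R' := fun s' τ' => Fr F τ τ' ∧
          τ'.reg i = k + 1 ∧ τ'.reg N = M ∧ τ'.reg t = M - (k + 1) ∧ Rel (k + 1) s' τ') h1 ?_
        · rwa [PMF.bind_pure] at h2
        · rintro s' τ' hf hR'
          have hi' : τ'.reg i = k := (hf.reg i hib).trans hi
          have hN' : τ'.reg N = M := (hf.reg N hNb).trans hN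
          refine Det.tri (R := fun τ'' => τ''.arr = τ'.arr ∧ τ''.reg i = k + 1 ∧
            τ''.reg t = M - (k + 1) ∧ ∀ x, x ≠ i → x ≠ t → τ''.reg x = τ'.reg x) ?_ ?_
          · refine det_ev _ _ _ rfl ?_
            simp only [ev, St.set_reg, if_neg hit, if_neg hiN.symm, if_neg htN.symm, hi', hN',
              if_true, St.set_arr, true_and]
            intro x hx hx'
            simp [hx, hx']
          · rintro τ'' - ⟨ha, hi'', ht'', hr⟩
            refine ⟨⟨fun x hx => ?_, fun x hx => ?_⟩, hi'', ?_, ht'', hR' τ'' ha hr⟩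
            · obtain ⟨h1, h2, h3⟩ := hwr x hx
              rw [hr x h1 h2, hf.reg x h3]
            · rw [ha, hf.arr x (hwa x hx)]
            · rw [hr N hiN.symm htN.symm, hN']
      · rintro s' τ' - ⟨hf, hi', hN', ht', hR'⟩
        exact ih (k + 1) s' τ' (hτ.trans hf (by simp) (by simp) (by simp) (by simp)) (by omega) hR'
          hi' hN' ht'
      · simp only [add_zero]
        rw [add_comm]
        gcongr with j
        exact le_of_eq (by congr 1; ring)
  refine Tri.mono (Det.seq_tri (T := 1) (q := 0) (R := fun τ => τ = σ.set i 0)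
    (det_ev _ _ _ rfl rfl) ?_) (T := 1 + (1 + (M * (Tb + 8) + 1) + 1) + 1) (by omega)
    (q := 0 + (0 + ∑ j ∈ Finset.range M, qb j)) (by simp) fun _ _ _ h => h
  rintro _ - rfl
  refine Det.seq_tri (T := 1) (q := 0) (R := fun τ => τ = (σ.set i 0).set t M)
    (det_ev _ _ _ rfl ?_) ?_
  · simp [ev, hiN.symm, hN]
  · rintro _ - rfl
    have hfr : Fr F σ ((σ.set i 0).set t M) := ⟨fun x hx => by
      obtain ⟨h1, h2, -⟩ := hwr x hx
      simp [h1, h2], fun _ _ => rfl⟩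
    have := key M 0 s ((σ.set i 0).set t M) hfr (by omega)
      (h0 _ hfr rfl fun x h1 h2 => by simp [h1, h2]) (by simp [hit])
      (by simp [htN.symm, hiN.symm, hN]) (by simp)
    simpa using this

theorem det_for {i t N : ℕ} {body : Prog} {Tb : ℕ} {qb : ℕ → ℕ} {M : ℕ}
    (Rel : ℕ → St → Prop) {σ : St}
    (hit : i ≠ t) (hiN : i ≠ N) (htN : t ≠ N) (hib : i ∉ wr body) (hNb : N ∉ wr body)
    (hN : σ.reg N = M) (h0 : ∀ τ, Fr (forUp i t N body) σ τ → τ.arr = σ.arr →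
      (∀ x, x ≠ i → x ≠ t → τ.reg x = σ.reg x) → Rel 0 τ)
    (hb : ∀ k < M, ∀ τ, Fr (forUp i t N body) σ τ → Rel k τ → τ.reg i = k → τ.reg N = M →
      Det f D body Tb (qb k) τ fun τ' => ∀ τ'', τ''.arr = τ'.arr →
        (∀ x, x ≠ i → x ≠ t → τ''.reg x = τ'.reg x) → Rel (k + 1) τ'') :
    Det f D (forUp i t N body) (M * (Tb + 8) + 6) (∑ j ∈ Finset.range M, qb j) σ (Rel M) := by
  have := tri_for (S := Unit) (f := f) (D := D) (g := fun _ _ => PMF.pure ()) (s := ())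
    (Tb := Tb) (qb := qb) (fun k _ => Rel k) hit hiN htN hib hNb hN h0 fun k hk _ τ => hb k hk τ
  obtain ⟨s', hs⟩ := itr_pure (fun _ (_ : Unit) => ()) 0 M ()
  rw [hs] at this
  exact this

/-- A loop that fills the cells `off, …, off + M - 1` of an array. -/
theorem det_fill {i t N A : ℕ} {body : Prog} {M Tb : ℕ} (off : ℕ) (val : ℕ → ℕ) {σ : St}
    (hit : i ≠ t) (hiN : i ≠ N) (htN : t ≠ N) (hib : i ∉ wr body) (hNb : N ∉ wr body)
    (hst : (straight body && (Nat.ble (cost body) Tb && Nat.ble (qcost body) 0)) = true) (hN : σ.reg N = M)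
    (hb : ∀ k < M, ∀ τ, Fr (forUp i t N body) σ τ → τ.reg i = k →
      -- The cells not yet reached keep their old content, so a body may read the cell that it
      -- overwrites; arrays can thus be updated in place.
      (∀ x, off + k ≤ x → τ.arr A x = σ.arr A x) →
      (ev f body τ).arr A = Function.update (τ.arr A) (off + k) (val k)) :
    Det f D (forUp i t N body) (M * (Tb + 8) + 6) 0 σ fun τ =>
      (∀ k < M, τ.arr A (off + k) = val k) ∧
        ∀ x, (x < off ∨ off + M ≤ x) → τ.arr A x = σ.arr A x := by
  have := det_for (f := f) (D := D) (σ := σ) (Tb := Tb) (qb := fun _ => 0)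
    (fun k τ => (∀ j < k, τ.arr A (off + j) = val j) ∧
      ∀ x, (x < off ∨ off + k ≤ x) → τ.arr A x = σ.arr A x) hit hiN htN hib hNb hN ?_ ?_
  · simpa using this
  · rintro τ - ha -
    simp [ha]
  · rintro k hk τ hf ⟨h1, h2⟩ hi -
    refine det_ev _ _ _ hst ?_
    intro τ'' ha _
    rw [ha, hb k hk τ hf hi fun x hx => h2 x (.inr hx)]
    refine ⟨fun j hj => ?_, fun x hx => ?_⟩
    · by_cases hjk : j = k
      · subst hjk; simp
      · rw [Function.update_of_ne (by omega)]; exact h1 j (by omega)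
    · rw [Function.update_of_ne (by omega)]; exact h2 x (by omega)

end Tri

/-! ### Testing literals -/

section Literals

variable {n : ℕ}

abbrev Str (n : ℕ) := Fin n → Bool

def bx (x y : Str n) : Str n := fun i => xor (x i) (y i)

def ba (x y : Str n) : Str n := fun i => x i && y i

def zs : Str n := fun _ => false

theorem bx_assoc (x y z : Str n) : bx (bx x y) z = bx x (bx y z) := by
  ext i; simp [bx]

theorem bx_comm (x y : Str n) : bx x y = bx y x := by
  ext i; simp [bx, Bool.xor_comm]

theorem bx_cancel (x y : Str n) : bx x (bx x y) = y := by
  ext i; simp [bx]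

@[simp] theorem bx_self (x : Str n) : bx x x = zs := by
  ext i; simp [bx, zs]

@[simp] theorem bx_zs (x : Str n) : bx x zs = x := by
  ext i; simp [bx, zs]

def bxEquiv (x : Str n) : Str n ≃ Str n := ⟨bx x, bx x, bx_cancel x, bx_cancel x⟩

/-- The average over all strings. -/
noncomputable def av (g : Str n → ℝ) : ℝ := (∑ u, g u) / 2 ^ n

theorem av_const (c : ℝ) : av (fun _ : Str n => c) = c := by
  simp [av]

theorem av_add (g h : Str n → ℝ) : av (fun u => g u + h u) = av g + av h := by
  simp [av, Finset.sum_add_distrib, add_div]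

theorem av_sub (g h : Str n → ℝ) : av (fun u => g u - h u) = av g - av h := by
  simp [av, Finset.sum_sub_distrib, sub_div]

theorem av_mul_left (c : ℝ) (g : Str n → ℝ) : av (fun u => c * g u) = c * av g := by
  simp [av, ← Finset.mul_sum, mul_div_assoc]

theorem av_mono {g h : Str n → ℝ} (H : ∀ u, g u ≤ h u) : av g ≤ av h := by
  unfold av; gcongr; exact H _

theorem av_nonneg {g : Str n → ℝ} (H : ∀ u, 0 ≤ g u) : 0 ≤ av g := by
  simpa [av_const] using av_mono (g := fun _ => 0) H

theorem av_shift (x : Str n) (g : Str n → ℝ) : av (fun u => g (bx x u)) = av g := by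
  unfold av; congr 1; exact Equiv.sum_comp (bxEquiv x) g

/-- Indicator of a Boolean. -/
def ind (b : Bool) : ℝ := if b then 1 else 0

@[simp] theorem ind_true : ind true = 1 := rfl
@[simp] theorem ind_false : ind false = 0 := rfl
theorem ind_nonneg (b : Bool) : 0 ≤ ind b := by cases b <;> simp
theorem ind_le_one (b : Bool) : ind b ≤ 1 := by cases b <;> simp

theorem exists_false_of_av_lt {p : Str n → Bool} (h : av (fun u => ind (p u)) < 1) :
    ∃ u, p u = false := by
  by_contra! H
  simp only [ne_eq, Bool.not_eq_false] at H
  simp [H, av_const] at h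

/-- The error of the linearity test. -/
noncomputable def linErr (g : Str n → Bool) : ℝ :=
  av fun u => av fun v => ind (xor (g u) (xor (g v) (g (bx u v))))

/-- The error of the test for multiplicativity, with self-correction. -/
noncomputable def conjErr (g : Str n → Bool) : ℝ :=
  av fun u => av fun v => av fun z =>
    ind (xor (xor (g (bx (ba u v) z)) (g z)) (g u && g v))

noncomputable def majority (g : Str n → Bool) (x : Str n) : Bool :=
  decide (1 / 2 ≤ av fun u => ind (xor (g (bx x u)) (g u)))

/-- Let `p` be the probability that `g (x + u) + g u` is true. Two independent copies differ with
probability `2 * p * (1 - p)`, which is at least the smaller of `p` and `1 - p`. If they differ,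
then one of the linearity tests at `(x + u, v)` and `(u, x + v)` fails, since both involve the same
sum `x + u + v`. -/
theorem majority_err (g : Str n → Bool) (x : Str n) :
    av (fun u => ind (xor (xor (g (bx x u)) (g u)) (majority g x))) ≤ 2 * linErr g := by
  set A : Str n → Bool := fun u => xor (g (bx x u)) (g u)
  set p := av fun u => ind (A u)
  have hp0 : 0 ≤ p := av_nonneg fun _ => ind_nonneg _
  have hp1 : p ≤ 1 := by
    have := av_mono (fun u => ind_le_one (A u)); rwa [av_const] at this
  have hq : av (fun u => ind (!(A u))) = 1 - p := by
    rw [← av_const (n := n) 1, ← av_sub]; congr 1; ext u; cases A u <;> simp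
  have hcol : av (fun u => av fun v => ind (xor (A u) (A v))) = 2 * (p * (1 - p)) := by
    have : ∀ u, av (fun v => ind (xor (A u) (A v))) =
        (1 - p) * ind (A u) + p * ind (!(A u)) := by
      intro u
      cases h : A u <;> simp [hq, p]
    simp only [this]
    rw [av_add, av_mul_left, av_mul_left, hq]; ring
  have hle : av (fun u => av fun v => ind (xor (A u) (A v))) ≤ 2 * linErr g := by
    set B : Str n → Str n → ℝ := fun u v => ind (xor (g u) (xor (g v) (g (bx u v))))
    have h1 : av (fun u => av fun v => B (bx x u) v) = linErr g :=
      av_shift x fun u => av fun v => B u v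
    have h2 : av (fun u => av fun v => B u (bx x v)) = linErr g := by
      unfold linErr; congr 1; ext u; exact av_shift x fun v => B u v
    rw [two_mul]; nth_rewrite 1 [← h1]; rw [← h2, ← av_add]
    refine av_mono fun u => ?_
    rw [← av_add]
    refine av_mono fun v => ?_
    have e : bx (bx x u) v = bx u (bx x v) := by
      rw [bx_comm x u, bx_assoc]
    simp only [B, A, e]
    cases g (bx x u) <;> cases g u <;> cases g (bx x v) <;> cases g v <;>
      cases g (bx u (bx x v)) <;> simp
  by_cases h : 1 / 2 ≤ p
  · have hm : majority g x = true := by simpa [majority] using h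
    rw [hm]
    have : av (fun u => ind (xor (A u) true)) = 1 - p := by simpa using hq
    rw [this]; nlinarith
  · have hm : majority g x = false := by simpa [majority] using h
    rw [hm]
    have : av (fun u => ind (xor (A u) false)) = p := by simp [p]
    rw [this]; nlinarith

/-- For a random `u`, each of the three majority values is attained by its sample with error below
1/3. Hence some `u` is good for all three, and there the samples telescope. -/
theorem majority_linear (g : Str n → Bool) (hg : linErr g < 1 / 6) (x y : Str n) :
    majority g (bx x y) = xor (majority g x) (majority g y) := by
  have h1 := majority_err g x
  have h2 := majority_err g (bx x y)
  have h3 := majority_err g y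
  rw [← av_shift x] at h3
  obtain ⟨u, hu⟩ := exists_false_of_av_lt (p := fun u =>
    (xor (xor (g (bx x u)) (g u)) (majority g x)) ||
      ((xor (xor (g (bx (bx x y) u)) (g u)) (majority g (bx x y))) ||
      (xor (xor (g (bx y (bx x u))) (g (bx x u))) (majority g y)))) (by
    refine lt_of_le_of_lt (av_mono (h := fun u => ind (xor (xor (g (bx x u)) (g u)) (majority g x))
      + (ind (xor (xor (g (bx (bx x y) u)) (g u)) (majority g (bx x y))) +
      ind (xor (xor (g (bx y (bx x u))) (g (bx x u))) (majority g y)))) fun u => ?_) ?_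
    · generalize (xor (xor (g (bx x u)) (g u)) (majority g x)) = a
      generalize (xor (xor (g (bx (bx x y) u)) (g u)) (majority g (bx x y))) = b
      generalize (xor (xor (g (bx y (bx x u))) (g (bx x u))) (majority g y)) = c
      cases a <;> cases b <;> cases c <;> norm_num
    · rw [av_add, av_add]; linarith)
  have e : bx y (bx x u) = bx (bx x y) u := by rw [bx_comm x y, bx_assoc]
  rw [e] at hu
  revert hu
  cases g (bx x u) <;> cases g u <;> cases g (bx (bx x y) u) <;> cases majority g x <;>
    cases majority g y <;> cases majority g (bx x y) <;> simp

/-- If `g u` is not the majority value, then for each `v` either the sample `g (u + v) + g v` misses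
the majority or the linearity test at `(u, v)` fails. -/
theorem majority_close (g : Str n → Bool) :
    av (fun u => ind (xor (g u) (majority g u))) ≤ 3 * linErr g := by
  have h1 : av (fun u => av fun v => ind (xor (xor (g (bx u v)) (g v)) (majority g u))) ≤
      2 * linErr g := by
    rw [← av_const (n := n) (2 * linErr g)]
    exact av_mono fun u => majority_err g u
  have h2 : av (fun u => ind (xor (g u) (majority g u))) ≤
      av (fun u => av fun v => ind (xor (xor (g (bx u v)) (g v)) (majority g u))) + linErr g := by
    rw [linErr, ← av_add]
    refine av_mono fun u => ?_
    rw [← av_add, ← av_const (n := n) (ind (xor (g u) (majority g u)))]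
    refine av_mono fun v => ?_
    cases g u <;> cases g v <;> cases g (bx u v) <;> cases majority g u <;> simp
  linarith

/-- The `i`-th unit string. -/
def unitStr (i : Fin n) : Str n := fun j => decide (j = i)

theorem linear_eq_of_units {φ : Str n → Bool} (hφ : ∀ x y, φ (bx x y) = xor (φ x) (φ y))
    (S : Finset (Fin n)) (hS : ∀ i ∉ S, φ (unitStr i) = false) (x : Str n) :
    φ x = φ (fun i => x i && decide (i ∈ S)) := by
  have h0 : φ zs = false := by simpa using hφ zs zs
  have key : ∀ T : Finset (Fin n), Disjoint T S → φ (fun i => x i && decide (i ∈ T)) = false := by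
    intro T
    induction T using Finset.induction_on with
    | empty => intro _; rw [← h0]; congr 1; ext i; simp [zs]
    | insert i T hi ih =>
      intro hd
      rw [Finset.disjoint_insert_left] at hd
      have e : (fun j => x j && decide (j ∈ insert i T)) =
          bx (fun j => x j && decide (j ∈ T)) (if x i then unitStr i else zs) := by
        ext j
        by_cases hj : j = i
        · subst hj; cases hx : x j <;> simp [bx, unitStr, zs, hi, hx]
        · cases hx : x i <;> simp [bx, unitStr, zs, hj]
      rw [e, hφ, ih hd.2]
      cases hx : x i <;> simp [hS i hd.1, h0]
  have e : x = bx (fun i => x i && decide (i ∈ S)) (fun i => x i && decide (i ∈ Sᶜ)) := by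
    ext i; by_cases hi : i ∈ S <;> simp [bx, hi]
  nth_rewrite 1 [e]
  rw [hφ, key _ disjoint_compl_left, Bool.xor_false]

/-- Suppose `i ≠ j`. Consider the four pairs obtained from `(u, v)` by optionally adding the `i`-th
unit string to `u` and the `j`-th to `v`. The two unit strings have product zero, so the four values
of `φ` at the products sum to zero, while the four products of values sum to one. At least one of
the pairs violates multiplicativity, and each pair is uniformly distributed. -/
theorem linear_conj {φ : Str n → Bool} (hφ : ∀ x y, φ (bx x y) = xor (φ x) (φ y))
    (h : av (fun u => av fun v => ind (xor (φ (ba u v)) (φ u && φ v))) < 1 / 4) (i j : Fin n)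
    (hi : φ (unitStr i) = true) (hj : φ (unitStr j) = true) : i = j := by
  by_contra hij
  set B : Str n → Str n → ℝ := fun u v => ind (xor (φ (ba u v)) (φ u && φ v))
  have h1 : av (fun u => av fun v => B (bx (unitStr i) u) v) = av fun u => av fun v => B u v :=
    av_shift _ fun u => av fun v => B u v
  have h2 : av (fun u => av fun v => B u (bx (unitStr j) v)) = av fun u => av fun v => B u v := by
    congr 1; ext u; exact av_shift _ fun v => B u v
  have h3 : av (fun u => av fun v => B (bx (unitStr i) u) (bx (unitStr j) v)) =
      av fun u => av fun v => B u v := by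
    rw [← h2]; exact av_shift _ fun u => av fun v => B u (bx (unitStr j) v)
  have h0 : φ zs = false := by simpa using hφ zs zs
  have hB : (1 : ℝ) ≤ av fun u => av fun v => B u v + (B (bx (unitStr i) u) v +
      (B u (bx (unitStr j) v) + B (bx (unitStr i) u) (bx (unitStr j) v))) := by
    rw [← av_const (n := n) 1]
    refine av_mono fun u => ?_
    rw [← av_const (n := n) 1]
    refine av_mono fun v => ?_
    have e1 : ba (bx (unitStr i) u) v = bx (ba (unitStr i) v) (ba u v) := by
      ext k; simp [ba, bx, Bool.and_xor_distrib_right]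
    have e2 : ba u (bx (unitStr j) v) = bx (ba u (unitStr j)) (ba u v) := by
      ext k; simp [ba, bx, Bool.and_xor_distrib_left]
    have e4 : ba (unitStr i) (unitStr j) = zs := by
      ext k
      by_cases hk : k = i
      · subst hk; simp [ba, unitStr, zs, hij]
      · simp [ba, unitStr, zs, hk]
    have e3 : ba (bx (unitStr i) u) (bx (unitStr j) v) =
        bx (ba (unitStr i) v) (bx (ba u (unitStr j)) (ba u v)) := by
      have : ba (bx (unitStr i) u) (bx (unitStr j) v) =
          bx (ba (unitStr i) (unitStr j)) (bx (ba (unitStr i) v)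
            (bx (ba u (unitStr j)) (ba u v))) := by
        ext k
        simp only [ba, bx]
        cases unitStr i k <;> cases unitStr j k <;> cases u k <;> cases v k <;> rfl
      rw [this, e4, bx_comm, bx_zs]
    simp only [B, e1, e2, e3, hφ, hi, hj]
    cases φ (ba (unitStr i) v) <;> cases φ (ba u (unitStr j)) <;> cases φ (ba u v) <;>
      cases φ u <;> cases φ v <;> norm_num
  simp only [av_add] at hB
  rw [h1, h2, h3] at hB
  linarith

/-- Passing from `g` to its self-correction costs `2 * linErr g` at the product and `3 * linErr g`
at each factor, so the self-correction is linear with multiplicativity error below 9/64. By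
`linear_conj` it depends on at most one variable. The last clause, that `g` itself depends on this
variable, later locates the variable in the right block. -/
theorem majority_dictator (g : Str n → Bool) (h1 : linErr g < 1 / 64) (h2 : conjErr g < 1 / 64) :
    (∀ x, majority g x = false) ∨ ∃ i, (∀ x, majority g x = x i) ∧
      ∃ u, g (bx (unitStr i) u) ≠ g u := by
  have hlin := majority_linear g (by linarith)
  have hconj : av (fun u => av fun v => ind (xor (majority g (ba u v))
      (majority g u && majority g v))) < 1 / 4 := by
    set M := majority g
    have a1 : av (fun u => av fun v => av fun z =>
        ind (xor (xor (g (bx (ba u v) z)) (g z)) (M (ba u v)))) ≤ 2 * linErr g := by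
      rw [← av_const (n := n) (2 * linErr g)]
      refine av_mono fun u => ?_
      rw [← av_const (n := n) (2 * linErr g)]
      exact av_mono fun v => majority_err g _
    have a2 : av (fun u => av fun _ : Str n => ind (xor (g u) (M u))) ≤ 3 * linErr g := by
      simp only [av_const]; exact majority_close g
    have a3 : av (fun _ : Str n => av fun v => ind (xor (g v) (M v))) ≤ 3 * linErr g := by
      rw [av_const]; exact majority_close g
    have a4 : av (fun u => av fun v => ind (xor (M (ba u v)) (M u && M v))) ≤
        conjErr g + (av (fun u => av fun v => av fun z =>
        ind (xor (xor (g (bx (ba u v) z)) (g z)) (M (ba u v)))) +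
        (av (fun u => av fun _ : Str n => ind (xor (g u) (M u))) +
        av (fun _ : Str n => av fun v => ind (xor (g v) (M v))))) := by
      rw [conjErr, ← av_add, ← av_add, ← av_add]
      refine av_mono fun u => ?_
      rw [← av_add, ← av_add, ← av_add]
      refine av_mono fun v => ?_
      rw [← av_const (n := n) (ind (xor (g u) (M u)) + _),
        ← av_const (n := n) (ind (xor (M (ba u v)) _)), ← av_add, ← av_add]
      refine av_mono fun z => ?_
      cases M (ba u v) <;> cases M u <;> cases M v <;> cases g u <;> cases g v <;>
        cases g (bx (ba u v) z) <;> cases g z <;> norm_num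
    linarith
  have huniq := linear_conj hlin hconj
  have h0 : majority g zs = false := by simpa using hlin zs zs
  by_cases hex : ∃ i, majority g (unitStr i) = true
  · obtain ⟨i, hi⟩ := hex
    refine .inr ⟨i, fun x => ?_, ?_⟩
    · rw [linear_eq_of_units hlin {i} (fun j hj => ?_) x]
      · cases hx : x i
        · convert h0 using 2
          ext j; by_cases hj : j = i
          · subst hj; simp [hx, zs]
          · simp [hj, zs]
        · convert hi using 2
          ext j; by_cases hj : j = i
          · subst hj; simp [hx, unitStr]
          · simp [hj, unitStr]
      · rw [← Bool.not_eq_true]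
        exact fun h => hj (by simpa using huniq j i h hi)
    · obtain ⟨u, hu⟩ := exists_false_of_av_lt (lt_of_le_of_lt (majority_err g (unitStr i))
        (by linarith))
      refine ⟨u, fun he => ?_⟩
      rw [hi, he] at hu
      simp at hu
  · push Not at hex
    refine .inl fun x => ?_
    rw [linear_eq_of_units hlin ∅ (fun j _ => by simpa using hex j) x]
    rw [← h0]; congr 1; ext i; simp [zs]

/-- All tests of the function `h` passed, and the test whether `h` has the right value at `x`. -/
def litOK (mono : Bool) (h : Str n → Bool) (x u v z : Str n) : Bool :=
  !(mono && h zs) && (!(xor (xor (h u) (h v)) (xor (h (bx u v)) (h zs))) &&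
    (!(xor (xor (h (bx (ba u v) z)) (h z)) (xor (h u) (h zs) && xor (h v) (h zs))) &&
      !(xor (xor (h (bx x z)) (h z)) (xor (h zs) (h x)))))

noncomputable def passAv (mono : Bool) (h : Str n → Bool) (x : Str n) : ℝ :=
  av fun u => av fun v => av fun z => ind (litOK mono h x u v z)

/-- `w` is constant, or a literal of a variable on which `h` depends. -/
def IsLit (mono : Bool) (h w : Str n → Bool) : Prop :=
  (∃ c, ∀ x, w x = c) ∨ ∃ i o, (mono = true → o = false) ∧ (∀ x, w x = xor (x i) o) ∧
    ∃ u, h (bx (unitStr i) u) ≠ h u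

/-- If some `x` passes with probability above 63/64, both test errors are below 1/64 and the
self-correction is zero or a dictator; `w` is this function shifted by `h zs`. Where `h` differs
from `w`, the self-corrected value contradicts the direct one except with probability `2 * linErr`,
which is far below 1/2. -/
theorem lit_sound (mono : Bool) (h : Str n → Bool) :
    (∀ x, passAv mono h x ≤ 63 / 64) ∨
      ∃ w, IsLit mono h w ∧ ∀ x, h x ≠ w x → passAv mono h x ≤ 1 / 2 := by
  by_contra! H
  obtain ⟨⟨x₀, hx₀⟩, H⟩ := H
  set g : Str n → Bool := fun y => xor (h y) (h zs)
  have h1 : linErr g ≤ 1 - passAv mono h x₀ := by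
    rw [linErr, passAv, ← av_const (n := n) 1, ← av_sub]
    refine av_mono fun u => ?_
    rw [← av_const (n := n) 1, ← av_sub]
    refine av_mono fun v => ?_
    rw [← av_const (n := n) 1, ← av_const (n := n) (ind _), ← av_sub]
    refine av_mono fun z => ?_
    simp only [litOK, g]
    generalize (mono && h zs) = b1
    generalize (xor (xor (h (bx (ba u v) z)) (h z)) _) = b2
    generalize (xor (xor (h (bx x₀ z)) (h z)) _) = b3
    cases b1 <;> cases b2 <;> cases b3 <;> cases h u <;> cases h v <;> cases h (bx u v) <;>
      cases h zs <;> simp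
  have h2 : conjErr g ≤ 1 - passAv mono h x₀ := by
    rw [conjErr, passAv, ← av_const (n := n) 1, ← av_sub]
    refine av_mono fun u => ?_
    rw [← av_const (n := n) 1, ← av_sub]
    refine av_mono fun v => ?_
    rw [← av_const (n := n) 1, ← av_sub]
    refine av_mono fun z => ?_
    simp only [litOK, g]
    generalize (mono && h zs) = b1
    generalize (xor (xor (h u) (h v)) _) = b2
    generalize (xor (xor (h (bx x₀ z)) (h z)) _) = b3
    cases b1 <;> cases b2 <;> cases b3 <;> cases h u <;> cases h v <;> cases h (bx (ba u v) z) <;>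
      cases h zs <;> cases h z <;> simp
  have hmono : mono = true → h zs = false := by
    intro hm
    by_contra hz
    rw [Bool.not_eq_false] at hz
    simp only [passAv, litOK, hm, hz, Bool.and_self, Bool.not_true, Bool.false_and, ind_false,
      av_const] at hx₀
    norm_num at hx₀
  obtain ⟨x, hx, hx'⟩ := H (fun x => xor (majority g x) (h zs)) (by
    rcases majority_dictator g (by linarith) (by linarith) with h' | ⟨i, hi, u, hu⟩
    · exact .inl ⟨h zs, fun x => by simp [h']⟩
    · refine .inr ⟨i, h zs, hmono, fun x => by simp [hi], u, fun he => hu ?_⟩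
      simp [g, he])
  have h3 : passAv mono h x ≤ 2 * linErr g := by
    rw [passAv, ← av_const (n := n) (2 * linErr g)]
    refine av_mono fun u => ?_
    rw [← av_const (n := n) (2 * linErr g)]
    refine av_mono fun v => ?_
    refine le_trans (av_mono fun z => ?_) (majority_err g x)
    simp only [litOK, g] at hx ⊢
    generalize (mono && h zs) = b1
    generalize (xor (xor (h u) (h v)) _) = b2
    generalize (xor (xor (h (bx (ba u v) z)) (h z)) _) = b3
    revert hx
    generalize majority _ x = b4
    cases b1 <;> cases b2 <;> cases b3 <;> cases b4 <;> cases h x <;> cases h (bx x z) <;>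
      cases h zs <;> cases h z <;> simp
  linarith

end Literals

/-! ### The tester as a random process -/

section Algorithm

variable {n : ℕ}

/-- `x` on the blocks in `S` and `a` on the other blocks. -/
def mix (hv : Fin n → ℕ) (S : ℕ → Bool) (x a : Str n) : Str n :=
  fun i => if S (hv i) then x i else a i

/-- As `p` grows from `0` to `2 ^ d` these sets lead from `F` to the union of `F` and `G` one block
at a time; binary search takes place on this path. -/
def mask (F G : ℕ → Bool) (p b : ℕ) : Bool := F b || (G b && decide (b < p))

theorem mask_zero (F G : ℕ → Bool) : mask F G 0 = F := by
  ext b; simp [mask]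

def vl (f : BoolFn n) (hv : Fin n → ℕ) (F G : ℕ → Bool) (x a : Str n) (p : ℕ) : Bool :=
  f (mix hv (mask F G p) x a)

/-- Binary search for a place where `val` changes its value. -/
def srchFrom (val : ℕ → Bool) : ℕ → ℕ → ℕ
  | 0, p => p
  | j + 1, p => srchFrom val j (if val (p + 2 ^ j) = val 0 then p + 2 ^ j else p)

def srch (val : ℕ → Bool) (d : ℕ) : ℕ := srchFrom val d 0

def mem (X : Finset ℕ) (b : ℕ) : Bool := decide (b ∈ X)

def every (_ : ℕ) : Bool := true

/-- Here `a` is the reference string, `X` the set of blocks found, `base b` the witness string of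
block `b`, `cnt` the current number of consecutive agreements and `K` the number of searches made.
-/
structure Phase1 (n : ℕ) where
  a : Str n
  X : Finset ℕ
  base : ℕ → Str n
  cnt : ℕ
  K : ℕ

def Phase1.first (n : ℕ) : Phase1 n := ⟨zs, ∅, fun _ => zs, 0, 0⟩

/-- The value at `x` with the blocks outside `X` frozen. -/
def Phase1.fn (f : BoolFn n) (hv : Fin n → ℕ) (σ : Phase1 n) : BoolFn n :=
  fun x => f (mix hv (mem σ.X) x σ.a)

/-- Search for a relevant block outside `X`. -/
def step1 (f : BoolFn n) (hv : Fin n → ℕ) (d k N : ℕ) (x : Str n) (σ : Phase1 n) : Phase1 n :=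
  if σ.cnt < N then
    if vl f hv (mem σ.X) every x σ.a 0 = f x then { σ with cnt := σ.cnt + 1 }
    else if σ.K < k then
      -- The reference shall falsify the literal of the new block. If the value before the change is
      -- true, then moving the block from `a` to `x` makes it false, so the side of `x` is the right
      -- one; otherwise `a` is.
      { a := if vl f hv (mem σ.X) every x σ.a 0 then
          mix hv (fun b => b == srch (vl f hv (mem σ.X) every x σ.a) d) x σ.a else σ.a
        X := insert (srch (vl f hv (mem σ.X) every x σ.a) d) σ.X
        base := Function.update σ.base (srch (vl f hv (mem σ.X) every x σ.a) d)
          (mix hv (mask (mem σ.X) every (srch (vl f hv (mem σ.X) every x σ.a) d)) x σ.a)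
        cnt := 0
        K := σ.K + 1 }
    -- The count `N + 1` stops the search and fails the final comparison with `N`: too many relevant
    -- blocks.
    else { σ with cnt := N + 1 }
  else σ

/-- The tentative literal of a block. -/
def lit (f : BoolFn n) (hv : Fin n → ℕ) (base : ℕ → Str n) (b : ℕ) : Str n → Bool :=
  fun y => f (mix hv (fun c => c == b) y (base b))

/-- `r` rounds of the search for a minimal set of blocks which makes the value true. -/
def greedy (f : BoolFn n) (hv : Fin n → ℕ) (X : Finset ℕ) (d : ℕ) (x a : Str n) : ℕ → Finset ℕ
  | 0 => ∅
  | r + 1 =>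
    if vl f hv (mem (greedy f hv X d x a r)) (mem X) x a 0 then greedy f hv X d x a r
    else insert (srch (vl f hv (mem (greedy f hv X d x a r)) (mem X) x a) d) (greedy f hv X d x a r)

structure Phase2 where
  tms : List (Finset ℕ)
  rej : Bool

/-- The current hypothesis. -/
def hyp (f : BoolFn n) (hv : Fin n → ℕ) (σ : Phase1 n) (tms : List (Finset ℕ)) : BoolFn n :=
  fun x => decide (∃ T ∈ tms, ∀ b ∈ T, b ∈ σ.X → lit f hv σ.base b x = true)

def litsOK (mono : Bool) (f : BoolFn n) (hv : Fin n → ℕ) (σ : Phase1 n) (x u v z : Str n) : Bool :=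
  decide (∀ b ∈ σ.X, litOK mono (lit f hv σ.base b) x u v z = true)

/-- A true value missed by the hypothesis is repaired by a further term, which a member requires at
most `s` times. The opposite disagreement, a failed literal test and a greedy search that does not
succeed never occur for a member whose relevant variables are separated by the hash, so they may
reject. -/
def step2 (mono : Bool) (f : BoolFn n) (hv : Fin n → ℕ) (d s r : ℕ) (σ : Phase1 n)
    (x u v z : Str n) (τ : Phase2) : Phase2 :=
  if σ.fn f hv x = true ∧ hyp f hv σ τ.tms x = false then
    if τ.tms.length < s then
      ⟨τ.tms ++ [greedy f hv σ.X d x σ.a r], τ.rej || !litsOK mono f hv σ x u v z ||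
        !vl f hv (mem (greedy f hv σ.X d x σ.a r)) (mem σ.X) x σ.a 0⟩
    else ⟨τ.tms, true⟩
  else ⟨τ.tms, τ.rej || !litsOK mono f hv σ x u v z || (hyp f hv σ τ.tms x && !σ.fn f hv x)⟩

noncomputable def unif (n : ℕ) : PMF (Str n) := PMF.uniformOfFintype _

noncomputable def hashGen (n d : ℕ) : PMF (Fin n → ℕ) :=
  itr (fun _ h => (unif n).bind fun u => PMF.pure fun i => 2 * h i + (u i).toNat) 0 d fun _ => 0

noncomputable def phase1 (f : BoolFn n) (D : PMF (Str n)) (hv : Fin n → ℕ) (d k N R : ℕ) :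
    PMF (Phase1 n) :=
  itr (fun _ σ => D.bind fun x => PMF.pure (step1 f hv d k N x σ)) 0 R (Phase1.first n)

noncomputable def phase2 (mono : Bool) (f : BoolFn n) (D : PMF (Str n)) (hv : Fin n → ℕ)
    (d s r R : ℕ) (σ : Phase1 n) : PMF Phase2 :=
  itr (fun _ τ => D.bind fun x => (unif n).bind fun u => (unif n).bind fun v => (unif n).bind fun z =>
    PMF.pure (step2 mono f hv d s r σ x u v z τ)) 0 R ⟨[], false⟩

/-- The answer of the tester. -/
noncomputable def answer (mono : Bool) (f : BoolFn n) (D : PMF (Str n)) (d k s r N R₁ R₂ : ℕ) :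
    PMF Bool :=
  (hashGen n d).bind fun hv => (phase1 f D hv d k N R₁).bind fun σ =>
    (phase2 mono f D hv d s r R₂ σ).bind fun τ => PMF.pure (decide (σ.cnt = N) && !τ.rej)

end Algorithm

/-! ### Expectations -/

section Expect

noncomputable def ex {α : Type} (μ : PMF α) (g : α → ENNReal) : ENNReal := ∑' a, μ a * g a

theorem ex_pure {α : Type} (a : α) (g : α → ENNReal) : ex (PMF.pure a) g = g a := by
  rw [ex, tsum_eq_single a]
  · simp
  · intro b hb; simp [hb]

theorem ex_bind {α β : Type} (μ : PMF α) (κ : α → PMF β) (g : β → ENNReal) :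
    ex (μ.bind κ) g = ex μ fun a => ex (κ a) g := by
  simp only [ex, PMF.bind_apply]
  simp_rw [← ENNReal.tsum_mul_right, ← ENNReal.tsum_mul_left, mul_assoc]
  rw [ENNReal.tsum_comm]

theorem ex_mono {α : Type} (μ : PMF α) {g h : α → ENNReal} (H : ∀ a, g a ≤ h a) :
    ex μ g ≤ ex μ h :=
  ENNReal.tsum_le_tsum fun a => by gcongr; exact H a

theorem ex_const {α : Type} (μ : PMF α) (c : ENNReal) : ex μ (fun _ => c) = c := by
  rw [ex, ENNReal.tsum_mul_right, PMF.tsum_coe, one_mul]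

theorem ex_le {α : Type} (μ : PMF α) {g : α → ENNReal} {c : ENNReal} (H : ∀ a, g a ≤ c) :
    ex μ g ≤ c := by
  simpa [ex_const] using ex_mono μ H

theorem ex_add {α : Type} (μ : PMF α) (g h : α → ENNReal) :
    ex μ (fun a => g a + h a) = ex μ g + ex μ h := by
  simp only [ex, mul_add, ENNReal.tsum_add]

theorem ex_mul_left {α : Type} (μ : PMF α) (c : ENNReal) (g : α → ENNReal) :
    ex μ (fun a => c * g a) = c * ex μ g := by
  simp only [ex, ← ENNReal.tsum_mul_left]
  congr 1; ext a; ring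

theorem ex_sum {α ι : Type} (μ : PMF α) (s : Finset ι) (g : ι → α → ENNReal) :
    ex μ (fun a => ∑ i ∈ s, g i a) = ∑ i ∈ s, ex μ (g i) := by
  classical
  induction s using Finset.induction_on with
  | empty => simp [ex_const]
  | insert i s hi ih => simp only [Finset.sum_insert hi, ex_add, ih]

theorem ex_le_of_support {α : Type} (μ : PMF α) {g h : α → ENNReal}
    (H : ∀ a ∈ μ.support, g a ≤ h a) : ex μ g ≤ ex μ h := by
  refine ENNReal.tsum_le_tsum fun a => ?_
  by_cases ha : μ a = 0
  · simp [ha]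
  · gcongr; exact H a (by simpa using ha)

/-- The indicator of a proposition. -/
noncomputable def chi (p : Prop) : ENNReal := open Classical in if p then 1 else 0

theorem chi_of {p : Prop} (h : p) : chi p = 1 := by simp [chi, h]
theorem chi_not {p : Prop} (h : ¬p) : chi p = 0 := by simp [chi, h]
theorem chi_le_one (p : Prop) : chi p ≤ 1 := by unfold chi; split_ifs <;> simp
theorem chi_mono {p q : Prop} (h : p → q) : chi p ≤ chi q := by
  by_cases hp : p
  · rw [chi_of hp, chi_of (h hp)]
  · rw [chi_not hp]; exact zero_le

theorem ex_chi {α : Type} (μ : PMF α) (p : α → Prop) :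
    ex μ (fun a => chi (p a)) = μ.toOuterMeasure {a | p a} := by
  rw [ex, PMF.toOuterMeasure_apply]
  congr 1; ext a
  by_cases h : p a
  · simp [chi, h]
  · simp [chi, h]

theorem ex_chi_add_not {α : Type} (μ : PMF α) (p : α → Prop) :
    ex μ (fun a => chi (p a)) + ex μ (fun a => chi (¬p a)) = 1 := by
  rw [← ex_add, ← ex_const μ 1]
  congr 1; ext a
  by_cases h : p a <;> simp [chi, h]

theorem ex_unif {n : ℕ} (g : Str n → ℝ) (hg : ∀ u, 0 ≤ g u) :
    ex (unif n) (fun u => ENNReal.ofReal (g u)) = ENNReal.ofReal (av g) := by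
  rw [ex, tsum_fintype, av, ENNReal.ofReal_div_of_pos (by positivity),
    ENNReal.ofReal_sum_of_nonneg fun u _ => hg u, ENNReal.div_eq_inv_mul, Finset.mul_sum]
  refine Finset.sum_congr rfl fun u _ => ?_
  congr 1
  simp [unif, ENNReal.ofReal_pow]

theorem itr_support {S : Type} {g : ℕ → S → PMF S} (I : ℕ → S → Prop)
    (hI : ∀ k s, I k s → ∀ s' ∈ (g k s).support, I (k + 1) s') {k N : ℕ} {s : S} (h : I k s) :
    ∀ s' ∈ (itr g k N s).support, I (k + N) s' := by
  induction N generalizing k s with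
  | zero =>
    intro s' hs
    rw [itr, PMF.mem_support_pure_iff] at hs
    subst hs; exact h
  | succ N ih =>
    intro s' hs
    rw [itr, PMF.mem_support_bind_iff] at hs
    obtain ⟨s₁, h1, h2⟩ := hs
    have := ih (hI k s h s₁ h1) s' h2
    rwa [show k + (N + 1) = k + 1 + N by omega]

end Expect

/-! ### The two classes -/

section Classes

variable {n : ℕ}

def cls (mono : Bool) (n s r : ℕ) : Set (BoolFn n) :=
  if mono then sTermMonotoneRDNF n s r else sTermUnateRDNF n s r

theorem mem_sTermMonotoneRDNF {s r : ℕ} {f : BoolFn n} :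
    f ∈ sTermMonotoneRDNF n s r ↔ ∃ tt : Finset (Finset (Fin n)), tt.card ≤ s ∧
      (∀ t ∈ tt, t.card ≤ r) ∧ ∀ x, f x = decide (∃ t ∈ tt, ∀ i ∈ t, x i = true) := by
  constructor
  · rintro ⟨F, hs, hr, hm, rfl⟩
    refine ⟨F.image fun t => t.image Prod.fst, Finset.card_image_le.trans hs, ?_, fun x => ?_⟩
    · intro t ht
      obtain ⟨t', ht', rfl⟩ := Finset.mem_image.1 ht
      exact Finset.card_image_le.trans (hr t' ht')
    · rw [DNF.eval]
      congr 1
      simp only [Finset.mem_image, exists_exists_and_eq_and, Term.eval, decide_eq_true_eq, eq_iff_iff]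
      refine exists_congr fun t => and_congr_right fun ht => ?_
      constructor
      · rintro h i ⟨l, hl, rfl⟩
        have := h l hl
        simpa [Literal.eval, hm t ht l hl] using this
      · intro h l hl
        simpa [Literal.eval, hm t ht l hl] using h l.1 ⟨l, hl, rfl⟩
  · rintro ⟨tt, hs, hr, hf⟩
    refine ⟨tt.image fun t => t.image fun i => (i, false), Finset.card_image_le.trans hs, ?_, ?_, ?_⟩
    · intro t ht
      obtain ⟨t', ht', rfl⟩ := Finset.mem_image.1 ht
      exact Finset.card_image_le.trans (hr t' ht')
    · intro t ht l hl
      obtain ⟨t', ht', rfl⟩ := Finset.mem_image.1 ht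
      obtain ⟨i, _, rfl⟩ := Finset.mem_image.1 hl
      rfl
    · ext x
      rw [hf, DNF.eval]
      congr 1
      simp [Term.eval, Literal.eval]

/-- Common normal form of both classes: terms are sets of variables, and one string `ξ` holds all
signs. In a unate function the sign of a variable is the same in every term. -/
theorem mem_cls {mono : Bool} {s r : ℕ} {f : BoolFn n} :
    f ∈ cls mono n s r ↔ ∃ (ξ : Str n) (tt : Finset (Finset (Fin n))), (mono = true → ξ = zs) ∧
      tt.card ≤ s ∧ (∀ t ∈ tt, t.card ≤ r) ∧
      ∀ x, f x = decide (∃ t ∈ tt, ∀ i ∈ t, xor (x i) (ξ i) = true) := by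
  cases mono
  · simp only [cls, Bool.false_eq_true, if_false, sTermUnateRDNF, Set.mem_ofPred_eq,
      mem_sTermMonotoneRDNF, false_imp_iff, true_and]
    refine exists_congr fun ξ => exists_congr fun tt => and_congr_right fun _ =>
      and_congr_right fun _ => ?_
    constructor
    · intro h x
      have := h fun i => xor (x i) (ξ i)
      simpa using this
    · intro h x
      have := h fun i => xor (x i) (ξ i)
      simpa using this
  · simp only [cls, if_true, mem_sTermMonotoneRDNF, forall_true_left]
    constructor
    · rintro ⟨tt, h⟩
      exact ⟨zs, tt, rfl, by simpa [zs] using h⟩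
    · rintro ⟨_, tt, rfl, h⟩
      exact ⟨tt, by simpa [zs] using h⟩

end Classes

/-! ### Completeness -/

section Complete

variable {n : ℕ}

/-- The invariant is that the value at `p` is the initial one and the value at `p + 2 ^ j` is not.
No monotonicity of `val` is needed. -/
theorem srchFrom_spec (val : ℕ → Bool) (j p : ℕ) (h0 : val p = val 0)
    (h1 : val (p + 2 ^ j) ≠ val 0) :
    val (srchFrom val j p) = val 0 ∧ val (srchFrom val j p + 1) ≠ val 0 := by
  induction j generalizing p with
  | zero => exact ⟨h0, h1⟩
  | succ j ih =>
    rw [srchFrom]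
    split_ifs with h
    · exact ih _ h (by rwa [add_assoc, ← two_mul, ← pow_succ'])
    · exact ih _ h0 h

theorem srch_spec (val : ℕ → Bool) (d : ℕ) (h : val (2 ^ d) ≠ val 0) :
    val (srch val d) = val 0 ∧ val (srch val d + 1) ≠ val 0 :=
  srchFrom_spec val d 0 rfl (by rwa [zero_add])

/-- A disjunction of conjunctions of literals `x i ≠ ξ i`, with a hash function that is injective on
the variables which occur. -/
structure Represents (f : BoolFn n) (hv : Fin n → ℕ) (d k s r : ℕ) (ξ : Str n)
    (tt : Finset (Finset (Fin n))) : Prop where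
  card_le : tt.card ≤ s
  term_card_le : ∀ t ∈ tt, t.card ≤ r
  eval : ∀ x, f x = decide (∃ t ∈ tt, ∀ i ∈ t, xor (x i) (ξ i) = true)
  var_card_le : (tt.biUnion id).card ≤ k
  inj : Set.InjOn hv (tt.biUnion id)
  lt : ∀ i, hv i < 2 ^ d

variable {f : BoolFn n} {hv : Fin n → ℕ} {d k s r : ℕ} {ξ : Str n} {tt : Finset (Finset (Fin n))}

theorem Represents.mono (H : Represents f hv d k s r ξ tt) {x y : Str n}
    (h : ∀ i ∈ tt.biUnion id, xor (x i) (ξ i) = true → xor (y i) (ξ i) = true) (hx : f x = true) :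
    f y = true := by
  rw [H.eval, decide_eq_true_eq] at hx ⊢
  obtain ⟨t, ht, hx⟩ := hx
  exact ⟨t, ht, fun i hi => h i (Finset.mem_biUnion.2 ⟨t, ht, hi⟩) (hx i hi)⟩

theorem Represents.congr (H : Represents f hv d k s r ξ tt) {x y : Str n}
    (h : ∀ i ∈ tt.biUnion id, x i = y i) : f x = f y := by
  rw [Bool.eq_iff_iff]
  exact ⟨H.mono fun i hi => by rw [h i hi]; exact id, H.mono fun i hi => by rw [h i hi]; exact id⟩

/-- For a member each block found holds exactly one relevant variable, the reference falsifies its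
literal, and the tentative literal of the block is the true one. -/
structure Sound1 (f : BoolFn n) (hv : Fin n → ℕ) (ξ : Str n) (V : Finset (Fin n))
    (σ : Phase1 n) : Prop where
  lits : ∀ b ∈ σ.X, ∃ i ∈ V, hv i = b ∧ σ.a i = ξ i ∧
    ∀ y, lit f hv σ.base b y = xor (y i) (ξ i)
  K_eq : σ.K = σ.X.card

theorem Sound1.K_le {V : Finset (Fin n)} {σ : Phase1 n} (h : Sound1 f hv ξ V σ) :
    σ.K ≤ V.card := by
  rw [h.K_eq]
  refine (Finset.card_le_card (t := V.image hv) fun b hb => ?_).trans Finset.card_image_le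
  obtain ⟨i, hi, rfl, -⟩ := h.lits b hb
  exact Finset.mem_image_of_mem _ hi

/-- The strings before and after the change differ only in block `p`, so the block contains a
relevant variable `i`, and only one by injectivity. On the block `f` is therefore a function of the
`i`-th bit; unateness gives the sign, and the choice of the new reference makes the literal false.
-/
theorem Represents.step1_new (H : Represents f hv d k s r ξ tt) {σ : Phase1 n}
    (h : Sound1 f hv ξ (tt.biUnion id) σ) (x : Str n) (p : ℕ)
    (hp : f (mix hv (mask (mem σ.X) every (p + 1)) x σ.a) ≠
      f (mix hv (mask (mem σ.X) every p) x σ.a)) (cnt : ℕ) :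
    Sound1 f hv ξ (tt.biUnion id)
      ⟨if f (mix hv (mask (mem σ.X) every p) x σ.a) then mix hv (fun b => b == p) x σ.a else σ.a,
        insert p σ.X,
        Function.update σ.base p (mix hv (mask (mem σ.X) every p) x σ.a), cnt, σ.K + 1⟩ := by
  set w := mix hv (mask (mem σ.X) every p) x σ.a with hw
  set w' := mix hv (mask (mem σ.X) every (p + 1)) x σ.a with hw'
  obtain ⟨i, hi, hne⟩ : ∃ i ∈ tt.biUnion id, w' i ≠ w i := by
    by_contra! hc; exact hp (H.congr hc)
  have hsame : ∀ j, hv j ≠ p → w' j = w j := by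
    intro j hj
    simp only [hw, hw', mix, mask, every, Bool.true_and]
    rw [show decide (hv j < p + 1) = decide (hv j < p) from decide_eq_decide.2 (by omega)]
  have hip : hv i = p := by by_contra hc; exact hne (hsame i hc)
  have hpX : p ∉ σ.X := by
    intro hX; apply hne; simp [hw, hw', mix, mask, mem, hip, hX]
  have hwi : w i = σ.a i := by simp [hw, mix, mask, mem, hip, hpX]
  have hwi' : w' i = x i := by simp [hw', mix, mask, mem, every, hip]
  have huniq : ∀ j ∈ tt.biUnion id, hv j = p → j = i := fun j hj hjp =>
    H.inj hj hi (hjp.trans hip.symm)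
  have hlit : ∀ y, f (mix hv (fun c => c == p) y w) = if y i = x i then f w' else f w := by
    intro y
    split_ifs with hy
    · refine H.congr fun j hj => ?_
      by_cases hjp : hv j = p
      · rw [huniq j hj hjp]; simp [mix, hip, hy, hwi']
      · rw [hsame j hjp]; simp [mix, hjp]
    · refine H.congr fun j hj => ?_
      by_cases hjp : hv j = p
      · rw [huniq j hj hjp]; simp only [mix, hip, beq_self_eq_true, if_true, hwi]
        rw [hwi, hwi'] at hne
        revert hne hy
        cases y i <;> cases x i <;> cases σ.a i <;> simp
      · simp [mix, hjp]
  -- Were the literal of `i` false at `y`, then passing from `y` to `z` would falsify no literal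
  -- that holds at `y`, and unateness would make `f z` true.
  have hup : ∀ y z : Str n, (∀ j, hv j ≠ p → y j = z j) → f y = true → f z = false →
      xor (y i) (ξ i) = true := by
    intro y z hyz hy hz
    by_contra hc
    have : f z = true := by
      refine H.mono (fun j hj hjy => ?_) hy
      by_cases hjp : hv j = p
      · rw [huniq j hj hjp] at hjy; exact absurd hjy hc
      · rwa [← hyz j hjp]
    rw [this] at hz; cases hz
  refine ⟨fun b hb => ?_, ?_⟩
  · dsimp only
    by_cases hbp : b = p
    · subst hbp
      refine ⟨i, hi, hip, ?_, fun y => ?_⟩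
      · rw [hwi, hwi'] at hne
        cases hv0 : f w
        · have h1 : f w' = true := by rw [hv0] at hp; simpa using hp
          have := hup w' w hsame h1 hv0
          rw [hwi'] at this
          revert hne this
          simp
          cases x i <;> cases ξ i <;> cases σ.a i <;> simp
        · have h1 : f w' = false := by rw [hv0] at hp; simpa using hp
          have := hup w w' (fun j hj => (hsame j hj).symm) hv0 h1
          rw [hwi] at this
          revert hne this
          simp [mix, hip]
          cases x i <;> cases ξ i <;> cases σ.a i <;> simp
      · simp only [lit, Function.update_self, hlit]
        rw [hwi, hwi'] at hne
        cases hv0 : f w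
        · have h1 : f w' = true := by rw [hv0] at hp; simpa using hp
          have := hup w' w hsame h1 hv0
          rw [hwi'] at this
          revert hne this
          rw [h1]
          cases x i <;> cases ξ i <;> cases σ.a i <;> cases y i <;> simp
        · have h1 : f w' = false := by rw [hv0] at hp; simpa using hp
          have := hup w w' (fun j hj => (hsame j hj).symm) hv0 h1
          rw [hwi] at this
          revert hne this
          rw [h1]
          cases x i <;> cases ξ i <;> cases σ.a i <;> cases y i <;> simp
    · obtain ⟨j, hj, rfl, ha, hl⟩ := h.lits b (Finset.mem_of_mem_insert_of_ne hb hbp)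
      refine ⟨j, hj, rfl, ?_, fun y => ?_⟩
      · split_ifs
        · simp [mix, hbp, ha]
        · exact ha
      · rw [← hl y]; simp [lit, Function.update_of_ne hbp]
  · simp [Finset.card_insert_of_notMem hpX, h.K_eq]

/-- Each active round increases `K * N + cnt`: it raises `cnt`, or it resets `cnt`, which is below
`N`, and raises `K`. Since `K ≤ k`, the count reaches `N` within `(k + 1) * N` rounds. -/
theorem Represents.step1 (H : Represents f hv d k s r ξ tt) {σ : Phase1 n} {N j : ℕ} (x : Str n)
    (h : Sound1 f hv ξ (tt.biUnion id) σ) (hc : σ.cnt ≤ N)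
    (hj : σ.cnt < N → j ≤ σ.K * N + σ.cnt) :
    Sound1 f hv ξ (tt.biUnion id) (step1 f hv d k N x σ) ∧ (step1 f hv d k N x σ).cnt ≤ N ∧
      ((step1 f hv d k N x σ).cnt < N →
        j + 1 ≤ (step1 f hv d k N x σ).K * N + (step1 f hv d k N x σ).cnt) := by
  by_cases h1 : σ.cnt < N
  swap
  · rw [DistFree.step1, if_neg h1]
    exact ⟨h, hc, fun h' => absurd h' h1⟩
  by_cases h2 : vl f hv (mem σ.X) every x σ.a 0 = f x
  · rw [DistFree.step1, if_pos h1, if_pos h2]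
    exact ⟨⟨h.lits, h.K_eq⟩, by simp; omega, fun _ => by simp; have := hj h1; omega⟩
  have hfull : vl f hv (mem σ.X) every x σ.a (2 ^ d) = f x := by
    rw [vl]; congr 1; ext i; simp [mix, mask, every, H.lt]
  have hs := srch_spec (vl f hv (mem σ.X) every x σ.a) d (by rw [hfull]; exact Ne.symm h2)
  have hnew := H.step1_new h x (srch (vl f hv (mem σ.X) every x σ.a) d) (by
    rw [← hs.1] at hs; exact hs.2) 0
  by_cases h3 : σ.K < k
  · rw [DistFree.step1, if_pos h1, if_neg h2, if_pos h3]
    refine ⟨?_, Nat.zero_le _, fun _ => ?_⟩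
    · rw [show vl f hv (mem σ.X) every x σ.a 0 = f (mix hv (mask (mem σ.X) every
        (srch (vl f hv (mem σ.X) every x σ.a) d)) x σ.a) from hs.1.symm]
      exact hnew
    · have := hj h1
      simp only [add_mul, one_mul]; omega
  -- With `k` blocks already present a further block would give more than `k` relevant variables.
  · have := hnew.K_le.trans H.var_card_le
    simp at this; omega

theorem Represents.phase1 (H : Represents f hv d k s r ξ tt) (D : PMF (Str n)) {N : ℕ} :
    ∀ σ ∈ (phase1 f D hv d k N ((k + 1) * N)).support,
      Sound1 f hv ξ (tt.biUnion id) σ ∧ σ.cnt = N := by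
  intro σ hσ
  have := itr_support (fun j σ => Sound1 f hv ξ (tt.biUnion id) σ ∧ σ.cnt ≤ N ∧
    (σ.cnt < N → j ≤ σ.K * N + σ.cnt)) ?_ ?_ σ hσ
  · obtain ⟨h1, h2, h3⟩ := this
    refine ⟨h1, ?_⟩
    by_contra hne
    have h4 := h3 (by omega)
    have h5 := h1.K_le.trans H.var_card_le
    have : (σ.K + 1) * N ≤ (k + 1) * N := Nat.mul_le_mul_right _ (by omega)
    rw [add_mul, one_mul] at this
    omega
  · rintro j σ ⟨h1, h2, h3⟩ σ' hσ'
    simp only [PMF.mem_support_bind_iff, PMF.mem_support_pure_iff] at hσ'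
    obtain ⟨x, -, rfl⟩ := hσ'
    exact H.step1 x h1 h2 h3
  · exact ⟨⟨by simp [Phase1.first], by simp [Phase1.first]⟩, by simp [Phase1.first],
      by simp [Phase1.first]⟩

/-- The blocks of the terms that the frozen blocks do not falsify. -/
def liveBlocks (hv : Fin n → ℕ) (ξ : Str n) (tt : Finset (Finset (Fin n))) (σ : Phase1 n) :
    Finset (Finset ℕ) :=
  (tt.filter fun t => ∀ i ∈ t, hv i ∉ σ.X → xor (σ.a i) (ξ i) = true).image
    fun t => (t.image hv).filter (· ∈ σ.X)

/-- Blocks of `X` outside `S` carry the reference, where their literals are false, so a term can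
hold only if all its blocks in `X` lie in `S`. The value thus depends monotonically on `S`, whatever
the signs are. -/
theorem Represents.mix_iff (H : Represents f hv d k s r ξ tt) {σ : Phase1 n}
    (h : Sound1 f hv ξ (tt.biUnion id) σ) (S : ℕ → Bool) (hS : ∀ b, S b = true → b ∈ σ.X)
    (x : Str n) : f (mix hv S x σ.a) = true ↔
      ∃ B ∈ liveBlocks hv ξ tt σ, (∀ b ∈ B, lit f hv σ.base b x = true) ∧ ∀ b ∈ B, S b = true := by
  have hkey : ∀ t ∈ tt, ∀ i ∈ t, hv i ∈ σ.X →
      σ.a i = ξ i ∧ lit f hv σ.base (hv i) x = xor (x i) (ξ i) := by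
    intro t ht i hi hX
    obtain ⟨j, hj, hji, ha, hl⟩ := h.lits _ hX
    obtain rfl : j = i := H.inj hj (Finset.mem_biUnion.2 ⟨t, ht, hi⟩) hji
    exact ⟨ha, hl x⟩
  rw [H.eval, decide_eq_true_eq]
  constructor
  · rintro ⟨t, ht, hx⟩
    refine ⟨_, Finset.mem_image_of_mem _ (Finset.mem_filter.2 ⟨ht, fun i hi hX => ?_⟩), ?_⟩
    · have := hx i hi
      rwa [mix, if_neg fun hs => hX (hS _ hs)] at this
    · have : ∀ b ∈ (t.image hv).filter (· ∈ σ.X), lit f hv σ.base b x = true ∧ S b = true := by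
        intro b hb
        rw [Finset.mem_filter, Finset.mem_image] at hb
        obtain ⟨⟨i, hi, rfl⟩, hX⟩ := hb
        obtain ⟨ha, hl⟩ := hkey t ht i hi hX
        have := hx i hi
        rw [mix] at this
        split_ifs at this with hs
        · exact ⟨hl.trans this, hs⟩
        · rw [ha] at this; simp at this
      exact ⟨fun b hb => (this b hb).1, fun b hb => (this b hb).2⟩
  · rintro ⟨B, hB, h1, h2⟩
    obtain ⟨t, ht, rfl⟩ := Finset.mem_image.1 hB
    rw [Finset.mem_filter] at ht
    refine ⟨t, ht.1, fun i hi => ?_⟩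
    by_cases hX : hv i ∈ σ.X
    · have hb : hv i ∈ (t.image hv).filter (· ∈ σ.X) :=
        Finset.mem_filter.2 ⟨Finset.mem_image_of_mem _ hi, hX⟩
      rw [mix, if_pos (h2 _ hb), ← (hkey t ht.1 i hi hX).2]
      exact h1 _ hb
    · rw [mix, if_neg fun hs => hX (hS _ hs)]
      exact ht.2 i hi hX

theorem Represents.live_card (H : Represents f hv d k s r ξ tt) (σ : Phase1 n) :
    (liveBlocks hv ξ tt σ).card ≤ s :=
  Finset.card_image_le.trans ((Finset.card_filter_le _ _).trans H.card_le)

theorem Represents.live_mem (H : Represents f hv d k s r ξ tt) {σ : Phase1 n} {B : Finset ℕ}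
    (hB : B ∈ liveBlocks hv ξ tt σ) : B.card ≤ r ∧ B ⊆ σ.X ∧ ∀ b ∈ B, b < 2 ^ d := by
  obtain ⟨t, ht, rfl⟩ := Finset.mem_image.1 hB
  rw [Finset.mem_filter] at ht
  refine ⟨(Finset.card_filter_le _ _).trans (Finset.card_image_le.trans (H.term_card_le t ht.1)),
    fun b hb => (Finset.mem_filter.1 hb).2, fun b hb => ?_⟩
  obtain ⟨i, -, rfl⟩ := Finset.mem_image.1 (Finset.mem_filter.1 hb).1
  exact H.lt i

theorem Represents.vl_iff (H : Represents f hv d k s r ξ tt) {σ : Phase1 n}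
    (h : Sound1 f hv ξ (tt.biUnion id) σ) {g : Finset ℕ} (hg : g ⊆ σ.X) (x : Str n) (p : ℕ) :
    vl f hv (mem g) (mem σ.X) x σ.a p = true ↔ ∃ B ∈ liveBlocks hv ξ tt σ,
      (∀ b ∈ B, lit f hv σ.base b x = true) ∧ ∀ b ∈ B, b ∈ g ∨ b < p := by
  rw [vl, H.mix_iff h]
  · refine exists_congr fun B => and_congr_right fun hB => and_congr_right fun _ =>
      forall_congr' fun b => forall_congr' fun hb => ?_
    have := (H.live_mem hB).2.1 hb
    simp [mask, mem, this]
  · intro b hb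
    simp only [mask, mem, Bool.or_eq_true, decide_eq_true_eq, Bool.and_eq_true] at hb
    rcases hb with hb | hb
    · exact hg hb
    · exact hb.1

/-- The current set `g` lies in every true live term contained in `g` together with the blocks below
`P`, and there is such a term. The next search finds the least `p` for which the blocks up to `p`
still suffice, so `p` belongs to all such terms and can replace `P` as the bound. If the value at
`g` becomes true, `g` contains a live term that in turn contains `g`. -/
theorem Represents.greedy_spec (H : Represents f hv d k s r ξ tt) {σ : Phase1 n}
    (h : Sound1 f hv ξ (tt.biUnion id) σ) {x : Str n} (hx : σ.fn f hv x = true) (r' : ℕ) :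
    greedy f hv σ.X d x σ.a r' ∈ liveBlocks hv ξ tt σ ∧
        (∀ b ∈ greedy f hv σ.X d x σ.a r', lit f hv σ.base b x = true) ∨
      greedy f hv σ.X d x σ.a r' ⊆ σ.X ∧ (greedy f hv σ.X d x σ.a r').card = r' ∧
        vl f hv (mem (greedy f hv σ.X d x σ.a r')) (mem σ.X) x σ.a 0 = false ∧
        ∃ P, (∃ B ∈ liveBlocks hv ξ tt σ, (∀ b ∈ B, lit f hv σ.base b x = true) ∧
            ∀ b ∈ B, b ∈ greedy f hv σ.X d x σ.a r' ∨ b < P) ∧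
          ∀ B ∈ liveBlocks hv ξ tt σ, (∀ b ∈ B, lit f hv σ.base b x = true) →
            (∀ b ∈ B, b ∈ greedy f hv σ.X d x σ.a r' ∨ b < P) →
            greedy f hv σ.X d x σ.a r' ⊆ B := by
  obtain ⟨B₀, hB₀, hl₀, -⟩ := (H.mix_iff h (mem σ.X) (by simp [mem]) x).1 hx
  have close : ∀ g : Finset ℕ, ∀ P, g ⊆ σ.X → (∃ B ∈ liveBlocks hv ξ tt σ,
      (∀ b ∈ B, lit f hv σ.base b x = true) ∧ ∀ b ∈ B, b ∈ g ∨ b < P) →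
      (∀ B ∈ liveBlocks hv ξ tt σ, (∀ b ∈ B, lit f hv σ.base b x = true) →
        (∀ b ∈ B, b ∈ g ∨ b < P) → g ⊆ B) →
      vl f hv (mem g) (mem σ.X) x σ.a 0 = true →
      g ∈ liveBlocks hv ξ tt σ ∧ ∀ b ∈ g, lit f hv σ.base b x = true := by
    intro g P hgX _ hP hv0
    obtain ⟨B, hB, hl, hBg⟩ := (H.vl_iff h hgX x 0).1 hv0
    simp only [Nat.not_lt_zero, or_false] at hBg
    have := hP B hB hl fun b hb => .inl (hBg b hb)
    obtain rfl : g = B := Finset.Subset.antisymm this hBg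
    exact ⟨hB, hl⟩
  induction r' with
  | zero =>
    by_cases hv0 : vl f hv (mem ∅) (mem σ.X) x σ.a 0 = true
    · exact .inl (close ∅ 0 (by simp) ((H.vl_iff h (by simp) x 0).1 hv0) (by simp) hv0)
    · refine .inr ⟨by simp [greedy], by simp [greedy], by simpa [greedy] using hv0, 2 ^ d,
        ⟨B₀, hB₀, hl₀, fun b hb => .inr ((H.live_mem hB₀).2.2 b hb)⟩, by simp [greedy]⟩
  | succ r' ih =>
    rw [greedy]
    set g := greedy f hv σ.X d x σ.a r'
    rcases ih with ⟨h1, h2⟩ | ⟨hgX, hcard, hv0, P, hex, hP⟩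
    · rw [if_pos ((H.vl_iff h (H.live_mem h1).2.1 x 0).2 ⟨g, h1, h2, fun b hb => .inl hb⟩)]
      exact .inl ⟨h1, h2⟩
    · rw [hv0, if_neg (by simp)]
      have hfull : vl f hv (mem g) (mem σ.X) x σ.a (2 ^ d) = true :=
        (H.vl_iff h hgX x _).2 ⟨B₀, hB₀, hl₀, fun b hb => .inr ((H.live_mem hB₀).2.2 b hb)⟩
      obtain ⟨hs1, hs2⟩ := srch_spec (vl f hv (mem g) (mem σ.X) x σ.a) d (by rw [hfull, hv0]; simp)
      set p := srch (vl f hv (mem g) (mem σ.X) x σ.a) d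
      rw [hv0] at hs1 hs2
      rw [ne_eq, Bool.not_eq_false] at hs2
      have hno : ¬∃ B ∈ liveBlocks hv ξ tt σ, (∀ b ∈ B, lit f hv σ.base b x = true) ∧
          ∀ b ∈ B, b ∈ g ∨ b < p := by
        rw [← H.vl_iff h hgX, hs1]; simp
      have hpP : p < P := by
        by_contra! hle
        obtain ⟨B, hB, hl, hBg⟩ := hex
        exact hno ⟨B, hB, hl, fun b hb => (hBg b hb).imp id fun h => by omega⟩
      have hpB : ∀ B ∈ liveBlocks hv ξ tt σ, (∀ b ∈ B, lit f hv σ.base b x = true) →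
          (∀ b ∈ B, b ∈ insert p g ∨ b < p) → insert p g ⊆ B := by
        intro B hB hl hBg
        refine Finset.insert_subset ?_ (hP B hB hl fun b hb => ?_)
        · by_contra hpB
          refine hno ⟨B, hB, hl, fun b hb => (hBg b hb).imp (fun h => ?_) id⟩
          exact Finset.mem_of_mem_insert_of_ne h (by rintro rfl; exact hpB hb)
        · rcases hBg b hb with h | h
          · rcases Finset.mem_insert.1 h with rfl | h
            · exact .inr hpP
            · exact .inl h
          · exact .inr (by omega)
      obtain ⟨B₁, hB₁, hl₁, hBg₁⟩ := (H.vl_iff h hgX x _).1 hs2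
      have hBg₁' : ∀ b ∈ B₁, b ∈ insert p g ∨ b < p := fun b hb => by
        rcases hBg₁ b hb with h | h
        · exact .inl (Finset.mem_insert_of_mem h)
        · rcases Nat.lt_succ_iff_lt_or_eq.1 h with h | rfl
          · exact .inr h
          · exact .inl (Finset.mem_insert_self _ _)
      have hsub := hpB B₁ hB₁ hl₁ hBg₁'
      have hpX : insert p g ⊆ σ.X := hsub.trans (H.live_mem hB₁).2.1
      have hpg : p ∉ g := by
        intro hpg
        refine hno ⟨B₁, hB₁, hl₁, fun b hb => ?_⟩
        have := hBg₁' b hb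
        rwa [Finset.insert_eq_of_mem hpg] at this
      by_cases hv1 : vl f hv (mem (insert p g)) (mem σ.X) x σ.a 0 = true
      · exact .inl (close _ p hpX ⟨B₁, hB₁, hl₁, hBg₁'⟩ hpB hv1)
      · exact .inr ⟨hpX, by rw [Finset.card_insert_of_notMem hpg, hcard], by simpa using hv1, p,
          ⟨B₁, hB₁, hl₁, hBg₁'⟩, hpB⟩

/-- A search unfinished after `r` rounds has found `r` blocks inside a term of at most `r` blocks.
It has then found the whole term, so the value would be true. -/
theorem Represents.greedy_mem (H : Represents f hv d k s r ξ tt) {σ : Phase1 n}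
    (h : Sound1 f hv ξ (tt.biUnion id) σ) {x : Str n} (hx : σ.fn f hv x = true) :
    greedy f hv σ.X d x σ.a r ∈ liveBlocks hv ξ tt σ ∧
      ∀ b ∈ greedy f hv σ.X d x σ.a r, lit f hv σ.base b x = true := by
  rcases H.greedy_spec h hx r with h' | ⟨hX, hcard, hv0, P, ⟨B, hB, hl, hBg⟩, hP⟩
  · exact h'
  · exfalso
    have hsub := hP B hB hl hBg
    have := Finset.eq_of_subset_of_card_le hsub (by rw [hcard]; exact (H.live_mem hB).1)
    rw [(H.vl_iff h hX x 0).2 ⟨B, hB, hl, fun b hb => .inl (this ▸ hb)⟩] at hv0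
    cases hv0

theorem Sound1.litsOK {V : Finset (Fin n)} {σ : Phase1 n} (h : Sound1 f hv ξ V σ) {mono : Bool}
    (hm : mono = true → ξ = zs) (x u v z : Str n) : litsOK mono f hv σ x u v z = true := by
  rw [DistFree.litsOK, decide_eq_true_eq]
  intro b hb
  obtain ⟨i, -, -, -, hl⟩ := h.lits b hb
  simp only [litOK, hl, bx, ba, zs]
  cases mono
  · cases x i <;> cases u i <;> cases v i <;> cases z i <;> cases ξ i <;> rfl
  · rw [hm rfl]
    cases x i <;> cases u i <;> cases v i <;> cases z i <;> rfl

structure Sound2 (hv : Fin n → ℕ) (ξ : Str n) (tt : Finset (Finset (Fin n))) (σ : Phase1 n)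
    (τ : Phase2) : Prop where
  rej : τ.rej = false
  nodup : τ.tms.Nodup
  live : ∀ T ∈ τ.tms, T ∈ liveBlocks hv ξ tt σ

/-- A new term is true at `x` while all earlier ones are false there, so the terms are distinct live
terms and there are at most `s`. Terms of the hypothesis are terms of `σ.fn`, so there are no false
positives. -/
theorem Represents.step2 (H : Represents f hv d k s r ξ tt) {mono : Bool}
    (hm : mono = true → ξ = zs) {σ : Phase1 n} (h : Sound1 f hv ξ (tt.biUnion id) σ)
    (x u v z : Str n) {τ : Phase2} (hτ : Sound2 hv ξ tt σ τ) :
    Sound2 hv ξ tt σ (step2 mono f hv d s r σ x u v z τ) := by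
  have hmem : ∀ T ∈ τ.tms, ∀ b ∈ T, b ∈ σ.X := fun T hT b hb =>
    (H.live_mem (hτ.live T hT)).2.1 hb
  unfold DistFree.step2
  split_ifs with h1 h2
  · obtain ⟨hg1, hg2⟩ := H.greedy_mem h h1.1
    refine ⟨?_, ?_, ?_⟩
    · simp only [hτ.rej, h.litsOK hm]
      rw [(H.vl_iff h (H.live_mem hg1).2.1 x 0).2 ⟨_, hg1, hg2, fun b hb => .inl hb⟩]
      rfl
    · rw [List.nodup_append]
      refine ⟨hτ.nodup, by simp, ?_⟩
      rintro T hT _ hT' rfl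
      rw [List.mem_singleton] at hT'
      subst hT'
      have := h1.2
      simp only [hyp, decide_eq_false_iff_not] at this
      exact this ⟨_, hT, fun b hb _ => hg2 b hb⟩
    · intro T hT
      rcases List.mem_append.1 hT with hT | hT
      · exact hτ.live T hT
      · rw [List.mem_singleton.1 hT]; exact hg1
  · exfalso
    obtain ⟨B, hB, hl, -⟩ := (H.mix_iff h (mem σ.X) (by simp [mem]) x).1 h1.1
    have hBt : B ∉ τ.tms := by
      intro hBt
      have := h1.2
      simp only [hyp, decide_eq_false_iff_not] at this
      exact this ⟨_, hBt, fun b hb _ => hl b hb⟩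
    have : insert B τ.tms.toFinset ⊆ liveBlocks hv ξ tt σ := by
      refine Finset.insert_subset hB fun T hT => hτ.live T (List.mem_toFinset.1 hT)
    have := (Finset.card_le_card this).trans (H.live_card σ)
    rw [Finset.card_insert_of_notMem (by simpa using hBt), List.toFinset_card_of_nodup hτ.nodup]
      at this
    omega
  · refine ⟨?_, hτ.nodup, hτ.live⟩
    simp only [hτ.rej, h.litsOK hm, Bool.or_self, Bool.not_true, Bool.false_or,
      Bool.and_eq_false_iff, Bool.not_eq_false']
    by_contra! hc
    obtain ⟨hc1, hc2⟩ := hc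
    rw [ne_eq, Bool.not_eq_false] at hc1
    simp only [hyp, decide_eq_true_eq] at hc1
    obtain ⟨T, hT, hl⟩ := hc1
    exact hc2 ((H.mix_iff h (mem σ.X) (by simp [mem]) x).2 ⟨T, hτ.live T hT,
      fun b hb => hl b hb (hmem T hT b hb), fun b hb => by simp [mem, hmem T hT b hb]⟩)

theorem Represents.answer_eq (H : Represents f hv d k s r ξ tt) {mono : Bool}
    (hm : mono = true → ξ = zs) (D : PMF (Str n)) (N R₂ : ℕ) :
    ∀ σ ∈ (DistFree.phase1 f D hv d k N ((k + 1) * N)).support,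
      ∀ τ ∈ (phase2 mono f D hv d s r R₂ σ).support, (decide (σ.cnt = N) && !τ.rej) = true := by
  intro σ hσ τ hτ
  obtain ⟨h1, h2⟩ := H.phase1 D σ hσ
  have := itr_support (fun _ τ => Sound2 hv ξ tt σ τ) ?_ ?_ τ hτ
  · simp [h2, this.rej]
  · rintro j τ h τ' hτ'
    simp only [PMF.mem_support_bind_iff, PMF.mem_support_pure_iff] at hτ'
    obtain ⟨x, -, u, -, v, -, z, -, rfl⟩ := hτ'
    exact H.step2 hm h1 x u v z h
  · exact ⟨rfl, by simp, by simp⟩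

/-! ### Hashing -/

/-- Flipping the `i`-th bit exchanges the event with its complement. -/
theorem unif_eq_half {i j : Fin n} (hij : i ≠ j) :
    ex (unif n) (fun u => chi (u i = u j)) = 1 / 2 := by
  have h1 : ∀ u : Str n, chi (u i = u j) = ENNReal.ofReal (ind (u i == u j)) := by
    intro u; unfold chi; cases u i <;> cases u j <;> simp
  simp only [h1]
  rw [ex_unif _ fun u => ind_nonneg _]
  have h2 : av (fun u : Str n => ind (u i == u j)) = 1 / 2 := by
    have a : av (fun u : Str n => ind (u i == u j)) = av fun u : Str n => ind (!(u i == u j)) := by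
      rw [← av_shift (unitStr i)]
      congr 1; ext u
      simp only [bx, unitStr, hij.symm]
      cases u i <;> cases u j <;> simp
    have b : av (fun u : Str n => ind (u i == u j) + ind (!(u i == u j))) = 1 := by
      rw [← av_const (n := n) 1]
      congr 1; ext u
      cases (u i == u j) <;> simp
    rw [av_add, ← a] at b
    linarith
  rw [h2]
  simp

theorem hash_collision {i j : Fin n} (hij : i ≠ j) (d : ℕ) :
    ex (hashGen n d) (fun h => chi (h i = h j)) ≤ (1 / 2) ^ d := by
  have key : ∀ d k (h : Fin n → ℕ), ex (itr (fun _ h => (unif n).bind fun u => PMF.pure fun i =>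
      2 * h i + (u i).toNat) k d h) (fun h => chi (h i = h j)) ≤ chi (h i = h j) * (1 / 2) ^ d := by
    intro d
    induction d with
    | zero => intro k h; rw [itr, ex_pure, pow_zero, mul_one]
    | succ d ih =>
      intro k h
      simp only [itr, ex_bind, ex_pure]
      refine le_trans (ex_mono _ (h := fun u => (chi (h i = h j) * (1 / 2) ^ d) *
        chi (u i = u j)) fun u => (ih _ _).trans ?_) ?_
      · by_cases hu : u i = u j
        · rw [chi_of hu, mul_one]
          gcongr
          exact chi_mono fun h => by rw [hu] at h; omega
        · rw [chi_not, zero_mul]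
          · exact zero_le
          · revert hu; cases u i <;> cases u j <;> simp <;> omega
      · rw [ex_mul_left, unif_eq_half hij, pow_succ, mul_assoc]
  refine (key d 0 _).trans ?_
  exact mul_le_of_le_one_left zero_le (chi_le_one _)

/-- Union bound over at most `k ^ 2` ordered pairs, each colliding with probability at most `2 ^
(-d)`. -/
theorem hash_not_injOn (V : Finset (Fin n)) (d k : ℕ) (hV : V.card ≤ k) (hd : 4 * k ^ 2 ≤ 2 ^ d) :
    ex (hashGen n d) (fun h => chi (¬Set.InjOn h V)) ≤ 1 / 4 := by
  refine le_trans (ex_mono _ (h := fun h => ∑ q ∈ V.offDiag, chi (h q.1 = h q.2)) fun h => ?_) ?_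
  · by_cases hi : Set.InjOn h V
    · rw [chi_not (not_not.2 hi)]; exact zero_le
    · rw [chi_of hi]
      rw [Set.InjOn] at hi
      push Not at hi
      obtain ⟨i, hi, j, hj, he, hne⟩ := hi
      rw [← chi_of he]
      exact Finset.single_le_sum (f := fun q : Fin n × Fin n => chi (h q.1 = h q.2))
        (fun _ _ => zero_le) (Finset.mem_offDiag.2 ⟨hi, hj, hne⟩ : (i, j) ∈ V.offDiag)
  · rw [ex_sum]
    refine (Finset.sum_le_sum fun q hq => hash_collision (Finset.mem_offDiag.1 hq).2.2 d).trans ?_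
    rw [Finset.sum_const, nsmul_eq_mul]
    have h1 : V.offDiag.card ≤ k ^ 2 := by
      rw [Finset.offDiag_card, sq]
      exact (Nat.sub_le _ _).trans (Nat.mul_le_mul hV hV)
    have h2 : (4 * V.offDiag.card : ENNReal) ≤ 2 ^ d := by
      exact_mod_cast (Nat.mul_le_mul_left 4 h1).trans hd
    rw [one_div, one_div, ENNReal.le_inv_iff_mul_le, ← ENNReal.inv_pow]
    calc (V.offDiag.card : ENNReal) * (2 ^ d)⁻¹ * 4 = (4 * V.offDiag.card) * (2 ^ d)⁻¹ := by ring
      _ ≤ 2 ^ d * (2 ^ d)⁻¹ := by gcongr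
      _ ≤ 1 := ENNReal.mul_inv_le_one _

theorem hashGen_lt {d : ℕ} {h : Fin n → ℕ} (hh : h ∈ (hashGen n d).support) (i : Fin n) :
    h i < 2 ^ d := by
  have := itr_support (fun j h => ∀ i, h i < 2 ^ j) ?_ ?_ h hh i
  · simpa using this
  · intro j h hj h' hh' i
    simp only [PMF.mem_support_bind_iff, PMF.mem_support_pure_iff] at hh'
    obtain ⟨u, -, rfl⟩ := hh'
    have := hj i
    rw [pow_succ]
    have := Bool.toNat_lt (u i)
    change 2 * h i + (u i).toNat < _
    omega
  · simp

/-- A collision of relevant variables is the only source of error for a member. -/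
theorem answer_complete {mono : Bool} (hf : f ∈ cls mono n s r) (D : PMF (Str n))
    (hk : s * r ≤ k) (hd : 4 * k ^ 2 ≤ 2 ^ d) (N R₂ : ℕ) :
    ex (answer mono f D d k s r N ((k + 1) * N) R₂) (fun b => chi (b = false)) ≤ 1 / 4 := by
  obtain ⟨ξ, tt, hm, hs, hr, he⟩ := mem_cls.1 hf
  have hV : (tt.biUnion id).card ≤ k :=
    (Finset.card_biUnion_le_card_mul _ _ r fun t ht => hr t ht).trans
      ((Nat.mul_le_mul_right r hs).trans hk)
  refine le_trans ?_ (hash_not_injOn (tt.biUnion id) d k hV hd)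
  rw [answer, ex_bind]
  refine ex_le_of_support _ fun hv hhv => ?_
  by_cases hi : Set.InjOn hv (tt.biUnion id)
  · have H : Represents f hv d k s r ξ tt := ⟨hs, hr, he, hV, hi, hashGen_lt hhv⟩
    rw [chi_not (not_not.2 hi), ex_bind]
    refine (ex_le_of_support _ (h := fun _ => 0) fun σ hσ => ?_).trans (by rw [ex_const])
    rw [ex_bind]
    refine (ex_le_of_support _ (h := fun _ => 0) fun τ hτ => ?_).trans (by rw [ex_const])
    rw [ex_pure, H.answer_eq hm D N R₂ σ hσ τ hτ, chi_not (by simp)]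
  · rw [chi_of hi]
    exact ex_le _ fun σ => chi_le_one _

end Complete

/-! ### Soundness -/

section Sound

variable {n : ℕ}

/-- A tentative literal reads its argument on its own block only. This forces the dictator of
`lit_sound` into that block. -/
theorem lit_depends {f : BoolFn n} {hv : Fin n → ℕ} {base : ℕ → Str n} {b : ℕ} {i : Fin n}
    {u : Str n} (h : lit f hv base b (bx (unitStr i) u) ≠ lit f hv base b u) : hv i = b := by
  by_contra hb
  refine h ?_
  unfold lit
  congr 1
  ext j
  by_cases hj : hv j = b
  · have : j ≠ i := by rintro rfl; exact hb hj
    simp [mix, hj, bx, unitStr, this]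
  · simp [mix, hj]

/-- The hypothesis with the tentative literals replaced by nearby functions. -/
def idealHyp (X : Finset ℕ) (tms : List (Finset ℕ)) (w : ℕ → Str n → Bool) : BoolFn n :=
  fun x => decide (∃ T ∈ tms, ∀ b ∈ T, b ∈ X → w b x = true)

/-- A block with an ideal literal contributes one literal to a term. A constant block contributes
nothing if it is true and deletes the term if it is false. Hence there are at most `s` terms with at
most `r` literals. -/
theorem idealHyp_mem_cls {mono : Bool} {s r : ℕ} {f : BoolFn n} {hv : Fin n → ℕ}
    {base : ℕ → Str n} {X : Finset ℕ} {tms : List (Finset ℕ)} {w : ℕ → Str n → Bool}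
    (hw : ∀ b ∈ X, IsLit mono (lit f hv base b) (w b)) (hs : tms.length ≤ s)
    (hr : ∀ T ∈ tms, T.card ≤ r) : idealHyp X tms w ∈ cls mono n s r := by
  classical
  -- Since the variable lies in the block, different blocks give different variables, and the sign
  -- of a variable can be defined through its block. This makes the function unate.
  set Dict : ℕ → Prop := fun b => ∃ i o, (mono = true → o = false) ∧
    (∀ x, w b x = xor (x i) o) ∧ hv i = b with hDict
  have hconst : ∀ b ∈ X, ¬Dict b → ∀ x, w b x = w b zs := by
    intro b hb hd x
    rcases hw b hb with ⟨c, hc⟩ | ⟨i, o, ho, hx, u, hu⟩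
    · rw [hc, hc]
    · exact absurd ⟨i, o, ho, hx, lit_depends hu⟩ hd
  have hD : ∀ b, Dict b → ∃ i o, (mono = true → o = false) ∧
    (∀ x, w b x = xor (x i) o) ∧ hv i = b := fun b h => h
  choose iv o ho hx hhv using hD
  set is : ℕ → Finset (Fin n) := fun b => if h : Dict b then {iv b h} else ∅ with his
  rw [mem_cls]
  set tt : Finset (Finset (Fin n)) :=
    (tms.toFinset.filter fun T => ∀ b ∈ T, b ∈ X → ¬Dict b → w b zs = true).image
      fun T => (T.filter fun b => b ∈ X).biUnion is with htt
  refine ⟨fun i => if h : Dict (hv i) then o (hv i) h else false, tt, ?_, ?_, ?_, ?_⟩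
  · intro hm
    ext i
    by_cases h : Dict (hv i)
    · simp [h, ho _ h hm, zs]
    · simp [h, zs]
  · exact Finset.card_image_le.trans ((Finset.card_filter_le _ _).trans
      ((List.toFinset_card_le _).trans hs))
  · intro t ht
    obtain ⟨T, hT, rfl⟩ := Finset.mem_image.1 ht
    rw [Finset.mem_filter, List.mem_toFinset] at hT
    refine (Finset.card_biUnion_le_card_mul _ _ 1 fun b _ => ?_).trans ?_
    · rw [his]; dsimp only; split_ifs <;> simp
    · rw [mul_one]; exact (Finset.card_filter_le _ _).trans (hr T hT.1)
  · intro x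
    rw [idealHyp]
    congr 1
    rw [eq_iff_iff]
    simp only [htt, Finset.mem_image, Finset.mem_filter, List.mem_toFinset]
    constructor
    · rintro ⟨T, hT, hT'⟩
      refine ⟨_, ⟨T, ⟨hT, fun b hb hbX hbD => ?_⟩, rfl⟩, ?_⟩
      · rw [← hconst b hbX hbD x]; exact hT' b hb hbX
      · intro i hi
        obtain ⟨b, hb, hib⟩ := Finset.mem_biUnion.1 hi
        rw [Finset.mem_filter] at hb
        by_cases hbD : Dict b
        · rw [his] at hib
          simp only [dif_pos hbD, Finset.mem_singleton] at hib
          have hvb : hv i = b := by rw [hib, hhv]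
          subst hvb
          rw [dif_pos hbD]
          have := hx _ hbD x
          rw [← hib] at this
          rw [← this]
          exact hT' _ hb.1 hb.2
        · simp [his, hbD] at hib
    · rintro ⟨_, ⟨T, ⟨hT, hc⟩, rfl⟩, h⟩
      refine ⟨T, hT, fun b hb hbX => ?_⟩
      by_cases hbD : Dict b
      · have := h (iv b hbD) (Finset.mem_biUnion.2 ⟨b, Finset.mem_filter.2 ⟨hb, hbX⟩, by
          simp [his, hbD]⟩)
        have hvb := hhv b hbD
        rw [hx b hbD]
        generalize hi : iv b hbD = i at this hvb
        subst hvb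
        rwa [dif_pos hbD] at this
      · rw [hconst b hbX hbD x]; exact hc b hb hbX hbD

/-- The probability that two functions agree. -/
noncomputable def agr (D : PMF (Str n)) (f g : BoolFn n) : ENNReal :=
  ex D fun x => chi (f x = g x)

theorem agr_le_of_far {D : PMF (Str n)} {ε : ℝ} {f g : BoolFn n}
    (h : ε ≤ prob D {x | f x ≠ g x}) : agr D f g ≤ ENNReal.ofReal (1 - ε) := by
  have h1 := ex_chi_add_not D fun x => f x = g x
  rw [ex_chi D fun x => ¬(f x = g x)] at h1
  have h2 : ENNReal.ofReal ε ≤ D.toOuterMeasure {x | f x ≠ g x} := ENNReal.ofReal_le_of_le_toReal h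
  have h3 : agr D f g ≠ ⊤ := by
    refine ne_top_of_le_ne_top (b := 1) (by simp) ?_
    exact ex_le D fun x => chi_le_one _
  have h4 : D.toOuterMeasure {x | f x ≠ g x} ≠ ⊤ := fun h => by
    rw [show {x | ¬(f x = g x)} = {x | f x ≠ g x} from rfl, h] at h1; simp at h1
  have h5 : (agr D f g).toReal + (D.toOuterMeasure {x | f x ≠ g x}).toReal = 1 := by
    rw [← ENNReal.toReal_add h3 h4]; rw [show (1:ℝ) = (1 : ENNReal).toReal by simp, ← h1]; rfl
  rw [← ENNReal.ofReal_toReal h3]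
  refine ENNReal.ofReal_le_ofReal ?_
  unfold prob at h
  linarith

theorem agr_triangle (D : PMF (Str n)) (f g h : BoolFn n) :
    agr D f g + agr D g h ≤ 1 + agr D f h := by
  simp only [agr]
  rw [← ex_const D 1, ← ex_add, ← ex_add]
  refine ex_mono D fun x => ?_
  by_cases h1 : f x = g x
  · by_cases h2 : g x = h x
    · rw [chi_of h1, chi_of h2, chi_of (h1.trans h2)]
    · rw [chi_of h1, chi_not h2]; simp
  · rw [chi_not h1, zero_add]; exact (chi_le_one _).trans (by simp)

theorem itr_of_pure {S : Type} {g : ℕ → S → PMF S} {s : S} (h : ∀ k, g k s = PMF.pure s) (k N : ℕ) :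
    itr g k N s = PMF.pure s := by
  induction N generalizing k with
  | zero => rfl
  | succ N ih => rw [itr, h, PMF.pure_bind, ih]

/-- Every run of agreements with a function that agrees with `f` with probability at most `c`
reaches length `N` with probability at most `c ^ N`, and there are at most `k + 1` runs. The
potential in `key` charges `c ^ N` for each run still to come and `c ^ (N - cnt)` for the current
one. -/
theorem phase1_sound (f : BoolFn n) (D : PMF (Str n)) (hv : Fin n → ℕ) (d k N R : ℕ)
    (c : ENNReal) :
    ex (phase1 f D hv d k N R) (fun σ => chi (σ.cnt = N ∧ agr D f (σ.fn f hv) ≤ c)) ≤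
      (k + 1 : ℕ) * c ^ N := by
  have key : ∀ R j σ, ex (itr (fun _ σ => D.bind fun x => PMF.pure (step1 f hv d k N x σ)) j R σ)
      (fun σ => chi (σ.cnt = N ∧ agr D f (σ.fn f hv) ≤ c)) ≤
      (k - σ.K : ℕ) * c ^ N + chi (σ.cnt ≤ N ∧ agr D f (σ.fn f hv) ≤ c) * c ^ (N - σ.cnt) := by
    intro R
    induction R with
    | zero =>
      intro j σ
      rw [itr, ex_pure]
      refine le_trans ?_ le_add_self
      by_cases h : σ.cnt = N ∧ agr D f (σ.fn f hv) ≤ c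
      · rw [chi_of h, chi_of ⟨h.1.le, h.2⟩, h.1]; simp
      · rw [chi_not h]; exact zero_le
    | succ R ih =>
      intro j σ
      by_cases hc : σ.cnt < N
      swap
      · have hst : ∀ x, step1 f hv d k N x σ = σ := fun x => by rw [step1, if_neg hc]
        rw [itr_of_pure fun _ => by simp only [hst, PMF.bind_const], ex_pure]
        refine le_trans ?_ le_add_self
        by_cases h : σ.cnt = N ∧ agr D f (σ.fn f hv) ≤ c
        · rw [chi_of h, chi_of ⟨h.1.le, h.2⟩, h.1]; simp
        · rw [chi_not h]; exact zero_le
      rw [itr, ex_bind, ex_bind]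
      simp only [ex_pure]
      have h0 : ∀ x, vl f hv (mem σ.X) every x σ.a 0 = σ.fn f hv x := fun x => by
        rw [vl, mask_zero]; rfl
      refine le_trans (ex_mono D (h := fun x => (k - σ.K : ℕ) * c ^ N +
        (chi (agr D f (σ.fn f hv) ≤ c) * c ^ (N - (σ.cnt + 1))) *
          chi (f x = σ.fn f hv x)) fun x => (ih _ _).trans ?_) ?_
      · rw [step1, if_pos hc]
        simp only [h0]
        by_cases hx : f x = σ.fn f hv x
        · rw [if_pos hx.symm, chi_of hx, mul_one]
          have : chi (σ.cnt + 1 ≤ N ∧ agr D f (Phase1.fn f hv { σ with cnt := σ.cnt + 1 }) ≤ c) ≤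
            chi (agr D f (σ.fn f hv) ≤ c) := chi_mono fun h => h.2
          gcongr
        · rw [if_neg (Ne.symm hx), chi_not hx, mul_zero, add_zero]
          by_cases hk : σ.K < k
          · rw [if_pos hk]
            refine le_trans (add_le_add_right (mul_le_of_le_one_left (zero_le) (chi_le_one _)) _) ?_
            simp only [tsub_zero]
            rw [← add_one_mul]
            gcongr
            exact_mod_cast (by omega : k - (σ.K + 1) + 1 ≤ k - σ.K)
          · rw [if_neg hk, chi_not (by rintro ⟨h, -⟩; simp at h)]
            simp
      · rw [ex_add, ex_const, ex_mul_left]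
        refine add_le_add_right ?_ _
        by_cases hb : agr D f (σ.fn f hv) ≤ c
        · rw [chi_of hb, chi_of ⟨hc.le, hb⟩, one_mul, one_mul]
          calc c ^ (N - (σ.cnt + 1)) * ex D (fun x => chi (f x = σ.fn f hv x))
              ≤ c ^ (N - (σ.cnt + 1)) * c := by gcongr; exact hb
            _ = c ^ (N - σ.cnt) := by rw [← pow_succ]; congr 1; omega
        · rw [chi_not hb]; simp
  refine (key R 0 (Phase1.first n)).trans ?_
  simp only [Phase1.first, tsub_zero]
  rw [Nat.cast_add, add_mul, Nat.cast_one]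
  gcongr
  exact chi_le_one _

theorem ex3_ind (p : Str n → Str n → Str n → Bool) :
    ex (unif n) (fun u => ex (unif n) fun v => ex (unif n) fun z => chi (p u v z = true)) =
      ENNReal.ofReal (av fun u => av fun v => av fun z => ind (p u v z)) := by
  have : ∀ b : Bool, chi (b = true) = ENNReal.ofReal (ind b) := by
    intro b; cases b <;> simp [chi]
  simp only [this]
  have h1 : ∀ u v, ex (unif n) (fun z => ENNReal.ofReal (ind (p u v z))) =
      ENNReal.ofReal (av fun z => ind (p u v z)) := fun u v => ex_unif _ fun z => ind_nonneg _
  have h2 : ∀ u, ex (unif n) (fun v => ENNReal.ofReal (av fun z => ind (p u v z))) =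
      ENNReal.ofReal (av fun v => av fun z => ind (p u v z)) := fun u => ex_unif _ fun v =>
        av_nonneg fun z => ind_nonneg _
  simp only [h1, h2]
  exact ex_unif _ fun u => av_nonneg fun v => av_nonneg fun z => ind_nonneg _

/-- The probability that an iteration of the second phase finds no mistake. -/
theorem no_mistake_le {mono : Bool} {s r : ℕ} {f : BoolFn n} {D : PMF (Str n)} {hv : Fin n → ℕ}
    {σ : Phase1 n} {tms : List (Finset ℕ)} {ε : ℝ} (hε0 : 0 < ε) (hε : ε ≤ 1)
    (hfar : ∀ g ∈ cls mono n s r, agr D (σ.fn f hv) g ≤ ENNReal.ofReal (1 - ε / 2))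
    (hs : tms.length ≤ s) (hr : ∀ T ∈ tms, T.card ≤ r) :
    ex D (fun x => ex (unif n) fun u => ex (unif n) fun v => ex (unif n) fun z =>
      chi (litsOK mono f hv σ x u v z = true ∧ σ.fn f hv x = hyp f hv σ tms x)) ≤
      ENNReal.ofReal (1 - ε / 64) := by
  -- A block rejected with probability at least 1/64 at every sample suffices by itself, as `ε ≤ 1`.
  by_cases hbad : ∃ b ∈ σ.X, ∀ x, passAv mono (lit f hv σ.base b) x ≤ 63 / 64
  · obtain ⟨b, hb, hx⟩ := hbad
    refine ex_le D fun x => ?_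
    refine le_trans ?_ (ENNReal.ofReal_le_ofReal (p := passAv mono (lit f hv σ.base b) x)
      ((hx x).trans (by linarith)))
    rw [passAv, ← ex3_ind]
    refine ex_mono _ fun u => ex_mono _ fun v => ex_mono _ fun z => chi_mono fun h => ?_
    have := h.1
    simp only [litsOK, decide_eq_true_eq] at this
    exact this b hb
  · have hgood : ∀ b ∈ σ.X, ∃ w, IsLit mono (lit f hv σ.base b) w ∧
        ∀ x, lit f hv σ.base b x ≠ w x → passAv mono (lit f hv σ.base b) x ≤ 1 / 2 := by
      intro b hb
      rcases lit_sound mono (lit f hv σ.base b) with h | h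
      · exact absurd ⟨b, hb, h⟩ hbad
      · exact h
    choose! w hw hpass using hgood
    have hg := hfar _ (idealHyp_mem_cls hw hs hr)
    -- Where the ideal hypothesis disagrees with `σ.fn`, a mistake shows with probability at least
    -- 1/2: either some tentative literal is not ideal at `x`, which its test detects, or the actual
    -- hypothesis errs as well. By `hfar` the total is at most `1 - ε / 4`.
    refine le_trans (ex_mono D (h := fun x => ENNReal.ofReal (1 / 2) + ENNReal.ofReal (1 / 2) *
      chi (σ.fn f hv x = idealHyp σ.X tms w x)) fun x => ?_) ?_
    · by_cases hx : σ.fn f hv x = idealHyp σ.X tms w x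
      · rw [chi_of hx, mul_one, ← ENNReal.ofReal_add (by norm_num) (by norm_num)]
        norm_num
        exact ex_le _ fun u => ex_le _ fun v => ex_le _ fun z => chi_le_one _
      · rw [chi_not hx, mul_zero, add_zero]
        by_cases hdiff : ∃ b ∈ σ.X, lit f hv σ.base b x ≠ w b x
        · obtain ⟨b, hb, hbx⟩ := hdiff
          refine le_trans ?_ (ENNReal.ofReal_le_ofReal (hpass b hb x hbx))
          rw [passAv, ← ex3_ind]
          refine ex_mono _ fun u => ex_mono _ fun v => ex_mono _ fun z => chi_mono fun h => ?_
          have := h.1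
          simp only [litsOK, decide_eq_true_eq] at this
          exact this b hb
        · push Not at hdiff
          have : hyp f hv σ tms x = idealHyp σ.X tms w x := by
            rw [hyp, idealHyp]
            congr 1
            rw [eq_iff_iff]
            refine exists_congr fun T => and_congr_right fun _ => forall_congr' fun b =>
              forall_congr' fun _ => forall_congr' fun hb => ?_
            rw [hdiff b hb]
          rw [this]
          refine ex_le _ fun u => ex_le _ fun v => ex_le _ fun z => ?_
          rw [chi_not fun h => hx h.2]
          exact zero_le
    · rw [ex_add, ex_const, ex_mul_left]
      refine le_trans (add_le_add_right (mul_le_mul_right hg _) _) ?_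
      rw [← ENNReal.ofReal_mul (by norm_num), ← ENNReal.ofReal_add (by norm_num) (by nlinarith)]
      exact ENNReal.ofReal_le_ofReal (by linarith)

theorem greedy_card (f : BoolFn n) (hv : Fin n → ℕ) (X : Finset ℕ) (d : ℕ) (x a : Str n) (r : ℕ) :
    (greedy f hv X d x a r).card ≤ r := by
  induction r with
  | zero => simp [greedy]
  | succ r ih =>
    rw [greedy]
    split_ifs
    · omega
    · exact (Finset.card_insert_le _ _).trans (by omega)

/-- The potential is `2 ^ (s - number of terms)` while nothing has been rejected. A round with a
mistake rejects or adds a term and so at least halves it; hence each round multiplies its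
expectation by at most `1/2 + 1/2 * (1 - ε / 64) = 1 - ε / 128`. -/
theorem phase2_sound {mono : Bool} {s r : ℕ} {f : BoolFn n} {D : PMF (Str n)} {hv : Fin n → ℕ}
    {σ : Phase1 n} {ε : ℝ} (hε0 : 0 < ε) (hε : ε ≤ 1) (d R : ℕ)
    (hfar : ∀ g ∈ cls mono n s r, agr D (σ.fn f hv) g ≤ ENNReal.ofReal (1 - ε / 2)) :
    ex (phase2 mono f D hv d s r R σ) (fun τ => chi (τ.rej = false)) ≤
      2 ^ s * ENNReal.ofReal (1 - ε / 128) ^ R := by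
  set lam := ENNReal.ofReal (1 - ε / 128)
  have hlam : ENNReal.ofReal (1 / 2) + ENNReal.ofReal (1 / 2) * ENNReal.ofReal (1 - ε / 64) ≤
      lam := by
    rw [← ENNReal.ofReal_mul (by norm_num), ← ENNReal.ofReal_add (by norm_num) (by nlinarith)]
    exact ENNReal.ofReal_le_ofReal (by linarith)
  have hhalf : ∀ j : ℕ, (2 : ENNReal) ^ j = ENNReal.ofReal (1 / 2) * 2 ^ (j + 1) := by
    intro j
    rw [show (2 : ENNReal) ^ (j + 1) = ENNReal.ofReal 2 * 2 ^ j by rw [pow_succ]; norm_num; ring,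
      ← mul_assoc, ← ENNReal.ofReal_mul (by norm_num)]
    norm_num
  have hone : ENNReal.ofReal (1 / 2) + ENNReal.ofReal (1 / 2) = 1 := by
    rw [← ENNReal.ofReal_add (by norm_num) (by norm_num)]; norm_num
  have key : ∀ R j τ, τ.tms.length ≤ s → (∀ T ∈ τ.tms, T.card ≤ r) →
      ex (itr (fun _ τ => D.bind fun x => (unif n).bind fun u => (unif n).bind fun v =>
        (unif n).bind fun z => PMF.pure (step2 mono f hv d s r σ x u v z τ)) j R τ)
        (fun τ => chi (τ.rej = false)) ≤
      chi (τ.rej = false) * (2 ^ (s - τ.tms.length) * lam ^ R) := by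
    intro R
    induction R with
    | zero =>
      intro j τ _ _
      rw [itr, ex_pure, pow_zero, mul_one]
      exact le_mul_of_one_le_right (zero_le) (one_le_pow₀ (by norm_num))
    | succ R ih =>
      intro j τ hJ hT
      simp only [itr, ex_bind, ex_pure]
      have hstep : ∀ x u v z, ex (itr (fun _ τ => D.bind fun x => (unif n).bind fun u =>
          (unif n).bind fun v => (unif n).bind fun z =>
            PMF.pure (step2 mono f hv d s r σ x u v z τ)) (j + 1) R
          (step2 mono f hv d s r σ x u v z τ)) (fun τ => chi (τ.rej = false)) ≤
          (chi (τ.rej = false) * (2 ^ (s - τ.tms.length) * lam ^ R)) * (ENNReal.ofReal (1 / 2) +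
            ENNReal.ofReal (1 / 2) * chi (litsOK mono f hv σ x u v z = true ∧
              σ.fn f hv x = hyp f hv σ τ.tms x)) := by
        intro x u v z
        have hrej : τ.rej = true → (step2 mono f hv d s r σ x u v z τ).rej = true := by
          intro h; unfold step2; split_ifs <;> simp [h]
        have hval : (step2 mono f hv d s r σ x u v z τ).tms.length ≤ s ∧
            ∀ T ∈ (step2 mono f hv d s r σ x u v z τ).tms, T.card ≤ r := by
          unfold step2
          split_ifs with h1 h2
          · refine ⟨by simp; omega, ?_⟩
            intro T hT'
            rw [List.mem_append, List.mem_singleton] at hT'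
            rcases hT' with h | rfl
            · exact hT T h
            · exact greedy_card _ _ _ _ _ _ _
          · exact ⟨hJ, hT⟩
          · exact ⟨hJ, hT⟩
        refine (ih _ _ hval.1 hval.2).trans ?_
        by_cases hτ : τ.rej = false
        swap
        · rw [Bool.not_eq_false] at hτ
          rw [hrej hτ, chi_not (by simp), hτ, chi_not (by simp)]; simp
        rw [chi_of hτ, one_mul]
        by_cases hm : litsOK mono f hv σ x u v z = true ∧ σ.fn f hv x = hyp f hv σ τ.tms x
        · rw [chi_of hm, mul_one, hone, mul_one]
          have : (step2 mono f hv d s r σ x u v z τ).tms = τ.tms := by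
            unfold step2
            rw [if_neg (by rintro ⟨h1, h2⟩; rw [hm.2, h2] at h1; cases h1)]
          rw [this]
          exact mul_le_of_le_one_left zero_le (chi_le_one _)
        · rw [chi_not hm, mul_zero, add_zero]
          by_cases hs2 : (step2 mono f hv d s r σ x u v z τ).rej = false
          swap
          · rw [chi_not hs2]; simp
          have : (step2 mono f hv d s r σ x u v z τ).tms.length = τ.tms.length + 1 := by
            revert hs2
            unfold step2
            split_ifs with h1 h2
            · intro _; simp
            · intro h; cases h
            · intro h
              exfalso
              simp only [Bool.or_eq_false_iff, Bool.not_eq_false', Bool.and_eq_false_iff] at h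
              refine hm ⟨h.1.2, ?_⟩
              cases h3 : σ.fn f hv x <;> cases h4 : hyp f hv σ τ.tms x <;>
                simp [h3, h4] at h h1 ⊢
          rw [chi_of hs2, one_mul, this]
          obtain ⟨q, hq⟩ : ∃ q, s - τ.tms.length = q + 1 := ⟨s - τ.tms.length - 1, by
            have := hval.1; omega⟩
          rw [hq, show s - (τ.tms.length + 1) = q by omega, hhalf q]
          exact le_of_eq (by ring)
      refine le_trans (ex_mono D fun x => ex_mono _ fun u => ex_mono _ fun v => ex_mono _ fun z =>
        hstep x u v z) ?_
      simp only [ex_mul_left, ex_add, ex_const]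
      have e : ∀ A B C L : ENNReal, A * (B * (C * L)) = A * (B * C) * L := by intros; ring
      rw [pow_succ, e]
      refine mul_le_mul_right (le_trans ?_ hlam) _
      gcongr
      exact no_mistake_le hε0 hε hfar hJ hT
  refine (key R 0 ⟨[], false⟩ (by simp) (by simp)).trans ?_
  rw [chi_of rfl, one_mul]
  simp

theorem answer_sound {mono : Bool} {s r : ℕ} {f : BoolFn n} {D : PMF (Str n)} {ε : ℝ}
    (hε0 : 0 < ε) (hε : ε ≤ 1) (hfar : IsFarFromClass D ε f (cls mono n s r))
    (d k N R₁ R₂ : ℕ) :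
    ex (answer mono f D d k s r N R₁ R₂) (fun b => chi (b = true)) ≤
      (k + 1 : ℕ) * ENNReal.ofReal (1 - ε / 2) ^ N + 2 ^ s * ENNReal.ofReal (1 - ε / 128) ^ R₂ := by
  rw [answer, ex_bind]
  refine ex_le _ fun hv => ?_
  rw [ex_bind]
  refine le_trans (ex_mono _ (h := fun σ => chi (σ.cnt = N ∧ agr D f (σ.fn f hv) ≤
    ENNReal.ofReal (1 - ε / 2)) + 2 ^ s * ENNReal.ofReal (1 - ε / 128) ^ R₂) fun σ => ?_) ?_
  · rw [ex_bind]
    simp only [ex_pure, Bool.and_eq_true, decide_eq_true_eq, Bool.not_eq_true']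
    by_cases hc : σ.cnt = N
    swap
    · refine le_trans (ex_le _ (c := 0) fun τ => ?_) zero_le
      rw [chi_not fun h => hc h.1]
    by_cases hb : agr D f (σ.fn f hv) ≤ ENNReal.ofReal (1 - ε / 2)
    · rw [chi_of ⟨hc, hb⟩]
      exact le_trans (ex_le _ fun τ => chi_le_one _) le_self_add
    · refine le_trans ?_ le_add_self
      refine le_trans (ex_mono _ fun τ => chi_mono fun h => h.2) ?_
      refine phase2_sound hε0 hε d R₂ fun g hg => ?_
      -- Two agreements above `1 - ε / 2` would make `f` agree with a member of the class with
      -- probability above `1 - ε`.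
      by_contra hlt
      push Not at hb hlt
      have h1 := (agr_triangle D f (σ.fn f hv) g).trans
        (add_le_add_right (agr_le_of_far (hfar g hg)) 1)
      have h2 := ENNReal.add_lt_add hb hlt
      refine absurd (lt_of_lt_of_le h2 h1) (not_lt.2 ?_)
      rw [← ENNReal.ofReal_add (by linarith) (by linarith), ← ENNReal.ofReal_one,
        ← ENNReal.ofReal_add (by norm_num) (by linarith)]
      exact ENNReal.ofReal_le_ofReal (by linarith)
  · rw [ex_add, ex_const]
    gcongr
    exact phase1_sound f D hv d k N R₁ _

end Sound

/-! ### Subroutines of the program -/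

infixr:60 " ;; " => Prog.seq

section Subroutines

variable {n : ℕ}

def Rep (cells : ℕ → ℕ) (x : Str n) : Prop := ∀ i : Fin n, cells i = (x i).toNat

theorem Rep.read {cells : ℕ → ℕ} {x : Str n} (h : Rep cells x) : readString n cells = x := by
  ext i; rw [readString, h i]; cases x i <;> rfl

/-- The first `2 ^ d` cells tell which blocks belong to a set. -/
def Flag (d : ℕ) (cells : ℕ → ℕ) (F : ℕ → Bool) : Prop := ∀ b < 2 ^ d, cells b ≠ 0 ↔ F b = true

/-- The data that stay unchanged after the setup. -/
structure Env (s r k d N : ℕ) (hv : Fin n → ℕ) (σ : St) : Prop where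
  n_eq : σ.reg 0 = n
  s_eq : σ.reg 1 = s
  r_eq : σ.reg 2 = r
  k_eq : σ.reg 6 = k
  d_eq : σ.reg 7 = d
  m_eq : σ.reg 8 = 2 ^ d
  N_eq : σ.reg 9 = N
  hash : ∀ i : Fin n, σ.arr 5 i = hv i
  pow : ∀ j < d, σ.arr 12 j = 2 ^ j
  ones : Flag d (σ.arr 13) every
  zero : Rep (σ.arr 15) (zs : Str n)
  lt : ∀ i, hv i < 2 ^ d

/-- The constants of `Env` occupy registers below 12 and the arrays 5, 12, 13 and 15. The check is
Boolean, so that evaluation settles it for each subroutine. -/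
def envSafe (P : Prog) : Bool :=
  (wr P).all (fun x => decide (12 ≤ x)) && (wa P).all fun a => !([5, 12, 13, 15].contains a)

variable {s r k d N : ℕ} {hv : Fin n → ℕ}

theorem Env.fr {P : Prog} {σ τ : St} (h : Env s r k d N hv σ) (hf : Fr P σ τ)
    (hs : envSafe P = true) : Env s r k d N hv τ := by
  simp only [envSafe, Bool.and_eq_true, List.all_eq_true, decide_eq_true_eq] at hs
  have hr : ∀ x < 12, τ.reg x = σ.reg x := fun x hx => hf.reg x fun h => by
    have := hs.1 x h; omega
  have ha : ∀ a ∈ [5, 12, 13, 15], τ.arr a = σ.arr a := fun a ha => hf.arr a fun h => by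
    have := hs.2 a h
    rw [List.contains_iff_mem.2 ha] at this
    cases this
  obtain ⟨h0, h1, h2, h3, h4, h5, h6, h7, h8, h9, h10, h11⟩ := h
  constructor
  · rwa [hr _ (by norm_num)]
  · rwa [hr _ (by norm_num)]
  · rwa [hr _ (by norm_num)]
  · rwa [hr _ (by norm_num)]
  · rwa [hr _ (by norm_num)]
  · rwa [hr _ (by norm_num)]
  · rwa [hr _ (by norm_num)]
  · rwa [ha 5 (by simp)]
  · rwa [ha 12 (by simp)]
  · rwa [ha 13 (by simp)]
  · rwa [ha 15 (by simp)]
  · exact h11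

/-- Array 0 holds the query string, 1 the sample, 5 the hash values and 6 the reference. The
comparison with the bound in register 27 is made by truncated subtraction. -/
def mixBody (F G : ℕ) : Prog :=
  .load 22 5 20 ;; .load 24 F 22 ;; .ite 24 (.load 23 1 20)
    (.sub 25 27 22 ;; .ite 25 (.load 24 G 22 ;; .ite 24 (.load 23 1 20) (.load 23 6 20))
      (.load 23 6 20)) ;; .store 0 20 23

/-- Query the string that equals the sample on the blocks in `F` and on the blocks in `G` below the
number in register `27`, and the reference string elsewhere. -/
def ask (F G : ℕ) : Prog := forUp 20 21 0 (mixBody F G) ;; .memQuery 26 0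

variable {f : BoolFn n} {D : PMF (Fin n → Bool)}

theorem ask_spec {F G p : ℕ} {Fb Gb : ℕ → Bool} {x a : Str n} {σ : St}
    (hE : Env s r k d N hv σ) (hx : Rep (σ.arr 1) x) (ha : Rep (σ.arr 6) a)
    (hF : Flag d (σ.arr F) Fb) (hG : Flag d (σ.arr G) Gb) (hF0 : F ≠ 0) (hG0 : G ≠ 0)
    (hp : σ.reg 27 = p) :
    Det f D (ask F G) (n * 30 + 10) 1 σ fun τ =>
      τ.reg 26 = (vl f hv Fb Gb x a p).toNat ∧ Rep (τ.arr 0) (mix hv (mask Fb Gb p) x a) := by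
  refine Det.mono (Det.seq (T' := 1) (q' := 1) (det_fill (i := 20) (t := 21) (N := 0)
    (body := mixBody F G) 0 (fun i => if h : i < n then
    (mix hv (mask Fb Gb p) x a ⟨i, h⟩).toNat else 0) (A := 0) (M := n) (by decide) (by decide)
    (by decide) (by simp [mixBody, wr]) (by simp [mixBody, wr]) rfl hE.n_eq ?_) ?_)
    (T := n * (20 + 8) + 6 + 1 + 1) (by omega) (q := 0 + 1) le_rfl fun _ _ h => h
  · intro i hi τ hf h20 _
    have h5 : τ.arr 5 i = hv ⟨i, hi⟩ := by
      rw [hf.arr 5 (by simp [forUp, mixBody, wa])]; exact hE.hash ⟨i, hi⟩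
    have h1 : τ.arr 1 i = (x ⟨i, hi⟩).toNat := by
      rw [hf.arr 1 (by simp [forUp, mixBody, wa])]; exact hx ⟨i, hi⟩
    have h6 : τ.arr 6 i = (a ⟨i, hi⟩).toNat := by
      rw [hf.arr 6 (by simp [forUp, mixBody, wa])]; exact ha ⟨i, hi⟩
    have hF' : τ.arr F = σ.arr F := hf.arr F (by simp [forUp, mixBody, wa, hF0])
    have hG' : τ.arr G = σ.arr G := hf.arr G (by simp [forUp, mixBody, wa, hG0])
    have h27 : τ.reg 27 = p := by rw [hf.reg 27 (by simp [forUp, mixBody, wr]), hp]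
    have e1 := hF _ (hE.lt ⟨i, hi⟩)
    have e2 := hG _ (hE.lt ⟨i, hi⟩)
    rw [dif_pos hi, zero_add]
    simp only [mixBody, ev, St.set_reg, St.set_arr, h20, h5, if_true, hF', hG', h27]
    simp only [mix, mask]
    by_cases c1 : σ.arr F (hv ⟨i, hi⟩) = 0
    · have : Fb (hv ⟨i, hi⟩) = false := by rw [← Bool.not_eq_true, ← e1]; simp [c1]
      by_cases c2 : p - hv ⟨i, hi⟩ = 0
      · have h' : ¬ hv ⟨i, hi⟩ < p := by omega
        simp [c1, c2, this, h', h20, h6]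
      · have h' : hv ⟨i, hi⟩ < p := by omega
        by_cases c3 : σ.arr G (hv ⟨i, hi⟩) = 0
        · have h'' : Gb (hv ⟨i, hi⟩) = false := by rw [← Bool.not_eq_true, ← e2]; simp [c3]
          simp [c1, c2, c3, this, h'', h20, h6]
        · have h'' := e2.1 c3
          simp [c1, c2, c3, this, h', h'', h20, h1]
    · have := e1.1 c1
      simp [c1, this, h20, h1]
  · rintro τ hf ⟨h1, -⟩
    have hR : Rep (τ.arr 0) (mix hv (mask Fb Gb p) x a) := fun i => by
      have := h1 i i.2
      rw [dif_pos i.2, zero_add] at this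
      exact this
    refine det_ev _ _ _ rfl ?_
    simp only [ev, St.set_reg, if_true, St.set_arr]
    exact ⟨by rw [hR.read]; rfl, hR⟩

theorem srchFrom_lt (val : ℕ → Bool) (j p : ℕ) : srchFrom val j p < p + 2 ^ j := by
  induction j generalizing p with
  | zero => simp [srchFrom]
  | succ j ih =>
    rw [srchFrom, pow_succ]
    split_ifs
    · have := ih (p + 2 ^ j); omega
    · have := ih p; omega

theorem srch_lt (val : ℕ → Bool) (d : ℕ) : srch val d < 2 ^ d := by
  simpa [srch] using srchFrom_lt val d 0

def mv (x y : ℕ) : Prog := .const x 0 ;; .add x x y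

def searchBody (F G : ℕ) : Prog :=
  (.sub 33 7 30 ;; .const 34 1 ;; .sub 33 33 34 ;; .load 32 12 33 ;; .add 27 28 32) ;; ask F G ;;
    (.sub 34 26 29 ;; .sub 35 29 26 ;; .add 34 34 35 ;; .ite 34 .skip (mv 28 27))

/-- Binary search: the place goes to register `28` and the value at zero to register `29`. -/
def search (F G : ℕ) : Prog :=
  .const 27 0 ;; ask F G ;; (mv 29 26 ;; .const 28 0) ;; forUp 30 31 7 (searchBody F G)

theorem search_spec {F G : ℕ} {Fb Gb : ℕ → Bool} {x a : Str n} {σ : St}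
    (hE : Env s r k d N hv σ) (hx : Rep (σ.arr 1) x) (ha : Rep (σ.arr 6) a)
    (hF : Flag d (σ.arr F) Fb) (hG : Flag d (σ.arr G) Gb) (hF0 : F ≠ 0) (hG0 : G ≠ 0) :
    Det f D (search F G) (d * (n * 30 + 50) + n * 30 + 40) (d + 1) σ fun τ =>
      τ.reg 28 = srch (vl f hv Fb Gb x a) d ∧ τ.reg 29 = (vl f hv Fb Gb x a 0).toNat := by
  set val := vl f hv Fb Gb x a
  have hbody : wa (searchBody F G) = [0] := rfl
  refine Det.mono (Det.seq (T := 1) (q := 0) (R := fun τ => τ.reg 27 = 0) (det_ev _ _ _ rfl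
    (by simp [ev])) (T' := (n * 30 + 10) + (5 + (d * ((n * 30 + 33) + 8) + 6) + 1) + 1)
    (q' := 1 + (0 + ∑ j ∈ Finset.range d, 1)) ?_) (by ring_nf; omega) (by simp; omega)
    fun _ _ h => h
  intro τ₁ hf₁ h27
  have hE₁ := hE.fr hf₁ rfl
  have ha₁ : τ₁.arr = σ.arr := by ext b; rw [hf₁.arr b (by simp [wa])]
  refine Det.seq (ask_spec hE₁ (by rwa [ha₁]) (by rwa [ha₁]) (by rwa [ha₁]) (by rwa [ha₁]) hF0 hG0
    h27) ?_
  rintro τ₂ hf₂ ⟨h26, -⟩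
  have hE₂ := hE₁.fr hf₂ rfl
  have ha₂ : ∀ b ≠ 0, τ₂.arr b = σ.arr b := fun b hb => by
    rw [hf₂.arr b (by simpa [ask, forUp, mixBody, wa] using hb), ha₁]
  refine Det.seq (T := 5) (q := 0) (R := fun τ => τ.reg 28 = 0 ∧ τ.reg 29 = (val 0).toNat)
    (det_ev _ _ _ rfl (by simp [ev, mv, h26, val])) ?_
  rintro τ₃ hf₃ ⟨h28, h29⟩
  have hE₃ := hE₂.fr hf₃ rfl
  have ha₃ : ∀ b ≠ 0, τ₃.arr b = σ.arr b := fun b hb => by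
    rw [hf₃.arr b (by simp [mv, wa]), ha₂ b hb]
  -- The invariant says that the remaining `d - j` halvings started at register 28 lead to the
  -- result of the whole search.
  refine Det.mono (det_for (Tb := n * 30 + 33) (qb := fun _ => 1) (M := d)
    (fun j τ => srchFrom val (d - j) (τ.reg 28) = srch val d ∧ τ.reg 29 = (val 0).toNat)
    (by decide) (by decide) (by decide) (by simp [searchBody, mv, ask, forUp, mixBody, wr])
    (by simp [searchBody, mv, ask, forUp, mixBody, wr]) hE₃.d_eq ?_ ?_) le_rfl le_rfl ?_
  · rintro τ - - hr
    rw [hr 28 (by decide) (by decide), hr 29 (by decide) (by decide), h28, h29]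
    exact ⟨rfl, rfl⟩
  · rintro j hj τ hf ⟨hp, h29⟩ h30 -
    have hEτ := hE₃.fr hf rfl
    have haτ : ∀ b ≠ 0, τ.arr b = σ.arr b := fun b hb => by
      rw [hf.arr b (by simpa [hbody, forUp, wa] using hb), ha₃ b hb]
    obtain ⟨i, hi⟩ : ∃ i, d - j = i + 1 := ⟨d - j - 1, by omega⟩
    refine Det.mono (Det.seq (T := 9) (q := 0) (R := fun τ' => τ'.reg 27 = τ.reg 28 + 2 ^ i ∧
      τ'.reg 28 = τ.reg 28 ∧ τ'.reg 29 = τ.reg 29 ∧ τ'.arr = τ.arr) (det_ev _ _ _ rfl ?_)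
      (T' := (n * 30 + 10) + 11 + 1) (q' := 1 + 0) ?_) (by omega) (by omega) fun _ _ h => h
    · simp only [ev, St.set_reg, St.set_arr, h30, hEτ.d_eq]
      have : d - j - 1 = i := by omega
      simp [this, hEτ.pow i (by omega)]
    · rintro τ₄ hf₄ ⟨h27, h28, h29', ha₄⟩
      have hE₄ := hEτ.fr hf₄ rfl
      have hb₄ : ∀ b ≠ 0, τ₄.arr b = σ.arr b := fun b hb => by rw [ha₄, haτ b hb]
      refine Det.seq (T := n * 30 + 10) (T' := 11) (q := 1) (q' := 0) (ask_spec hE₄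
        (by rwa [hb₄ 1 (by decide)]) (by rwa [hb₄ 6 (by decide)])
        (by rwa [hb₄ F hF0]) (by rwa [hb₄ G hG0]) hF0 hG0 h27) ?_
      rintro τ₅ hf₅ ⟨h26, -⟩
      have r27 : τ₅.reg 27 = τ.reg 28 + 2 ^ i := by
        rw [hf₅.reg 27 (by simp [ask, forUp, mixBody, wr]), h27]
      have r28 : τ₅.reg 28 = τ.reg 28 := by
        rw [hf₅.reg 28 (by simp [ask, forUp, mixBody, wr]), h28]
      have r29 : τ₅.reg 29 = (val 0).toNat := by
        rw [hf₅.reg 29 (by simp [ask, forUp, mixBody, wr]), h29', h29]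
      refine det_ev _ _ _ rfl ?_
      intro τ₆ _ hr₆
      rw [hr₆ 28 (by decide) (by decide), hr₆ 29 (by decide) (by decide)]
      rw [hi, srchFrom] at hp
      rw [show d - (j + 1) = i by omega]
      simp only [ev, St.set_reg, h26, r29, mv]
      rw [show vl f hv Fb Gb x a = val from rfl]
      cases h1 : val (τ.reg 28 + 2 ^ i) <;> cases h2 : val 0 <;>
        simp [h1, h2] at hp <;> simp [r27, r28, r29, hp, h2]
  · rintro τ - ⟨hp, h29⟩
    rw [Nat.sub_self] at hp
    exact ⟨hp, h29⟩

end Subroutines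

/-! ### The first phase as a program -/

section FirstPhase

variable {n : ℕ} {s r k d N : ℕ} {hv : Fin n → ℕ} {f : BoolFn n} {D : PMF (Fin n → Bool)}

/-- Multiplication by repeated addition. -/
theorem det_addLoop (i t M acc y : ℕ) (σ : St) (hit : i ≠ t) (hiM : i ≠ M) (htM : t ≠ M)
    (hai : acc ≠ i) (hat : acc ≠ t) (haM : acc ≠ M) (hay : y ≠ acc) (hyi : y ≠ i) (hyt : y ≠ t) :
    Det f D (forUp i t M (.add acc acc y)) (σ.reg M * (1 + 8) + 6) 0 σ fun τ =>
      τ.reg acc = σ.reg acc + σ.reg M * σ.reg y := by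
  have := det_for (f := f) (D := D) (σ := σ) (i := i) (t := t) (N := M) (body := .add acc acc y)
    (Tb := 1) (qb := fun _ => 0) (M := σ.reg M) (fun j τ => τ.reg acc = σ.reg acc + j * σ.reg y) hit hiM
    htM
    (by simpa [wr] using hai.symm) (by simpa [wr] using haM.symm) rfl ?_ ?_
  · simpa using this
  · intro τ _ _ hr
    simp [hr acc hai hat]
  · intro j _ τ hf h hi hM
    refine det_ev _ _ _ rfl ?_
    intro τ'' _ hr
    rw [hr acc hai hat]
    have : τ.reg y = σ.reg y := hf.reg y (by simp [forUp, wr, hyi, hyt, hay])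
    simp [ev, h, this]; ring

theorem mv_spec (x y : ℕ) (h : x ≠ y) (σ : St) :
    Det f D (mv x y) 3 0 σ fun τ => τ.reg x = σ.reg y ∧ τ.arr = σ.arr :=
  det_ev _ _ _ rfl (by simp [ev, mv, h.symm])

/-- The data found in the first phase. -/
structure Rel1 (k d : ℕ) (ρ : Phase1 n) (σ : St) : Prop where
  a : Rep (σ.arr 6) ρ.a
  X : Flag d (σ.arr 7) (mem ρ.X)
  X_lt : ∀ b ∈ ρ.X, b < 2 ^ d
  base : ∀ b < 2 ^ d, ∀ i : Fin n, σ.arr 8 (b * n + i) = (ρ.base b i).toNat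
  card_le : ρ.X.card ≤ k

theorem Rel1.of_arr {ρ : Phase1 n} {σ τ : St} (h : Rel1 k d ρ σ) (h6 : τ.arr 6 = σ.arr 6)
    (h7 : τ.arr 7 = σ.arr 7) (h8 : τ.arr 8 = σ.arr 8) : Rel1 k d ρ τ :=
  ⟨h6 ▸ h.a, h7 ▸ h.X, h.X_lt, h8 ▸ h.base, h.card_le⟩

structure Count1 (k N : ℕ) (ρ : Phase1 n) (σ : St) : Prop where
  cnt : σ.reg 13 = ρ.cnt
  K : σ.reg 14 = ρ.K
  card_le : ρ.X.card ≤ ρ.K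
  K_le : ρ.K ≤ k

/-- Record the queried string as the witness of the block in register `28`. -/
def saveBase : Prog :=
  .const 40 0 ;; forUp 41 42 28 (.add 40 40 0) ;;
    forUp 43 44 0 (.load 45 0 43 ;; .add 46 40 43 ;; .store 8 46 45)

theorem block_ne {b c n : ℕ} (h : b ≠ c) (i : Fin n) : b * n + i < c * n ∨ c * n + n ≤ b * n + i := by
  rcases Nat.lt_or_gt_of_ne h with h | h
  · left
    have := Nat.mul_le_mul_right n h
    rw [Nat.succ_mul] at this
    have := i.2; omega
  · right
    have := Nat.mul_le_mul_right n h
    rw [Nat.succ_mul] at this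
    omega

theorem saveBase_spec {σ : St} {w : Str n} {p : ℕ} (hE : Env s r k d N hv σ) (hw : Rep (σ.arr 0) w)
    (hp : σ.reg 28 = p) :
    Det f D saveBase (p * 9 + n * 20 + 20) 0 σ fun τ =>
      (∀ i : Fin n, τ.arr 8 (p * n + i) = (w i).toNat) ∧
        ∀ b ≠ p, ∀ i : Fin n, τ.arr 8 (b * n + i) = σ.arr 8 (b * n + i) := by
  refine Det.mono (Det.seq (T := 1) (q := 0) (R := fun τ => τ.reg 40 = 0) (det_ev _ _ _ rfl
    (by simp [ev])) (T' := (p * (1 + 8) + 6) + (n * (5 + 8) + 6) + 1) (q' := 0 + 0) ?_)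
    (by omega) le_rfl fun _ _ h => h
  rintro τ₁ hf₁ h40
  have hp₁ : τ₁.reg 28 = p := by rw [hf₁.reg 28 (by decide), hp]
  have hE₁ := hE.fr hf₁ rfl
  refine Det.seq (Det.mono (det_addLoop 41 42 28 40 0 τ₁ (by decide) (by decide) (by decide)
    (by decide) (by decide) (by decide) (by decide) (by decide) (by decide)) (by rw [hp₁]) le_rfl
    fun _ _ h => h) ?_
  rintro τ₂ hf₂ h
  have hE₂ := hE₁.fr hf₂ rfl
  rw [h40, hp₁, hE₁.n_eq, zero_add] at h
  have ha₂ : τ₂.arr = σ.arr := by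
    ext b; rw [hf₂.arr b (by simp [forUp, wa]), hf₁.arr b (by simp [wa])]
  refine Det.mono (det_fill (A := 8) (p * n) (fun i => σ.arr 0 i) (by decide) (by decide) (by decide)
    (by decide) (by decide) rfl hE₂.n_eq ?_) le_rfl le_rfl ?_
  · intro i hi τ hf h43 _
    have h0 : τ.arr 0 = σ.arr 0 := by rw [hf.arr 0 (by decide), ha₂]
    have h40 : τ.reg 40 = p * n := by rw [hf.reg 40 (by decide), h]
    simp [ev, h43, h0, h40]
  · rintro τ - ⟨h1, h2⟩
    refine ⟨fun i => ?_, fun b hb i => ?_⟩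
    · rw [h1 i i.2, hw i]
    · rw [h2 _ (block_ne hb i), ha₂]

/-- Replace the reference string by the sample on the block in register `28`. -/
def moveRef : Prog :=
  forUp 43 44 0 (.load 45 5 43 ;; .sub 46 45 28 ;; .sub 47 28 45 ;; .add 46 46 47 ;;
    .load 45 6 43 ;; .ite 46 .skip (.load 45 1 43) ;; .store 6 43 45)

theorem moveRef_spec {σ : St} {x a : Str n} {p : ℕ} (hE : Env s r k d N hv σ)
    (hx : Rep (σ.arr 1) x) (ha : Rep (σ.arr 6) a) (hp : σ.reg 28 = p) :
    Det f D moveRef (n * 30 + 20) 0 σ fun τ => Rep (τ.arr 6) (mix hv (fun b => b == p) x a) := by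
  refine Det.mono (det_fill (A := 6) (Tb := 20) 0 (fun i => if h : i < n then
    (mix hv (fun b => b == p) x a ⟨i, h⟩).toNat else 0) (by decide) (by decide) (by decide)
    (by decide) (by decide) rfl hE.n_eq ?_) (by omega) le_rfl ?_
  · intro i hi τ hf h43 h6
    have h5 : τ.arr 5 i = hv ⟨i, hi⟩ := by rw [hf.arr 5 (by decide)]; exact hE.hash ⟨i, hi⟩
    have h1 : τ.arr 1 i = (x ⟨i, hi⟩).toNat := by rw [hf.arr 1 (by decide)]; exact hx ⟨i, hi⟩
    have h6 : τ.arr 6 i = (a ⟨i, hi⟩).toNat := by rw [h6 i (by omega)]; exact ha ⟨i, hi⟩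
    have h28 : τ.reg 28 = p := by rw [hf.reg 28 (by decide), hp]
    rw [dif_pos hi, zero_add]
    simp only [ev, St.set_reg, h43, St.set_arr, h5, h28]
    by_cases c : hv ⟨i, hi⟩ = p
    · simp [mix, c, h43, h1]
    · have : ¬(hv ⟨i, hi⟩ - p = 0 ∧ p - hv ⟨i, hi⟩ = 0) := by omega
      simp [mix, c, h43, h6, this]
  · rintro τ - ⟨h1, -⟩ i
    have := h1 i i.2
    rw [dif_pos i.2, zero_add] at this
    exact this

/-- The search leaves an arbitrary string of the path in array 0, so one further query rebuilds the
string at the place found before it is saved as a witness. -/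
def addBlock : Prog :=
  mv 27 28 ;; ask 7 13 ;; saveBase ;; .ite 29 moveRef .skip ;;
    (.const 38 1 ;; .store 7 28 38 ;; .add 14 14 38 ;; .const 13 0)

theorem addBlock_spec {σ : St} {x : Str n} {ρ : Phase1 n} {p : ℕ} {v : Bool}
    (hE : Env s r k d N hv σ) (hx : Rep (σ.arr 1) x) (hR : Rel1 k d ρ σ) (hC : Count1 k N ρ σ)
    (hp : σ.reg 28 = p) (hv0 : σ.reg 29 = v.toNat) (hpd : p < 2 ^ d) (hK : ρ.K < k) :
    Det f D addBlock (p * 9 + n * 80 + 100) 1 σ fun τ =>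
      let ρ' : Phase1 n := ⟨if v then mix hv (fun b => b == p) x ρ.a else ρ.a, insert p ρ.X,
        Function.update ρ.base p (mix hv (mask (mem ρ.X) every p) x ρ.a), 0, ρ.K + 1⟩
      Rel1 k d ρ' τ ∧ Count1 k N ρ' τ := by
  refine Det.mono (Det.seq (mv_spec 27 28 (by decide) σ) (T' := (n * 30 + 10) +
    ((p * 9 + n * 20 + 20) + ((n * 30 + 20 + 1) + 7 + 1) + 1) + 1) (q' := 1 + (0 + (0 + 0))) ?_)
    (by omega) (by omega) fun _ _ h => h
  rintro τ₁ hf₁ ⟨h27, ha₁⟩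
  have hE₁ := hE.fr hf₁ rfl
  refine Det.seq (ask_spec hE₁ (by rwa [ha₁]) (by rw [ha₁]; exact hR.a) (by rw [ha₁]; exact hR.X)
    hE₁.ones (by decide) (by decide) (h27.trans hp)) ?_
  rintro τ₂ hf₂ ⟨-, h0⟩
  have hE₂ := hE₁.fr hf₂ rfl
  have r28 : τ₂.reg 28 = p := by rw [hf₂.reg 28 (by decide), hf₁.reg 28 (by decide), hp]
  refine Det.seq (saveBase_spec hE₂ h0 r28) ?_
  rintro τ₃ hf₃ ⟨hb1, hb2⟩
  have hE₃ := hE₂.fr hf₃ rfl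
  have r28 : τ₃.reg 28 = p := by rw [hf₃.reg 28 (by decide), r28]
  have r29 : τ₃.reg 29 = v.toNat := by
    rw [hf₃.reg 29 (by decide), hf₂.reg 29 (by decide), hf₁.reg 29 (by decide), hv0]
  have a1 : Rep (τ₃.arr 1) x := by
    rw [hf₃.arr 1 (by decide), hf₂.arr 1 (by decide), ha₁]; exact hx
  have a6 : Rep (τ₃.arr 6) ρ.a := by
    rw [hf₃.arr 6 (by decide), hf₂.arr 6 (by decide), ha₁]; exact hR.a
  have a7 : τ₃.arr 7 = σ.arr 7 := by
    rw [hf₃.arr 7 (by decide), hf₂.arr 7 (by decide), ha₁]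
  have a8 : τ₂.arr 8 = σ.arr 8 := by rw [hf₂.arr 8 (by decide), ha₁]
  refine Det.seq (T := n * 30 + 20 + 1) (T' := 7) (q := 0) (q' := 0)
    (R := fun τ => Rep (τ.arr 6) (if v then mix hv (fun b => b == p) x ρ.a else ρ.a))
    (Det.ite (fun h => ?_) fun h => ?_) ?_
  · have : v = true := by cases v <;> simp_all
    subst this
    exact moveRef_spec hE₃ a1 a6 r28
  · have : v = false := by cases v <;> simp_all
    subst this
    exact (det_ev (T := 1) .skip _ _ rfl a6).mono (by omega) le_rfl fun _ _ h => h
  · rintro τ₄ hf₄ h6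
    have r28 : τ₄.reg 28 = p := by rw [hf₄.reg 28 (by decide), r28]
    have r14 : τ₄.reg 14 = ρ.K := by
      rw [hf₄.reg 14 (by decide), hf₃.reg 14 (by decide), hf₂.reg 14 (by decide),
        hf₁.reg 14 (by decide), hC.K]
    have a7 : τ₄.arr 7 = σ.arr 7 := by rw [hf₄.arr 7 (by decide), a7]
    have a8' : τ₄.arr 8 = τ₃.arr 8 := hf₄.arr 8 (by decide)
    refine det_ev _ _ _ rfl ?_
    have hcard := (Finset.card_insert_le p ρ.X).trans (Nat.succ_le_succ hC.card_le)
    refine ⟨⟨?_, ?_, ?_, ?_, ?_⟩, ⟨?_, ?_, ?_, ?_⟩⟩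
    · simpa [ev] using h6
    · intro b hb
      have := hR.X b hb
      simp only [ev, St.set_reg, St.put_arr, St.set_arr, r28, a7]
      by_cases hbp : b = p
      · simp [hbp, mem]
      · simpa [Function.update_of_ne hbp, mem, hbp, r28] using this
    · intro b hb
      rcases Finset.mem_insert.1 hb with rfl | hb
      · exact hpd
      · exact hR.X_lt b hb
    · intro b hb i
      simp only [ev, St.put_arr, St.set_arr, St.set_reg]
      simp only [Nat.reduceEqDiff, if_false, a8']
      by_cases hbp : b = p
      · subst hbp; rw [hb1, Function.update_self]
      · rw [hb2 b hbp, Function.update_of_ne hbp, a8]; exact hR.base b hb i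
    · exact hcard.trans hK
    · simp [ev]
    · simp [ev, r14]
    · exact hcard
    · exact hK

/-- Put the difference of two bits into a register. -/
def xr (x y z : ℕ) : Prog := .sub 73 y z ;; .sub x z y ;; .add x x 73

theorem ev_xr_reg {x y z : ℕ} (hx : x ≠ 73) (hy : y ≠ 73) (hz : z ≠ 73) {a b : Bool} {σ : St}
    (ha : σ.reg y = a.toNat) (hb : σ.reg z = b.toNat) : (ev f (xr x y z) σ).reg x = (xor a b).toNat := by
  simp only [xr, ev, St.set_reg, if_neg hx.symm, if_neg hy, if_neg hz, ha, hb, if_true]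
  cases a <;> cases b <;> rfl

def body1 : Prog :=
  .sub 36 9 13 ;; .ite 36 (search 7 13 ;; (.memQuery 37 1 ;; xr 38 29 37) ;;
    .ite 38 (.sub 38 6 14 ;; .ite 38 addBlock (.const 38 1 ;; .add 13 9 38))
      (.const 38 1 ;; .add 13 13 38)) .skip

theorem body1_spec {σ : St} {x : Str n} {ρ : Phase1 n} (hE : Env s r k d N hv σ)
    (hx : Rep (σ.arr 1) x) (hR : Rel1 k d ρ σ) (hC : Count1 k N ρ σ) :
    Det f D body1 (d * (n * 30 + 50) + 2 ^ d * 9 + n * 110 + 200) (d + 3) σ fun τ =>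
      Rel1 k d (step1 f hv d k N x ρ) τ ∧ Count1 k N (step1 f hv d k N x ρ) τ := by
  refine Det.mono (Det.seq (T := 1) (q := 0) (R := fun τ => τ.reg 36 = N - ρ.cnt)
    (det_ev _ _ _ rfl (by simp [ev, hE.N_eq, hC.cnt])) (T' := (d * (n * 30 + 50) + n * 30 + 40) +
    (7 + (1 + (2 ^ d * 9 + n * 80 + 100 + 1) + 1 + 1) + 1) + 1 + 1)
    -- The search makes `d + 1` queries, the value at the sample takes one, and rebuilding the
    -- witness one.
    (q' := (d + 1) + (1 + (0 + 1))) ?_) (by omega) (by omega)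
    fun _ _ h => h
  intro τ₁ hf₁ h36
  have hE₁ := hE.fr hf₁ rfl
  have ha₁ : τ₁.arr = σ.arr := by ext b; rw [hf₁.arr b (by simp [wa])]
  have hR₁ : Rel1 k d ρ τ₁ := hR.of_arr (by rw [ha₁]) (by rw [ha₁]) (by rw [ha₁])
  have hC₁ : Count1 k N ρ τ₁ := ⟨by rw [hf₁.reg 13 (by decide), hC.cnt],
    by rw [hf₁.reg 14 (by decide), hC.K], hC.card_le, hC.K_le⟩
  refine Det.ite (fun h => ?_) fun h => ?_
  swap
  · refine (det_ev (T := 1) (q := 0) .skip _ _ rfl ?_).mono (by omega) (by omega) fun _ _ h => h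
    rw [step1, if_neg (by omega)]
    exact ⟨hR₁, hC₁⟩
  have hlt : ρ.cnt < N := by omega
  refine Det.seq (search_spec hE₁ (by rwa [ha₁]) hR₁.a hR₁.X hE₁.ones (by decide) (by decide)) ?_
  rintro τ₂ hf₂ ⟨h28, h29⟩
  have hE₂ := hE₁.fr hf₂ rfl
  have hR₂ : Rel1 k d ρ τ₂ := hR₁.of_arr (hf₂.arr 6 (by decide)) (hf₂.arr 7 (by decide))
    (hf₂.arr 8 (by decide))
  have hC₂ : Count1 k N ρ τ₂ := ⟨by rw [hf₂.reg 13 (by decide), hC₁.cnt],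
    by rw [hf₂.reg 14 (by decide), hC₁.K], hC.card_le, hC.K_le⟩
  have hx₂ : Rep (τ₂.arr 1) x := by rw [hf₂.arr 1 (by decide), ha₁]; exact hx
  refine Det.seq (R := fun τ => τ.reg 38 =
    (xor (vl f hv (mem ρ.X) every x ρ.a 0) (f x)).toNat) (det_ev _ _ _ rfl ?_) ?_
  · rw [ev]
    refine ev_xr_reg (by decide) (by decide) (by decide) ?_ ?_
    · simp [ev, h29]
    · simp [ev, hx₂.read]
  intro τ₃ hf₃ h38
  have hE₃ := hE₂.fr hf₃ rfl
  have ha₃ : τ₃.arr = τ₂.arr := by ext b; rw [hf₃.arr b (by simp [xr, wa])]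
  have hR₃ : Rel1 k d ρ τ₃ := hR₂.of_arr (by rw [ha₃]) (by rw [ha₃]) (by rw [ha₃])
  have hC₃ : Count1 k N ρ τ₃ := ⟨by rw [hf₃.reg 13 (by decide), hC₂.cnt],
    by rw [hf₃.reg 14 (by decide), hC₂.K], hC.card_le, hC.K_le⟩
  rw [step1, if_pos hlt]
  refine Det.ite (fun h => ?_) fun h => ?_
  swap
  · rw [h38] at h
    rw [if_pos (by revert h; cases vl f hv (mem ρ.X) every x ρ.a 0 <;> cases f x <;> simp)]
    refine (det_ev (T := 3) (q := 0) _ _ _ rfl ?_).mono (by omega) (by omega) fun _ _ h => h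
    refine ⟨⟨hR₃.a, hR₃.X, hR₃.X_lt, hR₃.base, hR₃.card_le⟩, ⟨?_, ?_, hC.card_le, hC.K_le⟩⟩
    · simp [ev, hC₃.cnt]
    · simp [ev, hC₃.K]
  rw [h38] at h
  rw [if_neg (by revert h; cases vl f hv (mem ρ.X) every x ρ.a 0 <;> cases f x <;> simp)]
  refine Det.seq (T := 1) (R := fun τ => τ.reg 38 = k - ρ.K) (det_ev _ _ _ rfl
    (by simp [ev, hE₃.k_eq, hC₃.K])) ?_
  intro τ₄ hf₄ h38
  have hE₄ := hE₃.fr hf₄ rfl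
  have ha₄ : τ₄.arr = τ₃.arr := by ext b; rw [hf₄.arr b (by simp [wa])]
  have hR₄ : Rel1 k d ρ τ₄ := hR₃.of_arr (by rw [ha₄]) (by rw [ha₄]) (by rw [ha₄])
  have hC₄ : Count1 k N ρ τ₄ := ⟨by rw [hf₄.reg 13 (by decide), hC₃.cnt],
    by rw [hf₄.reg 14 (by decide), hC₃.K], hC.card_le, hC.K_le⟩
  refine Det.ite (fun h => ?_) fun h => ?_
  · rw [if_pos (by omega)]
    have hpd := srch_lt (vl f hv (mem ρ.X) every x ρ.a) d
    refine Det.mono (addBlock_spec hE₄ (by rw [ha₄, ha₃]; exact hx₂) hR₄ hC₄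
      (p := srch (vl f hv (mem ρ.X) every x ρ.a) d) (v := vl f hv (mem ρ.X) every x ρ.a 0)
      (by rw [hf₄.reg 28 (by decide), hf₃.reg 28 (by decide), h28])
      (by rw [hf₄.reg 29 (by decide), hf₃.reg 29 (by decide), h29]) hpd (by omega))
      (by omega) le_rfl fun _ _ h => h
  · rw [if_neg (by omega)]
    refine (det_ev (T := 3) (q := 0) _ _ _ rfl ?_).mono (by omega) (by omega) fun _ _ h => h
    refine ⟨⟨hR₄.a, hR₄.X, hR₄.X_lt, hR₄.base, hR₄.card_le⟩, ⟨?_, ?_, hC.card_le, hC.K_le⟩⟩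
    · simp [ev, hE₄.N_eq]
    · simp [ev, hC₄.K]

theorem rep_writeString (cells : ℕ → ℕ) (x : Str n) : Rep (writeString cells x) x := by
  intro i; simp [writeString]

def progPhase1 : Prog := forUp 64 65 10 (.exQuery 1 ;; body1)

theorem progPhase1_spec {σ : St} {R : ℕ} (hE : Env s r k d N hv σ)
    (hR : Rel1 k d (Phase1.first n) σ) (hC : Count1 k N (Phase1.first n) σ) (h10 : σ.reg 10 = R) :
    Tri f D progPhase1 (R * (d * (n * 30 + 50) + 2 ^ d * 9 + n * 110 + 210) + 6) (R * (d + 4)) σ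
      (phase1 f D hv d k N R) fun ρ τ => Rel1 k d ρ τ ∧ Count1 k N ρ τ := by
  refine Tri.mono (tri_for (Tb := 1 + (d * (n * 30 + 50) + 2 ^ d * 9 + n * 110 + 200) + 1)
    (qb := fun _ => 1 + (d + 3)) (M := R)
    (fun _ ρ τ => Rel1 k d ρ τ ∧ Count1 k N ρ τ) (by decide) (by decide) (by decide) (by decide)
    (by decide) h10 ?_ ?_) (by ring_nf; omega) (by simp; ring_nf; omega) fun _ _ _ h => h
  · intro τ _ ha hr
    exact ⟨hR.of_arr (by rw [ha]) (by rw [ha]) (by rw [ha]), ⟨by rw [hr 13 (by decide) (by decide),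
      hC.cnt], by rw [hr 14 (by decide) (by decide), hC.K], hC.card_le, hC.K_le⟩⟩
  · rintro j hj ρ τ hf ⟨hR, hC⟩ - -
    have hEτ := hE.fr hf rfl
    refine Tri.seq (Tri.exQuery 1 τ) ?_
    rintro x τ₁ hf₁ rfl
    refine Det.tri (body1_spec (hEτ.fr hf₁ rfl) (x := x) (by simpa using rep_writeString _ x)
      (hR.of_arr (by simp) (by simp) (by simp)) ⟨hC.cnt, hC.K, hC.card_le, hC.K_le⟩) ?_
    rintro τ₂ - ⟨hR₂, hC₂⟩ τ₃ ha hr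
    exact ⟨hR₂.of_arr (by rw [ha]) (by rw [ha]) (by rw [ha]), ⟨by rw [hr 13 (by decide) (by decide),
      hC₂.cnt], by rw [hr 14 (by decide) (by decide), hC₂.K], hC₂.card_le, hC₂.K_le⟩⟩

end FirstPhase

/-! ### The second phase as a program -/

section RandomStrings

variable {n : ℕ} {f : BoolFn n} {D : PMF (Fin n → Bool)}

/-- Resampling one coordinate keeps the uniform distribution: exchanging the new bit with the old
one is an involution on pairs, under which each string is produced by exactly two pairs. -/
theorem unif_update (j : Fin n) :
    ((PMF.uniformOfFintype Bool).bind fun b =>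
      (unif n).bind fun w => PMF.pure (Function.update w j b)) = unif n := by
  ext v
  have hinv : Function.Involutive fun p : Bool × Str n => (p.2 j, Function.update p.2 j p.1) := by
    intro p; simp
  have key : ∑ p : Bool × Str n, (if v = Function.update p.2 j p.1 then (1 : ENNReal) else 0) = 2 := by
    rw [← Equiv.sum_comp (hinv.toPerm _)]
    have : ∀ p : Bool × Str n, Function.update (hinv.toPerm _ p).2 j (hinv.toPerm _ p).1 = p.2 :=
      fun p => congrArg Prod.snd (hinv p)
    simp only [this, Fintype.sum_prod_type, Finset.sum_ite_eq, Finset.mem_univ, if_true]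
    norm_num
  rw [Fintype.sum_prod_type] at key
  simp only [PMF.bind_apply, tsum_fintype, unif, PMF.uniformOfFintype_apply, PMF.pure_apply]
  simp only [← Finset.mul_sum]
  rw [← mul_assoc, mul_comm, ← mul_assoc]
  trans 2 * (2 : ENNReal)⁻¹ * ((Fintype.card (Str n) : ℕ) : ENNReal)⁻¹
  · congr 2
    convert key
  · rw [ENNReal.mul_inv_cancel (by norm_num) (by norm_num), one_mul]

/-- After `j` coins the first `j` bits are fixed and the rest is still uniform. -/
theorem itr_coin_eq_unif :
    itr (fun j (u : Str n) => (PMF.uniformOfFintype Bool).bind fun b =>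
      PMF.pure fun i => if i.val = j then b else u i) 0 n zs = unif n := by
  have key : ∀ m j (u : Str n), j + m = n →
      itr (fun j (u : Str n) => (PMF.uniformOfFintype Bool).bind fun b =>
        PMF.pure fun i => if i.val = j then b else u i) j m u =
      (unif n).bind fun w => PMF.pure fun i => if i.val < j then u i else w i := by
    intro m
    induction m with
    | zero =>
      intro j u h
      rw [itr]
      have : ∀ w : Str n, (fun i : Fin n => if i.val < j then u i else w i) = u := by
        intro w; ext i; rw [if_pos (by have := i.2; omega)]
      simp only [this, PMF.bind_const]
    | succ m ih =>
      intro j u h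
      rw [itr, PMF.bind_bind]
      simp only [PMF.pure_bind]
      conv_rhs => rw [← unif_update ⟨j, by omega⟩]
      rw [PMF.bind_bind]
      congr 1; ext b : 1
      rw [ih (j + 1) _ (by omega), PMF.bind_bind]
      simp only [PMF.pure_bind]
      congr 1; ext w : 1
      congr 1; ext i
      rcases lt_trichotomy i.val j with h' | h' | h'
      · rw [if_pos (by omega), if_neg (by omega), if_pos h']
      · rw [if_pos (by omega), if_pos h', if_neg (by omega), show i = ⟨j, by omega⟩ from Fin.ext h']
        simp
      · rw [if_neg (by omega), if_neg (by omega), Function.update_of_ne]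
        rintro rfl; simp at h'
  rw [key n 0 zs (by omega)]
  simp only [Nat.not_lt_zero, if_false]
  exact PMF.bind_pure _

/-- Fill the first cells of an array with random bits. -/
def randStr (A : ℕ) : Prog := forUp 20 21 0 (.coin 22 ;; .store A 20 22)

theorem randStr_spec (A : ℕ) {σ : St} (h0 : σ.reg 0 = n) :
    Tri f D (randStr A) (n * 11 + 6) 0 σ (unif n) fun u τ => Rep (τ.arr A) u := by
  rw [← itr_coin_eq_unif]
  refine Tri.mono (tri_for (Tb := 3) (qb := fun _ => 0) (M := n)
    (fun j (u : Str n) τ => ∀ i : Fin n, i.val < j → τ.arr A i = (u i).toNat) (by decide) (by decide)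
    (by decide) (by simp [wr]) (by simp [wr]) h0 ?_ ?_) le_rfl (by simp) fun u τ _ h i => h i i.2
  · intro τ _ _ _ i hi; omega
  · intro j hj u τ _ hu h20 _
    refine Tri.seq (T' := 1) (q' := 0) (Tri.coin 22 τ) ?_
    rintro b _ - rfl
    refine Det.tri (det_ev _ _ (fun τ' => τ'.arr A = Function.update (τ.arr A) j b.toNat) rfl
      (by simp [ev, h20])) ?_
    intro τ' _ h' τ'' ha _ i hi
    rw [ha, h', Function.update_apply]
    split_ifs with hij
    · simp [hij]
    · simpa [hij] using hu i (by omega)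

def xorFill (A B C : ℕ) : Prog :=
  forUp 20 21 0 (.load 22 A 20 ;; .load 23 B 20 ;; xr 24 22 23 ;; .store C 20 24)

theorem xorFill_spec {A B C : ℕ} {σ : St} {x y : Str n} (h0 : σ.reg 0 = n) (hx : Rep (σ.arr A) x)
    (hy : Rep (σ.arr B) y) (hA : A ≠ C) (hB : B ≠ C) :
    Det f D (xorFill A B C) (n * 20 + 6) 0 σ fun τ => Rep (τ.arr C) (bx x y) := by
  refine Det.mono (det_fill (A := C) (Tb := 12) 0 (fun i => if h : i < n then
    (bx x y ⟨i, h⟩).toNat else 0) (by decide) (by decide) (by decide)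
    (by simp [xr, wr]) (by simp [xr, wr]) rfl h0 ?_) (by omega) le_rfl ?_
  · intro i hi τ hf h20 _
    have h1 : τ.arr A i = (x ⟨i, hi⟩).toNat := by
      rw [hf.arr A (by simp [forUp, wa, xr, hA])]; exact hx ⟨i, hi⟩
    have h2 : τ.arr B i = (y ⟨i, hi⟩).toNat := by
      rw [hf.arr B (by simp [forUp, wa, xr, hB])]; exact hy ⟨i, hi⟩
    rw [dif_pos hi, zero_add]
    cases hx' : x ⟨i, hi⟩ <;> cases hy' : y ⟨i, hi⟩ <;> simp [ev, xr, h20, h1, h2, hx', hy', bx]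
  · rintro τ - ⟨h1, -⟩ i
    have := h1 i i.2
    rw [dif_pos i.2, zero_add] at this
    exact this

def andFill (A B C : ℕ) : Prog :=
  forUp 20 21 0 (.load 22 A 20 ;; .load 23 B 20 ;; .ite 22 .skip (.const 23 0) ;; .store C 20 23)

theorem andFill_spec {A B C : ℕ} {σ : St} {x y : Str n} (h0 : σ.reg 0 = n) (hx : Rep (σ.arr A) x)
    (hy : Rep (σ.arr B) y) (hA : A ≠ C) (hB : B ≠ C) :
    Det f D (andFill A B C) (n * 20 + 6) 0 σ fun τ => Rep (τ.arr C) (ba x y) := by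
  refine Det.mono (det_fill (A := C) (Tb := 12) 0 (fun i => if h : i < n then
    (ba x y ⟨i, h⟩).toNat else 0) (by decide) (by decide) (by decide)
    (by simp [wr]) (by simp [wr]) rfl h0 ?_) (by omega) le_rfl ?_
  · intro i hi τ hf h20 _
    have h1 : τ.arr A i = (x ⟨i, hi⟩).toNat := by
      rw [hf.arr A (by simp [forUp, wa, hA])]; exact hx ⟨i, hi⟩
    have h2 : τ.arr B i = (y ⟨i, hi⟩).toNat := by
      rw [hf.arr B (by simp [forUp, wa, hB])]; exact hy ⟨i, hi⟩
    rw [dif_pos hi, zero_add]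
    cases hx' : x ⟨i, hi⟩ <;> cases hy' : y ⟨i, hi⟩ <;> simp [ev, h20, h1, h2, hx', hy', ba]
  · rintro τ - ⟨h1, -⟩ i
    have := h1 i i.2
    rw [dif_pos i.2, zero_add] at this
    exact this

end RandomStrings

/-! ### Evaluating and testing the tentative literals. -/

section Literals

variable {n : ℕ} {s r k d N : ℕ} {hv : Fin n → ℕ} {f : BoolFn n} {D : PMF (Fin n → Bool)}

/-- Evaluate the literal of the block in register `50` at the string in array `A`. -/
def evalLit (A y : ℕ) : Prog :=
  forUp 20 21 0 (.load 22 5 20 ;; .sub 23 22 50 ;; .sub 24 50 22 ;; .add 23 23 24 ;;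
    .add 24 51 20 ;; .load 24 8 24 ;; .ite 23 .skip (.load 24 A 20) ;; .store 0 20 24) ;;
    (.memQuery 26 0 ;; mv y 26)

theorem evalLit_spec {A y b : ℕ} {σ : St} {w : Str n} {ρ : Phase1 n} (hE : Env s r k d N hv σ)
    (hR : Rel1 k d ρ σ) (hw : Rep (σ.arr A) w) (hA : A ≠ 0) (hy : 26 < y) (h50 : σ.reg 50 = b)
    (h51 : σ.reg 51 = b * n) (hb : b < 2 ^ d) :
    Det f D (evalLit A y) (n * 30 + 15) 1 σ fun τ => τ.reg y = (lit f hv ρ.base b w).toNat := by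
  refine Det.mono (Det.seq (T' := 5) (q' := 1) (det_fill (A := 0) (Tb := 20) 0
    (fun i => if h : i < n then
    (mix hv (fun c => c == b) w (ρ.base b) ⟨i, h⟩).toNat else 0) (by decide) (by decide) (by decide)
    (by simp [wr]) (by simp [wr]) rfl hE.n_eq ?_) ?_) (T := n * (20 + 8) + 6 + 5 + 1) (by omega)
    (q := 0 + 1) le_rfl fun _ _ h => h
  · intro i hi τ hf h20 _
    have h5 : τ.arr 5 i = hv ⟨i, hi⟩ := by
      rw [hf.arr 5 (by simp [forUp, wa])]; exact hE.hash ⟨i, hi⟩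
    have h8 : τ.arr 8 (b * n + i) = (ρ.base b ⟨i, hi⟩).toNat := by
      rw [hf.arr 8 (by simp [forUp, wa])]; exact hR.base b hb ⟨i, hi⟩
    have h1 : τ.arr A i = (w ⟨i, hi⟩).toNat := by
      rw [hf.arr A (by simp [forUp, wa, hA])]; exact hw ⟨i, hi⟩
    have h50 : τ.reg 50 = b := by rw [hf.reg 50 (by simp [forUp, wr]), h50]
    have h51 : τ.reg 51 = b * n := by rw [hf.reg 51 (by simp [forUp, wr]), h51]
    rw [dif_pos hi, zero_add]
    simp only [ev, St.set_reg, St.set_arr, h20, h5, h50, h51]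
    by_cases c : hv ⟨i, hi⟩ = b
    · simp [mix, c, h20, h1]
    · have : ¬(hv ⟨i, hi⟩ - b = 0 ∧ b - hv ⟨i, hi⟩ = 0) := by omega
      simp [mix, c, h20, h8, this]
  · rintro τ hf ⟨h1, -⟩
    have hR : Rep (τ.arr 0) (mix hv (fun c => c == b) w (ρ.base b)) := fun i => by
      have := h1 i i.2
      rw [dif_pos i.2, zero_add] at this
      exact this
    refine det_ev _ _ _ rfl ?_
    have : 26 ≠ y := by omega
    simp [ev, mv, hR.read, lit, this]

def evalLits : List (ℕ × ℕ) → Prog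
  | [] => .skip
  | p :: l => evalLit p.1 p.2 ;; evalLits l

theorem mem_wr_evalLits {x : ℕ} (hx : 51 < x) {l : List (ℕ × ℕ)} (h : x ∈ wr (evalLits l)) :
    x ∈ l.map Prod.snd := by
  induction l with
  | nil => simp [evalLits, wr] at h
  | cons p l ih =>
    rw [evalLits, wr, List.mem_append] at h
    rw [List.map_cons, List.mem_cons]
    refine h.imp (fun h => ?_) ih
    simp [evalLit, mv, forUp, wr] at h
    omega

theorem evalLits_spec {b : ℕ} {ρ : Phase1 n} (str : ℕ → Str n) (hb : b < 2 ^ d)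
    (l : List (ℕ × ℕ)) {σ : St} (hE : Env s r k d N hv σ)
    (hR : Rel1 k d ρ σ) (hl : ∀ p ∈ l, p.1 ≠ 0 ∧ 51 < p.2 ∧ Rep (σ.arr p.1) (str p.1))
    (hd : (l.map Prod.snd).Nodup) (h50 : σ.reg 50 = b) (h51 : σ.reg 51 = b * n) :
    Det f D (evalLits l) (l.length * (n * 30 + 16) + 1) l.length σ fun τ =>
      ∀ p ∈ l, τ.reg p.2 = (lit f hv ρ.base b (str p.1)).toNat := by
  induction l generalizing σ with
  | nil => exact det_ev _ _ _ (by simp [evalLits, straight, cost, qcost]) (by simp)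
  | cons p l ih =>
    obtain ⟨hp, hl⟩ := List.forall_mem_cons.1 hl
    rw [List.map_cons, List.nodup_cons] at hd
    refine Det.mono (Det.seq (T := n * 30 + 15) (T' := l.length * (n * 30 + 16) + 1) (q := 1)
      (q' := l.length) (evalLit_spec hE hR hp.2.2 hp.1 (by omega) h50 h51 hb) ?_)
      (by rw [List.length_cons]; ring_nf; omega) (by rw [List.length_cons]; omega) fun _ _ h => h
    intro τ hf h
    have har : ∀ a ≠ 0, τ.arr a = σ.arr a := fun a ha =>
      hf.arr a (by simp [evalLit, mv, forUp, wa, ha])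
    refine Det.mono (ih (hE.fr hf ?_) (hR.of_arr (har 6 (by decide)) (har 7 (by decide))
      (har 8 (by decide))) (fun q hq => ?_) hd.2 ?_ ?_) le_rfl le_rfl ?_
    · simp [envSafe, evalLit, forUp, mv, wr, wa]; omega
    · rw [har _ (hl q hq).1]; exact hl q hq
    · rw [hf.reg 50 (by simp [evalLit, mv, forUp, wr]; omega), h50]
    · rw [hf.reg 51 (by simp [evalLit, mv, forUp, wr]; omega), h51]
    · intro τ' hf' h'
      refine List.forall_mem_cons.2 ⟨?_, h'⟩
      rw [hf'.reg p.2 fun hm => hd.1 (mem_wr_evalLits hp.2.1 hm), h]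

theorem ev_xr_seq {x y z : ℕ} {a b : Bool} {P : Prog} {σ : St} (hx : x ≠ 73) (hy : y ≠ 73)
    (hz : z ≠ 73) (ha : σ.reg y = a.toNat) (hb : σ.reg z = b.toNat) :
    ev f (xr x y z ;; P) σ = ev f P ((σ.set 73 (a.toNat - b.toNat)).set x (xor a b).toNat) := by
  rw [ev]
  congr 1
  ext w
  · simp only [xr, ev, St.set_reg, if_neg hy, if_neg hz, ha, hb, if_neg hx.symm, if_true]
    by_cases hwx : w = x
    · simp only [hwx, if_true]; cases a <;> cases b <;> rfl
    · simp [hwx]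
  · rfl

theorem ev_add_seq {x y z : ℕ} {P : Prog} {σ : St} :
    ev f (.add x y z ;; P) σ = ev f P (σ.set x (σ.reg y + σ.reg z)) := rfl

/-- Put the conjunction of two bits into the first register. -/
def andBit (x y : ℕ) : Prog := .add x x y ;; .const y 1 ;; .sub x x y

theorem ev_andBit_seq {x y : ℕ} {a b : Bool} {P : Prog} {σ : St} (hxy : x ≠ y)
    (ha : σ.reg x = a.toNat) (hb : σ.reg y = b.toNat) :
    ev f (andBit x y ;; P) σ = ev f P ((σ.set y 1).set x (a && b).toNat) := by
  rw [ev]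
  congr 1
  ext w
  · simp only [andBit, ev, St.set_reg, ha, hb, if_neg hxy, if_true]
    by_cases hwx : w = x
    · simp only [hwx, if_true]; cases a <;> cases b <;> rfl
    · simp [hwx]
  · rfl

/-- Count the failed tests. -/
def judge (mono : Bool) : Prog :=
  (if mono then .add 12 12 55 else .skip) ;;
  xr 70 56 57 ;; xr 70 70 58 ;; xr 70 70 55 ;; .add 12 12 70 ;;
  xr 70 60 59 ;; xr 71 56 55 ;; xr 72 57 55 ;; andBit 72 71 ;;
  xr 70 70 72 ;;  .add 12 12 70 ;; xr 70 61 59 ;; xr 70 70 55 ;; xr 70 70 54 ;; .add 12 12 70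

/-- Register 12 adds up the outcomes of the four tests, so it ends nonzero exactly if it was nonzero
or one of them failed. The program is unfolded one operation at a time to keep the state expression
small. -/
theorem ev_judge (mono : Bool) {h : Str n → Bool} {x u v z : Str n} {σ : St}
    (h54 : σ.reg 54 = (h x).toNat) (h55 : σ.reg 55 = (h zs).toNat) (h56 : σ.reg 56 = (h u).toNat)
    (h57 : σ.reg 57 = (h v).toNat) (h58 : σ.reg 58 = (h (bx u v)).toNat)
    (h59 : σ.reg 59 = (h z).toNat) (h60 : σ.reg 60 = (h (bx (ba u v) z)).toNat)
    (h61 : σ.reg 61 = (h (bx x z)).toNat) :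
    (ev f (judge mono) σ).reg 12 ≠ 0 ↔ σ.reg 12 ≠ 0 ∨ litOK mono h x u v z = false := by
  have key : ∀ (m : ℕ) (a b c e : Bool), m + a.toNat + b.toNat + c.toNat + e.toNat ≠ 0 ↔
      m ≠ 0 ∨ (!a && (!b && (!c && !e))) = false := by
    intro m a b c e
    cases a <;> cases b <;> cases c <;> cases e <;> simp
  obtain ⟨σ₁, h1, h2, h3⟩ : ∃ σ₁ : St, ev f (if mono then .add 12 12 55 else .skip) σ = σ₁ ∧
      σ₁.reg 12 = σ.reg 12 + (mono && h zs).toNat ∧ ∀ x ≠ 12, σ₁.reg x = σ.reg x := by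
    refine ⟨_, rfl, ?_, ?_⟩ <;> cases mono <;> simp [ev, h55]
    intro x hx hx'; exact absurd hx' hx
  rw [judge, ev, h1]
  rw [ev_xr_seq (x := 70) (y := 56) (z := 57) (a := h u)
    (b := h v) (by decide) (by decide) (by decide) (by simp [h3, h56]) (by simp [h3, h57])]
  rw [ev_xr_seq (x := 70) (y := 70) (z := 58) (a := xor (h u) (h v))
    (b := h (bx u v)) (by decide) (by decide) (by decide) (by simp) (by simp [h3, h58])]
  rw [ev_xr_seq (x := 70) (y := 70) (z := 55) (a := xor (xor (h u) (h v)) (h (bx u v)))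
    (b := h zs) (by decide) (by decide) (by decide) (by simp) (by simp [h3, h55])]
  rw [ev_add_seq]
  rw [ev_xr_seq (x := 70) (y := 60) (z := 59) (a := h (bx (ba u v) z))
    (b := h z) (by decide) (by decide) (by decide) (by simp [h3, h60]) (by simp [h3, h59])]
  rw [ev_xr_seq (x := 71) (y := 56) (z := 55) (a := h u)
    (b := h zs) (by decide) (by decide) (by decide) (by simp [h3, h56]) (by simp [h3, h55])]
  rw [ev_xr_seq (x := 72) (y := 57) (z := 55) (a := h v)
    (b := h zs) (by decide) (by decide) (by decide) (by simp [h3, h57]) (by simp [h3, h55])]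
  rw [ev_andBit_seq (x := 72) (y := 71) (a := xor (h v) (h zs)) (b := xor (h u) (h zs))
    (by decide) (by simp) (by simp)]
  rw [ev_xr_seq (x := 70) (y := 70) (z := 72) (a := xor (h (bx (ba u v) z)) (h z))
    (b := xor (h v) (h zs) && xor (h u) (h zs)) (by decide) (by decide) (by decide) (by simp) (by simp)]
  rw [ev_add_seq]
  rw [ev_xr_seq (x := 70) (y := 61) (z := 59) (a := h (bx x z))
    (b := h z) (by decide) (by decide) (by decide) (by simp [h3, h61]) (by simp [h3, h59])]
  rw [ev_xr_seq (x := 70) (y := 70) (z := 55) (a := xor (h (bx x z)) (h z))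
    (b := h zs) (by decide) (by decide) (by decide) (by simp) (by simp [h3, h55])]
  rw [ev_xr_seq (x := 70) (y := 70) (z := 54) (a := xor (xor (h (bx x z)) (h z)) (h zs))
    (b := h x) (by decide) (by decide) (by decide) (by simp) (by simp [h3, h54])]
  rw [Bool.and_comm (xor (h v) (h zs))]
  rw [litOK, ← key]
  rw [ev]
  simp only [St.set_reg, h2, Nat.reduceEqDiff, if_true, if_false, Bool.xor_assoc]

end Literals

/-! ### The rounds of the second phase. -/

section SecondPhase

variable {n : ℕ} {s r k d N : ℕ} {hv : Fin n → ℕ} {f : BoolFn n} {D : PMF (Fin n → Bool)}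

/-- The strings at which a literal is tested, with the registers for the values. -/
def points : List (ℕ × ℕ) :=
  [(15, 55), (2, 56), (3, 57), (14, 58), (4, 59), (16, 60), (17, 61), (1, 54)]

structure Strs (x u v z : Str n) (σ : St) : Prop where
  a1 : Rep (σ.arr 1) x
  a2 : Rep (σ.arr 2) u
  a3 : Rep (σ.arr 3) v
  a4 : Rep (σ.arr 4) z
  a14 : Rep (σ.arr 14) (bx u v)
  a16 : Rep (σ.arr 16) (bx (ba u v) z)
  a17 : Rep (σ.arr 17) (bx x z)

def strOf (x u v z : Str n) : ℕ → Str n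
  | 1 => x
  | 2 => u
  | 3 => v
  | 4 => z
  | 14 => bx u v
  | 16 => bx (ba u v) z
  | 17 => bx x z
  | _ => zs

/-- The value at the sample is kept in array 11, so that the hypothesis is evaluated later without
queries. -/
def litBody (mono : Bool) : Prog := evalLits points ;; judge mono ;; .store 11 50 54

theorem litBody_spec (mono : Bool) {b : ℕ} {σ : St} {x u v z : Str n} {ρ : Phase1 n}
    (hE : Env s r k d N hv σ) (hS : Strs x u v z σ) (hR : Rel1 k d ρ σ) (h50 : σ.reg 50 = b)
    (h51 : σ.reg 51 = b * n) (hb : b < 2 ^ d) :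
    Det f D (litBody mono) (n * 240 + 250) 8 σ fun τ =>
      (τ.reg 12 ≠ 0 ↔ σ.reg 12 ≠ 0 ∨ litOK mono (lit f hv ρ.base b) x u v z = false) ∧
        τ.arr 11 = Function.update (σ.arr 11) b (lit f hv ρ.base b x).toNat := by
  refine Det.mono (Det.seq (evalLits_spec (strOf x u v z) hb points hE hR ?_ (by decide) h50 h51)
    (T' := 100) (q' := 0) ?_) (by simp [points]; ring_nf; omega) (by simp [points]) fun _ _ h => h
  · simp only [points, List.forall_mem_cons, strOf]
    refine ⟨⟨by decide, by decide, hE.zero⟩, ⟨by decide, by decide, hS.a2⟩,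
      ⟨by decide, by decide, hS.a3⟩, ⟨by decide, by decide, hS.a14⟩, ⟨by decide, by decide, hS.a4⟩,
      ⟨by decide, by decide, hS.a16⟩, ⟨by decide, by decide, hS.a17⟩,
      ⟨by decide, by decide, hS.a1⟩, by simp⟩
  · intro τ hf h
    simp only [points, List.forall_mem_cons, strOf] at h
    obtain ⟨h55, h56, h57, h58, h59, h60, h61, h54, -⟩ := h
    have r12 : τ.reg 12 = σ.reg 12 := hf.reg 12 (by decide)
    have r50 : τ.reg 50 = b := by rw [hf.reg 50 (by decide), h50]
    have a11 : τ.arr 11 = σ.arr 11 := hf.arr 11 (by decide)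
    refine det_ev _ _ _ (by cases mono <;> rfl) ?_
    have hfr := ev_fr (f := f) (judge mono) τ
    rw [ev, ev]
    refine ⟨?_, ?_⟩
    · rw [St.put_reg, ev_judge mono h54 h55 h56 h57 h58 h59 h60 h61, r12]
    · rw [St.put_arr, if_pos rfl, hfr.reg 50 (by cases mono <;> decide),
        hfr.reg 54 (by cases mono <;> decide), hfr.arr 11 (by cases mono <;> decide), r50, h54, a11]

/-- Test the literals of all blocks. -/
def progLits (mono : Bool) : Prog :=
  .const 51 0 ;; forUp 50 52 8 (.load 53 7 50 ;; .ite 53 (litBody mono) .skip ;; .add 51 51 0)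

theorem Rel1.fr {P : Prog} {ρ : Phase1 n} {σ τ : St} (h : Rel1 k d ρ σ) (hf : Fr P σ τ)
    (h6 : 6 ∉ wa P) (h7 : 7 ∉ wa P) (h8 : 8 ∉ wa P) : Rel1 k d ρ τ :=
  h.of_arr (hf.arr 6 h6) (hf.arr 7 h7) (hf.arr 8 h8)

theorem Strs.fr {P : Prog} {x u v z : Str n} {σ τ : St} (h : Strs x u v z σ) (hf : Fr P σ τ)
    (hP : (wa P).all fun a => !([1, 2, 3, 4, 14, 16, 17].contains a)) : Strs x u v z τ := by
  have ha : ∀ a ∈ [1, 2, 3, 4, 14, 16, 17], τ.arr a = σ.arr a := fun a ha => hf.arr a fun h => by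
    have := List.all_eq_true.1 hP a h
    rw [List.contains_iff_mem.2 ha] at this
    cases this
  constructor
  · rw [ha 1 (by simp)]; exact h.a1
  · rw [ha 2 (by simp)]; exact h.a2
  · rw [ha 3 (by simp)]; exact h.a3
  · rw [ha 4 (by simp)]; exact h.a4
  · rw [ha 14 (by simp)]; exact h.a14
  · rw [ha 16 (by simp)]; exact h.a16
  · rw [ha 17 (by simp)]; exact h.a17

theorem progLits_spec (mono : Bool) {σ : St} {x u v z : Str n} {ρ : Phase1 n}
    (hE : Env s r k d N hv σ) (hS : Strs x u v z σ) (hR : Rel1 k d ρ σ) :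
    Det f D (progLits mono) (2 ^ d * (n * 240 + 270) + 8) (8 * k) σ fun τ =>
      (τ.reg 12 ≠ 0 ↔ σ.reg 12 ≠ 0 ∨ litsOK mono f hv ρ x u v z = false) ∧
        ∀ b ∈ ρ.X, τ.arr 11 b = (lit f hv ρ.base b x).toNat := by
  -- The loop visits all `2 ^ d` blocks, but only the at most `k` blocks of `X` cost queries;
  -- otherwise the number of queries would be quadratic in `k`.
  have hsum : ∑ b ∈ Finset.range (2 ^ d), (if b ∈ ρ.X then 8 else 0) ≤ 8 * k := by
    rw [← Finset.sum_filter, Finset.sum_const, smul_eq_mul, mul_comm]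
    refine Nat.mul_le_mul_left 8 (le_trans (Finset.card_le_card ?_) hR.card_le)
    intro b hb
    exact (Finset.mem_filter.1 hb).2
  refine Det.mono (Det.seq (T := 1) (q := 0) (R := fun τ => τ.reg 51 = 0) (det_ev _ _ _ rfl
    (by simp [ev])) (T' := 2 ^ d * ((n * 240 + 256) + 8) + 6)
    (q' := ∑ b ∈ Finset.range (2 ^ d), (if b ∈ ρ.X then 8 else 0)) ?_) (by ring_nf; omega)
    (by omega) fun _ _ h => h
  intro τ₁ hf₁ h51
  have hE₁ := hE.fr hf₁ rfl
  have hS₁ := hS.fr hf₁ rfl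
  have hR₁ := hR.fr hf₁ (by decide) (by decide) (by decide)
  have r12 : τ₁.reg 12 = σ.reg 12 := hf₁.reg 12 (by decide)
  refine Det.mono (det_for (fun b τ => τ.reg 51 = b * n ∧ (τ.reg 12 ≠ 0 ↔ σ.reg 12 ≠ 0 ∨
    ∃ c < b, c ∈ ρ.X ∧ litOK mono (lit f hv ρ.base c) x u v z = false) ∧
    ∀ c < b, c ∈ ρ.X → τ.arr 11 c = (lit f hv ρ.base c x).toNat) (by decide) (by decide) (by decide)
    (by cases mono <;> decide) (by cases mono <;> decide) hE₁.m_eq ?_ ?_) le_rfl le_rfl ?_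
  · intro τ _ _ hr
    rw [hr 51 (by decide) (by decide), hr 12 (by decide) (by decide), h51, r12]
    simp
  · rintro b hb τ hf ⟨g51, g12, g11⟩ h50 -
    have hEτ := hE₁.fr hf (by cases mono <;> rfl)
    have hSτ := hS₁.fr hf (by cases mono <;> rfl)
    have hRτ := hR₁.fr hf (by cases mono <;> decide) (by cases mono <;> decide)
      (by cases mono <;> decide)
    refine Det.mono (Det.seq (T := 1) (q := 0) (R := fun τ' => τ' = τ.set 53 (τ.arr 7 b))
      (det_ev _ _ _ rfl (by simp [ev, h50])) (T' := (n * 240 + 250 + 1) + 1 + 1)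
      (q' := (if b ∈ ρ.X then 8 else 0) + 0) ?_) (by omega) (by omega) fun _ _ h => h
    rintro τ₂ hf₂ rfl
    have hE₂ := hEτ.fr hf₂ rfl
    have hS₂ := hSτ.fr hf₂ rfl
    have hR₂ := hRτ.fr hf₂ (by decide) (by decide) (by decide)
    have hX : τ.arr 7 b ≠ 0 ↔ b ∈ ρ.X := by simpa [mem] using hRτ.X b hb
    refine Det.seq (T := n * 240 + 250 + 1) (T' := 1) (q := if b ∈ ρ.X then 8 else 0) (q' := 0)
      (R := fun τ' => (τ'.reg 12 ≠ 0 ↔ σ.reg 12 ≠ 0 ∨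
      ∃ c < b + 1, c ∈ ρ.X ∧ litOK mono (lit f hv ρ.base c) x u v z = false) ∧
      (∀ c < b + 1, c ∈ ρ.X → τ'.arr 11 c = (lit f hv ρ.base c x).toNat))
      (Det.ite (fun h => ?_) fun h => ?_) ?_
    · have hb' : b ∈ ρ.X := hX.1 (by simpa using h)
      rw [if_pos hb']
      refine (litBody_spec mono hE₂ hS₂ hR₂ (by simpa using h50) (by simpa using g51) hb).mono
        le_rfl le_rfl ?_
      rintro τ₃ - ⟨h1, h2⟩
      refine ⟨?_, ?_⟩
      · rw [h1, St.set_reg, if_neg (by decide), g12, or_assoc]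
        refine or_congr_right ⟨?_, ?_⟩
        · rintro (⟨c, hc, h'⟩ | h')
          · exact ⟨c, by omega, h'⟩
          · exact ⟨b, by omega, hb', h'⟩
        · rintro ⟨c, hc, h'⟩
          rcases Nat.lt_succ_iff_lt_or_eq.1 hc with hc | rfl
          · exact .inl ⟨c, hc, h'⟩
          · exact .inr h'.2
      · intro c hc hcX
        rw [h2, Function.update_apply, St.set_arr]
        split_ifs with hcb
        · rw [hcb]
        · exact g11 c (by omega) hcX
    · have hb' : b ∉ ρ.X := fun hb' => hX.2 hb' (by simpa using h)
      rw [if_neg hb']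
      refine (det_ev (T := 1) (q := 0) .skip _ _ rfl ?_).mono (by omega) le_rfl fun _ _ h => h
      refine ⟨?_, fun c hc hcX => ?_⟩
      · rw [show ev f .skip (τ.set 53 (τ.arr 7 b)) = τ.set 53 (τ.arr 7 b) from rfl, St.set_reg,
          if_neg (by decide), g12]
        refine or_congr_right ⟨?_, ?_⟩
        · rintro ⟨c, hc, h'⟩
          exact ⟨c, by omega, h'⟩
        · rintro ⟨c, hc, h'⟩
          rcases Nat.lt_succ_iff_lt_or_eq.1 hc with hc | rfl
          · exact ⟨c, hc, h'⟩
          · exact absurd h'.1 hb'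
      · rcases Nat.lt_succ_iff_lt_or_eq.1 hc with hc | rfl
        · exact g11 c hc hcX
        · exact absurd hcX hb'
    · rintro τ₃ hf₃ ⟨h1, h2⟩
      refine det_ev _ _ _ rfl ?_
      intro τ₄ ha hr
      have r51 : τ₃.reg 51 = b * n := by
        rw [hf₃.reg 51 (by cases mono <;> decide), St.set_reg, if_neg (by decide), g51]
      have r0 : τ₃.reg 0 = n := by
        rw [hf₃.reg 0 (by cases mono <;> decide)]; exact hE₂.n_eq
      rw [ha, hr 12 (by decide) (by decide), hr 51 (by decide) (by decide)]
      refine ⟨?_, by simpa [ev] using h1, by simpa [ev] using h2⟩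
      simp [ev, r51, r0, Nat.succ_mul]
  · rintro τ - ⟨-, h1, h2⟩
    refine ⟨h1.trans (or_congr_right ?_), fun b hb => h2 b (hR.X_lt b hb) hb⟩
    simp only [litsOK, decide_eq_false_iff_not, not_forall, Bool.not_eq_true]
    exact ⟨fun ⟨c, _, h, h'⟩ => ⟨c, h, h'⟩, fun ⟨c, h, h'⟩ => ⟨c, hR.X_lt c h, h, h'⟩⟩

/-- The data found in the second phase. -/
structure Rel2 (s d : ℕ) (p : Phase2) (σ : St) : Prop where
  J : σ.reg 15 = p.tms.length
  off : σ.reg 16 = p.tms.length * 2 ^ d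
  rej : σ.reg 12 ≠ 0 ↔ p.rej = true
  tm : ∀ (j : ℕ) (h : j < p.tms.length), ∀ b < 2 ^ d, σ.arr 10 (j * 2 ^ d + b) ≠ 0 ↔ b ∈ p.tms[j]
  le : p.tms.length ≤ s

theorem Rel2.fr {P : Prog} {p : Phase2} {σ τ : St} (h : Rel2 s d p σ) (hf : Fr P σ τ)
    (hr : (wr P).all fun x => !([12, 15, 16].contains x)) (ha : 10 ∉ wa P) : Rel2 s d p τ := by
  have hr : ∀ x ∈ [12, 15, 16], τ.reg x = σ.reg x := fun x hx => hf.reg x fun h => by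
    have := List.all_eq_true.1 hr x h
    rw [List.contains_iff_mem.2 hx] at this
    cases this
  exact ⟨by rw [hr 15 (by simp), h.J], by rw [hr 16 (by simp), h.off], by rw [hr 12 (by simp), h.rej],
    by rw [hf.arr 10 ha]; exact h.tm, h.le⟩

def hypCell : Prog :=
  .add 87 81 85 ;; .load 87 10 87 ;; .ite 87 (.load 87 7 85 ;;
    .ite 87 (.load 87 11 85 ;; .ite 87 .skip (.const 84 0)) .skip) .skip

/-- Evaluate the hypothesis from the values of the literals. -/
def evalHyp : Prog :=
  .const 80 0 ;; .const 81 0 ;; forUp 82 83 15 (.const 84 1 ;; forUp 85 86 8 hypCell ;;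
    (.add 81 81 8 ;; .ite 84 (.const 80 1) .skip))

theorem ev_hypCell {b off : ℕ} {X T : Finset ℕ} {g : ℕ → Bool} {σ : St} (h81 : σ.reg 81 = off)
    (h85 : σ.reg 85 = b) (hT : σ.arr 10 (off + b) ≠ 0 ↔ b ∈ T) (hX : σ.arr 7 b ≠ 0 ↔ b ∈ X)
    (hg : b ∈ X → σ.arr 11 b = (g b).toNat) :
    (ev f hypCell σ).reg 84 ≠ 0 ↔ σ.reg 84 ≠ 0 ∧ (b ∈ T → b ∈ X → g b = true) := by
  by_cases h1 : σ.arr 10 (off + b) = 0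
  · have : b ∉ T := fun h => hT.2 h h1
    simp [hypCell, ev, h81, h85, h1, this]
  · have h1' := hT.1 h1
    by_cases h2 : σ.arr 7 b = 0
    · have : b ∉ X := fun h => hX.2 h h2
      simp [hypCell, ev, h81, h85, h1, h2, this]
    · have h2' := hX.1 h2
      have h3 := hg h2'
      cases h4 : g b
      · simp [hypCell, ev, h81, h85, h1, h2, h1', h2', h3, h4]
      · simp [hypCell, ev, h81, h85, h1, h2, h3, h4]

theorem evalHyp_spec {σ : St} {ρ : Phase1 n} {p : Phase2} (g : ℕ → Bool) (hE : Env s r k d N hv σ)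
    (hR : Rel1 k d ρ σ) (h2 : Rel2 s d p σ) (hg : ∀ b ∈ ρ.X, σ.arr 11 b = (g b).toNat) :
    Det f D evalHyp (s * (2 ^ d * 30 + 30) + 10) 0 σ fun τ =>
      (τ.reg 80 ≠ 0 ↔ ∃ T ∈ p.tms, ∀ b ∈ T, b ∈ ρ.X → g b = true) := by
  have hle := Nat.mul_le_mul_right (2 ^ d * 30 + 30) h2.le
  refine Det.mono (Det.seq (T := 1) (q := 0) (R := fun τ => τ.reg 80 = 0) (det_ev _ _ _ rfl
    (by simp [ev])) (T' := 1 + (p.tms.length * ((1 + ((2 ^ d * (15 + 8) + 6) + 7 + 1) + 1) + 8) + 6) + 1)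
    (q' := 0 + (∑ j ∈ Finset.range p.tms.length, (0 + ((∑ b ∈ Finset.range (2 ^ d), 0) + 0)))) ?_)
    (by ring_nf at hle ⊢; omega) (by simp) fun _ _ h => h
  intro τ₁ hf₁ h80
  refine Det.seq (T := 1) (q := 0) (R := fun τ => τ.reg 80 = 0 ∧ τ.reg 81 = 0) (det_ev _ _ _ rfl
    (by simp [ev, h80])) ?_
  rintro τ₂ hf₂ ⟨h80, h81⟩
  have hE₂ := (hE.fr hf₁ rfl).fr hf₂ rfl
  have hR₂ := (hR.fr hf₁ (by decide) (by decide) (by decide)).fr hf₂ (by decide) (by decide) (by decide)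
  have h2₂ := (h2.fr hf₁ (by decide) (by decide)).fr hf₂ (by decide) (by decide)
  have hg₂ : τ₂.arr 11 = σ.arr 11 := by rw [hf₂.arr 11 (by decide), hf₁.arr 11 (by decide)]
  refine Det.mono (det_for (fun j τ => τ.reg 81 = j * 2 ^ d ∧ (τ.reg 80 ≠ 0 ↔
    ∃ (i : ℕ) (h : i < p.tms.length), i < j ∧ ∀ b ∈ p.tms[i], b ∈ ρ.X → g b = true)) (by decide)
    (by decide) (by decide) (by decide) (by decide) h2₂.J ?_ ?_) le_rfl le_rfl ?_
  · intro τ _ _ hr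
    rw [hr 80 (by decide) (by decide), hr 81 (by decide) (by decide), h80, h81]
    simp
  · rintro j hj τ hf ⟨g81, g80⟩ - -
    refine Det.seq (T := 1) (T' := (2 ^ d * (15 + 8) + 6) + 7 + 1) (q := 0)
      (q' := (∑ b ∈ Finset.range (2 ^ d), 0) + 0) (R := fun τ' => τ'.reg 84 = 1) (det_ev _ _ _ rfl
      (by simp [ev])) ?_
    intro τ₃ hf₃ h84
    have hf' : Fr (forUp 82 83 15 (.const 84 1 ;; forUp 85 86 8 hypCell ;;
      (.add 81 81 8 ;; .ite 84 (.const 80 1) .skip))) τ₂ τ₃ :=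
      hf.trans hf₃ (by decide) (by decide) (by decide) (by decide)
    have hE₃ := hE₂.fr hf' rfl
    have hR₃ := hR₂.fr hf' (by decide) (by decide) (by decide)
    have h2₃ := h2₂.fr hf' (by decide) (by decide)
    have hg₃ : τ₃.arr 11 = σ.arr 11 := by rw [hf'.arr 11 (by decide), hg₂]
    have r81 : τ₃.reg 81 = j * 2 ^ d := by rw [hf₃.reg 81 (by decide), g81]
    have r80 : τ₃.reg 80 = τ.reg 80 := hf₃.reg 80 (by decide)
    refine Det.seq (T := 2 ^ d * (15 + 8) + 6) (T' := 7) (q := ∑ b ∈ Finset.range (2 ^ d), 0)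
      (q' := 0) (R := fun τ' => τ'.reg 84 ≠ 0 ↔ ∀ b < 2 ^ d, b ∈ p.tms[j] → b ∈ ρ.X → g b = true)
      (det_for (Tb := 15) (qb := fun _ => 0) (fun c τ' => τ'.reg 84 ≠ 0 ↔
        ∀ b < c, b ∈ p.tms[j] → b ∈ ρ.X → g b = true)
      (by decide) (by decide) (by decide) (by decide) (by decide) hE₃.m_eq ?_ ?_) ?_
    · intro τ' _ _ hr
      rw [hr 84 (by decide) (by decide), h84]
      simp
    · intro c hc τ' hf'' h84' h85 _
      refine det_ev _ _ _ rfl ?_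
      intro τ'' _ hr
      rw [hr 84 (by decide) (by decide), ev_hypCell (g := g) (T := p.tms[j]) (X := ρ.X)
        (off := j * 2 ^ d) (by rw [hf''.reg 81 (by decide), r81]) h85
        (by rw [hf''.arr 10 (by decide)]; exact h2₃.tm j hj c hc)
        (by rw [hf''.arr 7 (by decide)]; simpa [mem] using hR₃.X c hc)
        (fun h => by rw [hf''.arr 11 (by decide), hg₃, hg c h]), h84', Nat.forall_lt_succ_right]
    · intro τ₄ hf₄ h84
      have r81 : τ₄.reg 81 = j * 2 ^ d := by rw [hf₄.reg 81 (by decide), r81]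
      have r80 : τ₄.reg 80 = τ.reg 80 := by rw [hf₄.reg 80 (by decide), r80]
      have r8 : τ₄.reg 8 = 2 ^ d := by rw [hf₄.reg 8 (by decide), hE₃.m_eq]
      refine det_ev _ _ _ rfl ?_
      intro τ₅ _ hr
      rw [hr 81 (by decide) (by decide), hr 80 (by decide) (by decide)]
      have key : (∃ (i : ℕ) (h : i < p.tms.length), i < j + 1 ∧
          ∀ b ∈ p.tms[i], b ∈ ρ.X → g b = true) ↔ τ.reg 80 ≠ 0 ∨ τ₄.reg 84 ≠ 0 := by
        rw [g80, h84]
        constructor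
        · rintro ⟨i, hi, hij, h⟩
          rcases Nat.lt_succ_iff_lt_or_eq.1 hij with hij | rfl
          · exact .inl ⟨i, hi, hij, h⟩
          · exact .inr fun b _ => h b
        · rintro (⟨i, hi, hij, h⟩ | h)
          · exact ⟨i, hi, by omega, h⟩
          · exact ⟨j, hj, by omega, fun b hb hbX => h b (hR.X_lt b hbX) hb hbX⟩
      rw [key]
      by_cases h : τ₄.reg 84 = 0
      · simp [ev, r81, r8, h, r80, Nat.succ_mul]
      · simp [ev, r81, r8, h, Nat.succ_mul]
  · rintro τ - ⟨-, h⟩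
    rw [h]
    constructor
    · rintro ⟨i, hi, -, h⟩
      exact ⟨_, List.getElem_mem hi, h⟩
    · rintro ⟨T, hT, h⟩
      obtain ⟨i, hi, rfl⟩ := List.getElem_of_mem hT
      exact ⟨i, hi, hi, h⟩

/-- Run the greedy search for a term. -/
def progGreedy : Prog :=
  forUp 94 95 8 (.const 96 0 ;; .store 9 94 96) ;;
    forUp 94 95 2 (search 9 7 ;; .ite 29 .skip (.const 96 1 ;; .store 9 28 96))

theorem progGreedy_spec {σ : St} {x : Str n} {ρ : Phase1 n} (hE : Env s r k d N hv σ)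
    (hx : Rep (σ.arr 1) x) (hR : Rel1 k d ρ σ) :
    Det f D progGreedy (2 ^ d * 12 + r * (d * (n * 30 + 50) + n * 30 + 60) + 20) (r * (d + 1)) σ
      fun τ => Flag d (τ.arr 9) (mem (greedy f hv ρ.X d x ρ.a r)) := by
  refine Det.mono (Det.seq (T := 2 ^ d * (3 + 8) + 6) (q := 0)
    (R := fun τ => Flag d (τ.arr 9) (mem ∅)) (Det.mono (det_fill (A := 9) 0 (fun _ => 0) (by decide)
    (by decide) (by decide) (by decide) (by decide) rfl hE.m_eq ?_) le_rfl le_rfl ?_)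
    (T' := r * (((d * (n * 30 + 50) + n * 30 + 40) + 6 + 1) + 8) + 6)
    (q' := ∑ j ∈ Finset.range r, ((d + 1) + 0)) ?_) (by ring_nf; omega) (by simp) fun _ _ h => h
  · intro b _ τ _ h94 _
    simp [ev, h94]
  · rintro τ - ⟨h, -⟩ b hb
    rw [← zero_add b, h b hb]; simp [mem]
  intro τ₁ hf₁ h0
  have hE₁ := hE.fr hf₁ rfl
  have hR₁ := hR.fr hf₁ (by decide) (by decide) (by decide)
  have a1 : τ₁.arr 1 = σ.arr 1 := hf₁.arr 1 (by decide)
  refine det_for (fun j τ => Flag d (τ.arr 9) (mem (greedy f hv ρ.X d x ρ.a j))) (by decide)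
    (by decide) (by decide) (by decide) (by decide) hE₁.r_eq ?_ ?_
  · intro τ _ ha _
    rw [ha]; exact h0
  · intro j _ τ hf hF _ _
    have hEτ := hE₁.fr hf rfl
    have hRτ := hR₁.fr hf (by decide) (by decide) (by decide)
    refine Det.seq (T := d * (n * 30 + 50) + n * 30 + 40) (T' := 6) (q := d + 1) (q' := 0)
      (search_spec hEτ (by rw [hf.arr 1 (by decide), a1]; exact hx) hRτ.a hF hRτ.X
      (by decide) (by decide)) ?_
    rintro τ₂ hf₂ ⟨h28, h29⟩
    have hF₂ : Flag d (τ₂.arr 9) (mem (greedy f hv ρ.X d x ρ.a j)) := by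
      rw [hf₂.arr 9 (by decide)]; exact hF
    refine det_ev _ _ _ rfl ?_
    intro τ₃ ha _
    rw [ha, greedy]
    cases hv0 : vl f hv (mem (greedy f hv ρ.X d x ρ.a j)) (mem ρ.X) x ρ.a 0
    · rw [hv0] at h29
      intro b hb
      simp only [ev, h29, St.set_arr, St.set_reg]
      by_cases hbp : b = srch (vl f hv (mem (greedy f hv ρ.X d x ρ.a j)) (mem ρ.X) x ρ.a) d
      · simp [h28, hbp, mem]
      · simpa [h28, hbp, mem] using hF₂ b hb
    · rw [hv0] at h29
      simpa [ev, h29] using hF₂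

/-- Append the term found by the greedy search to the hypothesis. -/
def addTerm : Prog :=
  progGreedy ;; .const 27 0 ;; ask 9 7 ;; .ite 26 .skip (.const 12 1) ;;
    forUp 92 93 8 (.load 96 9 92 ;; .add 97 16 92 ;; .store 10 97 96) ;;
    (.add 16 16 8 ;; .const 96 1 ;; .add 15 15 96)

theorem addTerm_spec {σ : St} {x : Str n} {ρ : Phase1 n} {p : Phase2} (hE : Env s r k d N hv σ)
    (hx : Rep (σ.arr 1) x) (hR : Rel1 k d ρ σ) (h2 : Rel2 s d p σ) (hlt : p.tms.length < s) :
    Det f D addTerm (2 ^ d * 30 + r * (d * (n * 30 + 50) + n * 30 + 60) + n * 30 + 80)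
      (r * (d + 1) + 1) σ
      fun τ => Rel2 s d ⟨p.tms ++ [greedy f hv ρ.X d x ρ.a r], p.rej ||
        !vl f hv (mem (greedy f hv ρ.X d x ρ.a r)) (mem ρ.X) x ρ.a 0⟩ τ := by
  set G := greedy f hv ρ.X d x ρ.a r with hG
  refine Det.mono (Det.seq (progGreedy_spec hE hx hR) (T' := 1 + ((n * 30 + 10) +
    (3 + ((2 ^ d * (5 + 8) + 6) + 5 + 1) + 1) + 1) + 1) (q' := 0 + (1 + (0 + (0 + 0)))) ?_)
    (by omega) (by omega) fun _ _ h => h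
  intro τ₁ hf₁ h9
  refine Det.seq (T := 1) (q := 0) (R := fun τ => τ.reg 27 = 0) (det_ev _ _ _ rfl (by simp [ev])) ?_
  intro τ₂ hf₂ h27
  have hE₂ := (hE.fr hf₁ rfl).fr hf₂ rfl
  have hR₂ := (hR.fr hf₁ (by decide) (by decide) (by decide)).fr hf₂ (by decide) (by decide) (by decide)
  have h2₂ := (h2.fr hf₁ (by decide) (by decide)).fr hf₂ (by decide) (by decide)
  have hx₂ : Rep (τ₂.arr 1) x := by rw [hf₂.arr 1 (by decide), hf₁.arr 1 (by decide)]; exact hx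
  have h9₂ : Flag d (τ₂.arr 9) (mem G) := by rw [hf₂.arr 9 (by decide)]; exact h9
  refine Det.seq (T := n * 30 + 10) (T' := 3 + ((2 ^ d * (5 + 8) + 6) + 5 + 1) + 1) (q := 1)
    (q' := 0 + (0 + 0)) (ask_spec hE₂ hx₂ hR₂.a h9₂ hR₂.X (by decide) (by decide) h27) ?_
  rintro τ₃ hf₃ ⟨h26, -⟩
  have hE₃ := hE₂.fr hf₃ rfl
  have h2₃ := h2₂.fr hf₃ (by decide) (by decide)
  have h9₃ : Flag d (τ₃.arr 9) (mem G) := by rw [hf₃.arr 9 (by decide)]; exact h9₂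
  refine Det.seq (T := 3) (T' := (2 ^ d * (5 + 8) + 6) + 5 + 1) (q := 0) (q' := 0 + 0)
    (R := fun τ => τ.reg 12 ≠ 0 ↔
    (p.rej || !vl f hv (mem G) (mem ρ.X) x ρ.a 0) = true) (det_ev _ _ _ rfl ?_) ?_
  · have := h2₃.rej
    cases hv0 : vl f hv (mem G) (mem ρ.X) x ρ.a 0 <;> rw [hv0] at h26 <;> simp [ev, h26]
    simpa using this
  intro τ₄ hf₄ h12
  have hE₄ := hE₃.fr hf₄ rfl
  have h15 : τ₄.reg 15 = p.tms.length := by rw [hf₄.reg 15 (by decide), h2₃.J]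
  have h16 : τ₄.reg 16 = p.tms.length * 2 ^ d := by rw [hf₄.reg 16 (by decide), h2₃.off]
  have h9₄ : Flag d (τ₄.arr 9) (mem G) := by rw [hf₄.arr 9 (by decide)]; exact h9₃
  have htm : τ₄.arr 10 = τ₃.arr 10 := hf₄.arr 10 (by decide)
  refine Det.seq (T := 2 ^ d * (5 + 8) + 6) (T' := 5) (q := 0) (q' := 0)
    (det_fill (A := 10) (p.tms.length * 2 ^ d) (fun b => τ₄.arr 9 b) (by decide)
    (by decide) (by decide) (by decide) (by decide) rfl hE₄.m_eq ?_) ?_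
  · intro b _ τ hf h92 _
    have r16 : τ.reg 16 = p.tms.length * 2 ^ d := by rw [hf.reg 16 (by decide), h16]
    have a9 : τ.arr 9 = τ₄.arr 9 := hf.arr 9 (by decide)
    simp [ev, h92, r16, a9]
  · rintro τ₅ hf₅ ⟨h10, h10'⟩
    refine det_ev _ _ _ rfl ?_
    have r12 : τ₅.reg 12 = τ₄.reg 12 := hf₅.reg 12 (by decide)
    have r15 : τ₅.reg 15 = p.tms.length := by rw [hf₅.reg 15 (by decide), h15]
    have r16 : τ₅.reg 16 = p.tms.length * 2 ^ d := by rw [hf₅.reg 16 (by decide), h16]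
    have r8 : τ₅.reg 8 = 2 ^ d := by rw [hf₅.reg 8 (by decide), hE₄.m_eq]
    refine ⟨?_, ?_, ?_, ?_, ?_⟩
    · simp [ev, r15]
    · simp [ev, r16, r8, Nat.succ_mul]
    · simpa [ev, r12] using h12
    · intro j hj b hb
      rw [List.length_append, List.length_singleton] at hj
      simp only [ev, St.set_arr]
      rcases Nat.lt_succ_iff_lt_or_eq.1 hj with hj' | rfl
      · rw [List.getElem_append_left hj', h10' _ (.inl ?_), htm]
        · exact h2₃.tm j hj' b hb
        -- The cells of earlier terms end before the offset of the new one.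
        · calc j * 2 ^ d + b < (j + 1) * 2 ^ d := by rw [Nat.succ_mul]; omega
            _ ≤ _ := Nat.mul_le_mul_right _ hj'
      · rw [h10 b hb]
        simpa [mem] using h9₄ b hb
    · simpa using hlt

/-- Compare the hypothesis with the value of the function. -/
def compare : Prog :=
  .const 27 0 ;; ask 7 7 ;; mv 89 26 ;; evalHyp ;;
    .ite 89 (.ite 80 .skip (.sub 90 1 15 ;; .ite 90 addTerm (.const 12 1))) (.add 12 12 80)

theorem compare_spec {mono : Bool} {σ : St} {x u v z : Str n} {ρ : Phase1 n} {p : Phase2}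
    (hE : Env s r k d N hv σ) (hx : Rep (σ.arr 1) x) (hR : Rel1 k d ρ σ)
    (h2 : Rel2 s d ⟨p.tms, p.rej || !litsOK mono f hv ρ x u v z⟩ σ)
    (hg : ∀ b ∈ ρ.X, σ.arr 11 b = (lit f hv ρ.base b x).toNat) :
    Det f D compare (s * (2 ^ d * 30 + 30) + 2 ^ d * 30 + r * (d * (n * 30 + 50) + n * 30 + 60) +
      n * 60 + 150) (r * (d + 1) + 2) σ fun τ => Rel2 s d (step2 mono f hv d s r ρ x u v z p) τ := by
  set A := 2 ^ d * 30 + r * (d * (n * 30 + 50) + n * 30 + 60) + n * 30 + 80 with hA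
  set B := s * (2 ^ d * 30 + 30) + 10 with hB
  refine Det.mono (Det.seq (T := 1) (q := 0) (R := fun τ => τ.reg 27 = 0) (det_ev _ _ _ rfl
    (by simp [ev])) (T' := (n * 30 + 10) + (3 + (B + ((1 + (A + 1) + 1) + 1 + 1) + 1) + 1) + 1)
    (q' := 1 + (0 + (0 + (0 + (r * (d + 1) + 1))))) ?_) (by omega) (by omega) fun _ _ h => h
  intro τ₁ hf₁ h27
  have hE₁ := hE.fr hf₁ rfl
  have hR₁ := hR.fr hf₁ (by decide) (by decide) (by decide)
  have h2₁ := h2.fr hf₁ (by decide) (by decide)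
  have hx₁ : Rep (τ₁.arr 1) x := by rw [hf₁.arr 1 (by decide)]; exact hx
  refine Det.seq (T := n * 30 + 10) (T' := 3 + (B + ((1 + (A + 1) + 1) + 1 + 1) + 1) + 1) (q := 1)
    (q' := 0 + (0 + (0 + (r * (d + 1) + 1))))
    (ask_spec hE₁ hx₁ hR₁.a hR₁.X hR₁.X (by decide) (by decide) h27) ?_
  rintro τ₂ hf₂ ⟨h26, -⟩
  have hE₂ := hE₁.fr hf₂ rfl
  have hR₂ := hR₁.fr hf₂ (by decide) (by decide) (by decide)
  have h2₂ := h2₁.fr hf₂ (by decide) (by decide)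
  have hx₂ : Rep (τ₂.arr 1) x := by rw [hf₂.arr 1 (by decide)]; exact hx₁
  refine Det.seq (T := 3) (T' := B + ((1 + (A + 1) + 1) + 1 + 1) + 1) (q := 0)
    (q' := 0 + (0 + (r * (d + 1) + 1))) (mv_spec 89 26 (by decide) τ₂) ?_
  rintro τ₃ hf₃ ⟨h89, -⟩
  have hE₃ := hE₂.fr hf₃ rfl
  have hR₃ := hR₂.fr hf₃ (by decide) (by decide) (by decide)
  have h2₃ := h2₂.fr hf₃ (by decide) (by decide)
  have hx₃ : Rep (τ₃.arr 1) x := by rw [hf₃.arr 1 (by decide)]; exact hx₂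
  have hg₃ : τ₃.arr 11 = σ.arr 11 := by
    rw [hf₃.arr 11 (by decide), hf₂.arr 11 (by decide), hf₁.arr 11 (by decide)]
  -- With bound zero the second set is irrelevant, so `ask 7 7` freezes everything outside `X`.
  have hfn : vl f hv (mem ρ.X) (mem ρ.X) x ρ.a 0 = ρ.fn f hv x := by
    rw [vl, mask_zero, Phase1.fn]
  rw [h26, hfn] at h89
  refine Det.seq (T := B) (T' := (1 + (A + 1) + 1) + 1 + 1) (q := 0) (q' := 0 + (r * (d + 1) + 1))
    (evalHyp_spec (fun b => lit f hv ρ.base b x) hE₃ hR₃ h2₃ (by rw [hg₃]; exact hg)) ?_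
  intro τ₄ hf₄ h80
  have hE₄ := hE₃.fr hf₄ rfl
  have hR₄ := hR₃.fr hf₄ (by decide) (by decide) (by decide)
  have h2₄ := h2₃.fr hf₄ (by decide) (by decide)
  have hx₄ : Rep (τ₄.arr 1) x := by rw [hf₄.arr 1 (by decide)]; exact hx₃
  have h89 : τ₄.reg 89 = (ρ.fn f hv x).toNat := by rw [hf₄.reg 89 (by decide), h89]
  have h80 : τ₄.reg 80 ≠ 0 ↔ hyp f hv ρ p.tms x = true := by
    rw [h80, hyp, decide_eq_true_eq]
  refine Det.ite (T := (1 + (A + 1) + 1) + 1) (fun h => ?_) fun h => ?_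
  · have hfx : ρ.fn f hv x = true := by
      cases h' : ρ.fn f hv x
      · rw [h89, h'] at h; exact absurd rfl h
      · rfl
    refine Det.ite (T := 1 + (A + 1) + 1) (fun h => ?_) fun h => ?_
    · have hH := h80.1 h
      refine (det_ev (T := 1) (q := 0) .skip _ _ rfl ?_).mono (by omega) (by omega) fun _ _ h => h
      rw [step2, if_neg (by simp [hH])]
      rw [show ev f .skip τ₄ = τ₄ from rfl]
      simpa [hH, hfx] using h2₄
    · have hH : hyp f hv ρ p.tms x = false := by
        rw [← Bool.not_eq_true, ← h80]; simpa using h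
      refine Det.seq (T := 1) (T' := A + 1) (q := 0) (q' := r * (d + 1) + 1)
        (R := fun τ => τ.reg 90 = s - p.tms.length) (det_ev _ _ _ rfl
        (by simp [ev, hE₄.s_eq, h2₄.J])) ?_
      intro τ₅ hf₅ h90
      have hE₅ := hE₄.fr hf₅ rfl
      have hR₅ := hR₄.fr hf₅ (by decide) (by decide) (by decide)
      have h2₅ := h2₄.fr hf₅ (by decide) (by decide)
      rw [step2, if_pos ⟨hfx, hH⟩]
      refine Det.ite (T := A) (fun h => ?_) fun h => ?_
      · have hlt : p.tms.length < s := by omega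
        rw [if_pos hlt]
        exact addTerm_spec hE₅ (by rw [hf₅.arr 1 (by decide)]; exact hx₄) hR₅ h2₅ hlt
      · rw [if_neg (by omega)]
        refine (det_ev (T := 1) (q := 0) _ _ _ rfl ?_).mono (by omega) (by omega) fun _ _ h => h
        exact ⟨by simpa [ev] using h2₅.J, by simpa [ev] using h2₅.off, by simp [ev],
          by simpa [ev] using h2₅.tm, h2₅.le⟩
  · have hfx : ρ.fn f hv x = false := by
      cases h' : ρ.fn f hv x
      · rfl
      · rw [h89, h'] at h; exact absurd h (by decide)
    refine (det_ev (T := 1) (q := 0) _ _ _ rfl ?_).mono (by omega) (by omega) fun _ _ h => h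
    rw [step2, if_neg (by simp [hfx])]
    refine ⟨by simpa [ev] using h2₄.J, by simpa [ev] using h2₄.off, ?_,
      by simpa [ev] using h2₄.tm, h2₄.le⟩
    -- Where the frozen function is false, adding register 80 to the failure count rejects exactly
    -- the false positives.
    have h12 := h2₄.rej
    simp only [ev, St.set_reg, if_true, hfx, Bool.not_false, Bool.and_true]
    rw [Bool.or_eq_true, ← h12, ← h80]
    omega

def body2 (mono : Bool) : Prog :=
  randStr 2 ;; randStr 3 ;; randStr 4 ;; xorFill 2 3 14 ;; andFill 2 3 18 ;; xorFill 18 4 16 ;;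
    xorFill 1 4 17 ;; progLits mono ;; compare

/-- The time for one round of the second phase. -/
def time2 (n s r d : ℕ) : ℕ :=
  2 ^ d * (n * 240 + 270) + s * (2 ^ d * 30 + 30) + 2 ^ d * 30 +
    r * (d * (n * 30 + 50) + n * 30 + 60) + n * 173 + 300

theorem body2_spec (mono : Bool) {σ : St} {x : Str n} {ρ : Phase1 n} {p : Phase2}
    (hE : Env s r k d N hv σ) (hx : Rep (σ.arr 1) x) (hR : Rel1 k d ρ σ) (h2 : Rel2 s d p σ) :
    Tri f D (body2 mono) (time2 n s r d) (8 * k + (r * (d + 1) + 2)) σ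
      ((unif n).bind fun u => (unif n).bind fun v => (unif n).bind fun z =>
        PMF.pure (step2 mono f hv d s r ρ x u v z p)) fun p' τ => Rel2 s d p' τ := by
  set A := n * 11 + 6
  set B := n * 20 + 6
  set C := 2 ^ d * (n * 240 + 270) + 8
  set E := s * (2 ^ d * 30 + 30) + 2 ^ d * 30 + r * (d * (n * 30 + 50) + n * 30 + 60) + n * 60 + 150
    with hE'
  set Q := 8 * k + (r * (d + 1) + 2) with hQ
  refine Tri.mono (Tri.seq (T := A) (T' := A + (A + (B + (B + (B + (B + (C + E + 1) + 1) + 1) + 1) + 1) + 1) + 1)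
    (q := 0) (q' := Q) (randStr_spec 2 hE.n_eq) fun u τ₁ hf₁ hu => ?_) (by rw [time2]; omega)
    (by omega) fun _ _ _ h => h
  have hE₁ := hE.fr hf₁ rfl
  have hR₁ := hR.fr hf₁ (by decide) (by decide) (by decide)
  have h2₁ := h2.fr hf₁ (by decide) (by decide)
  have x₁ : Rep (τ₁.arr 1) x := by rw [hf₁.arr 1 (by decide)]; exact hx
  refine Tri.mono (Tri.seq (T := A) (T' := A + (B + (B + (B + (B + (C + E + 1) + 1) + 1) + 1) + 1) + 1)
    (q := 0) (q' := Q) (randStr_spec 3 hE₁.n_eq) fun v τ₂ hf₂ hv' => ?_) le_rfl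
    (by omega) fun _ _ _ h => h
  have hE₂ := hE₁.fr hf₂ rfl
  have hR₂ := hR₁.fr hf₂ (by decide) (by decide) (by decide)
  have h2₂ := h2₁.fr hf₂ (by decide) (by decide)
  have x₂ : Rep (τ₂.arr 1) x := by rw [hf₂.arr 1 (by decide)]; exact x₁
  have u₂ : Rep (τ₂.arr 2) u := by rw [hf₂.arr 2 (by decide)]; exact hu
  refine Tri.mono (Tri.seq (T := A) (T' := B + (B + (B + (B + (C + E + 1) + 1) + 1) + 1) + 1)
    (q := 0) (q' := Q) (randStr_spec 4 hE₂.n_eq) fun z τ₃ hf₃ hz => ?_) le_rfl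
    (by omega) fun _ _ _ h => h
  have hE₃ := hE₂.fr hf₃ rfl
  have hR₃ := hR₂.fr hf₃ (by decide) (by decide) (by decide)
  have h2₃ := h2₂.fr hf₃ (by decide) (by decide)
  have x₃ : Rep (τ₃.arr 1) x := by rw [hf₃.arr 1 (by decide)]; exact x₂
  have u₃ : Rep (τ₃.arr 2) u := by rw [hf₃.arr 2 (by decide)]; exact u₂
  have v₃ : Rep (τ₃.arr 3) v := by rw [hf₃.arr 3 (by decide)]; exact hv'
  refine Det.tri (R := fun τ => Rel2 s d (step2 mono f hv d s r ρ x u v z p) τ) ?_ fun _ _ h => h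
  refine Det.mono (Det.seq (T := B) (T' := B + (B + (B + (C + E + 1) + 1) + 1) + 1) (q := 0) (q' := Q)
    (xorFill_spec hE₃.n_eq u₃ v₃ (by decide) (by decide)) fun τ₄ hf₄ huv => ?_) le_rfl
    (by omega) fun _ _ h => h
  have hE₄ := hE₃.fr hf₄ rfl
  have hR₄ := hR₃.fr hf₄ (by decide) (by decide) (by decide)
  have h2₄ := h2₃.fr hf₄ (by decide) (by decide)
  refine Det.mono (Det.seq (T := B) (T' := B + (B + (C + E + 1) + 1) + 1) (q := 0) (q' := Q)
    (andFill_spec (A := 2) (B := 3) (x := u) (y := v) hE₄.n_eq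
    (by rw [hf₄.arr 2 (by decide)]; exact u₃) (by rw [hf₄.arr 3 (by decide)]; exact v₃)
    (by decide) (by decide)) fun τ₅ hf₅ huv' => ?_) le_rfl (by omega) fun _ _ h => h
  have hE₅ := hE₄.fr hf₅ rfl
  have hR₅ := hR₄.fr hf₅ (by decide) (by decide) (by decide)
  have h2₅ := h2₄.fr hf₅ (by decide) (by decide)
  refine Det.mono (Det.seq (T := B) (T' := B + (C + E + 1) + 1) (q := 0) (q' := Q)
    (xorFill_spec (A := 18) (B := 4) (x := ba u v) (y := z) hE₅.n_eq huv'
    (by rw [hf₅.arr 4 (by decide), hf₄.arr 4 (by decide)]; exact hz)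
    (by decide) (by decide)) fun τ₆ hf₆ huvz => ?_) le_rfl (by omega) fun _ _ h => h
  have hE₆ := hE₅.fr hf₆ rfl
  have hR₆ := hR₅.fr hf₆ (by decide) (by decide) (by decide)
  have h2₆ := h2₅.fr hf₆ (by decide) (by decide)
  have x₆ : Rep (τ₆.arr 1) x := by
    rw [hf₆.arr 1 (by decide), hf₅.arr 1 (by decide), hf₄.arr 1 (by decide)]; exact x₃
  have z₆ : Rep (τ₆.arr 4) z := by
    rw [hf₆.arr 4 (by decide), hf₅.arr 4 (by decide), hf₄.arr 4 (by decide)]; exact hz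
  refine Det.mono (Det.seq (T := B) (T' := C + E + 1) (q := 0) (q' := Q)
    (xorFill_spec hE₆.n_eq x₆ z₆ (by decide) (by decide)) fun τ₇ hf₇ hxz => ?_) le_rfl (by omega)
    fun _ _ h => h
  have hE₇ := hE₆.fr hf₇ rfl
  have hR₇ := hR₆.fr hf₇ (by decide) (by decide) (by decide)
  have h2₇ := h2₆.fr hf₇ (by decide) (by decide)
  have hS : Strs x u v z τ₇ := ⟨by rw [hf₇.arr 1 (by decide)]; exact x₆,
    by rw [hf₇.arr 2 (by decide), hf₆.arr 2 (by decide), hf₅.arr 2 (by decide),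
      hf₄.arr 2 (by decide)]; exact u₃,
    by rw [hf₇.arr 3 (by decide), hf₆.arr 3 (by decide), hf₅.arr 3 (by decide),
      hf₄.arr 3 (by decide)]; exact v₃,
    by rw [hf₇.arr 4 (by decide)]; exact z₆,
    by rw [hf₇.arr 14 (by decide), hf₆.arr 14 (by decide), hf₅.arr 14 (by decide)]; exact huv,
    by rw [hf₇.arr 16 (by decide)]; exact huvz, hxz⟩
  refine Det.seq (T := C) (T' := E) (q := 8 * k) (q' := r * (d + 1) + 2)
    (progLits_spec mono hE₇ hS hR₇) ?_
  rintro τ₈ hf₈ ⟨h12, h11⟩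
  refine compare_spec (hE₇.fr hf₈ (by cases mono <;> rfl))
    (by rw [hf₈.arr 1 (by cases mono <;> decide)]; exact hS.a1)
    (hR₇.fr hf₈ (by cases mono <;> decide) (by cases mono <;> decide) (by cases mono <;> decide))
    ⟨?_, ?_, ?_, ?_, h2₇.le⟩ h11
  · rw [hf₈.reg 15 (by cases mono <;> decide), h2₇.J]
  · rw [hf₈.reg 16 (by cases mono <;> decide), h2₇.off]
  · rw [h12, h2₇.rej]; simp
  · rw [hf₈.arr 10 (by cases mono <;> decide)]; exact h2₇.tm

def progPhase2 (mono : Bool) : Prog := forUp 64 65 11 (.exQuery 1 ;; body2 mono)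

set_option maxRecDepth 2000 in
theorem progPhase2_spec (mono : Bool) {σ : St} {R : ℕ} {ρ : Phase1 n} (hE : Env s r k d N hv σ)
    (hR : Rel1 k d ρ σ) (h2 : Rel2 s d ⟨[], false⟩ σ) (h11 : σ.reg 11 = R) :
    Tri f D (progPhase2 mono) (R * (time2 n s r d + 10) + 6) (R * (8 * k + r * (d + 1) + 3)) σ
      (phase2 mono f D hv d s r R ρ) fun p τ => τ.reg 12 ≠ 0 ↔ p.rej = true := by
  refine Tri.mono (tri_for (Tb := 1 + time2 n s r d + 1)
    (qb := fun _ => 1 + (8 * k + (r * (d + 1) + 2))) (M := R)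
    (fun _ p τ => Rel2 s d p τ) (by decide) (by decide) (by decide) (by cases mono <;> decide)
    (by cases mono <;> decide) h11 ?_ ?_) (by ring_nf; omega) (by simp; ring_nf; omega)
    fun _ _ _ h => h.rej
  · intro τ _ ha hr
    exact ⟨by rw [hr 15 (by decide) (by decide), h2.J], by rw [hr 16 (by decide) (by decide), h2.off],
      by rw [hr 12 (by decide) (by decide), h2.rej], by rw [ha]; exact h2.tm, h2.le⟩
  · rintro j hj p τ hf h2 - -
    have hEτ := hE.fr hf (by cases mono <;> rfl)
    have hRτ := hR.fr hf (by cases mono <;> decide) (by cases mono <;> decide)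
      (by cases mono <;> decide)
    refine Tri.seq (Tri.exQuery 1 τ) ?_
    rintro x τ₁ hf₁ rfl
    refine Tri.mono (body2_spec mono (hEτ.fr hf₁ rfl) (x := x) (by simpa using rep_writeString _ x)
      (hRτ.fr hf₁ (by decide) (by decide) (by decide)) (h2.fr hf₁ (by decide) (by decide)))
      le_rfl le_rfl ?_
    rintro p' τ₂ - h τ₃ ha hr
    exact ⟨by rw [hr 15 (by decide) (by decide), h.J], by rw [hr 16 (by decide) (by decide), h.off],
      by rw [hr 12 (by decide) (by decide), h.rej], by rw [ha]; exact h.tm, h.le⟩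

end SecondPhase

/-! ### The whole program -/

section Setup

variable {n : ℕ} {f : BoolFn n} {D : PMF (Fin n → Bool)}

def divLoop : Prog := .loop 20 (.sub 20 20 3 ;; .const 21 1 ;; .add 5 5 21)

/-- The two inequalities say that `E` is the quotient of `v` by `m` rounded up; a last incomplete
subtraction is truncated to zero and still counted. -/
theorem divLoop_spec {m : ℕ} (E : ℕ) {v c : ℕ} {σ : St} (h3 : σ.reg 3 = m) (h20 : σ.reg 20 = v)
    (h5 : σ.reg 5 = c) (h1 : v ≤ E * m) (h2 : E * m < v + m) :
    Det f D divLoop (E * 7 + 1) 0 σ fun τ => τ.reg 5 = c + E := by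
  induction E generalizing σ v c with
  | zero => exact Tri.loop_zero (by omega) (by simpa using h5)
  | succ E ih =>
    rw [Nat.succ_mul] at h1 h2
    refine Det.mono (Det.loop_succ (T := 5) (T' := E * 7 + 1) (q := 0) (q' := 0)
      (R := fun τ => τ.reg 20 = v - m ∧ τ.reg 5 = c + 1) (by omega) (det_ev _ _ _ rfl
      (by simp [ev, h20, h3, h5])) ?_) (by omega) le_rfl fun _ _ h => h
    rintro τ hf ⟨h20', h5'⟩
    refine (ih (by rw [hf.reg 3 (by decide), h3]) h20' h5' (by omega) ?_).mono le_rfl le_rfl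
      fun τ' _ h => by rw [h]; ring
    rcases Nat.lt_or_ge v m with hvm | hvm
    · have hE : E = 0 := by
        by_contra hE
        have := Nat.le_mul_of_pos_left m (Nat.pos_of_ne_zero hE)
        omega
      subst hE; omega
    · omega

/-- Compute the basic number of samples and the maximal number of relevant variables. -/
def setSizes : Prog :=
  (.const 5 0 ;; .const 20 0 ;; .add 20 20 4) ;; divLoop ;;
    (.add 5 5 5 ;; .add 5 5 5 ;; .add 5 5 5 ;; .add 5 5 5 ;; .add 5 5 5 ;; .add 5 5 5 ;;
      .add 5 5 5 ;; .add 5 5 5 ;; .const 6 0) ;; forUp 20 21 1 (.add 6 6 2)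

/-- Eight doublings produce the factor 256. -/
theorem setSizes_spec {s r m E : ℕ} {σ : St} (hs : σ.reg 1 = s) (hr : σ.reg 2 = r) (h3 : σ.reg 3 = m)
    (h1 : σ.reg 4 ≤ E * m) (h2 : E * m < σ.reg 4 + m) :
    Det f D setSizes (E * 7 + s * 9 + 40) 0 σ fun τ => τ.reg 5 = 256 * E ∧ τ.reg 6 = s * r := by
  refine Det.mono (Det.seq (T := 5) (T' := (E * 7 + 1) + (17 + (s * (1 + 8) + 6) + 1) + 1) (q := 0)
    (q' := 0) (R := fun τ => τ.reg 5 = 0 ∧ τ.reg 20 = σ.reg 4) (det_ev _ _ _ rfl (by simp [ev]))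
    ?_) (by omega) le_rfl fun _ _ h => h
  rintro τ₁ hf₁ ⟨h5, h20⟩
  refine Det.seq (T := E * 7 + 1) (T' := 17 + (s * (1 + 8) + 6) + 1) (q := 0) (q' := 0)
    (divLoop_spec E (by rw [hf₁.reg 3 (by decide), h3]) h20 h5 h1 h2) ?_
  rintro τ₂ hf₂ h5
  refine Det.seq (T := 17) (T' := s * (1 + 8) + 6) (q := 0) (q' := 0)
    (R := fun τ => τ.reg 5 = 256 * E ∧ τ.reg 6 = 0) (det_ev _ _ _ rfl (by simp [ev, h5]; ring)) ?_
  rintro τ₃ hf₃ ⟨h5, h6⟩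
  have r1 : τ₃.reg 1 = s := by
    rw [hf₃.reg 1 (by decide), hf₂.reg 1 (by decide), hf₁.reg 1 (by decide), hs]
  have r2 : τ₃.reg 2 = r := by
    rw [hf₃.reg 2 (by decide), hf₂.reg 2 (by decide), hf₁.reg 2 (by decide), hr]
  refine Det.mono (det_addLoop 20 21 1 6 2 τ₃ (by decide) (by decide) (by decide) (by decide)
    (by decide) (by decide) (by decide) (by decide) (by decide)) (by rw [r1]) le_rfl ?_
  intro τ₄ hf₄ h6'
  exact ⟨by rw [hf₄.reg 5 (by decide), h5], by rw [h6', h6, r1, r2, zero_add]⟩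

def powLoop : Prog :=
  .loop 24 (.store 12 7 8 ;; .add 8 8 8 ;; .const 25 1 ;; .add 7 7 25 ;; .sub 24 23 8)

theorem powLoop_spec {V d : ℕ} (rem : ℕ) {j : ℕ} {σ : St} (hj : j + rem = d)
    (hlt : ∀ i < d, 2 ^ i < V) (hle : V ≤ 2 ^ d) (h7 : σ.reg 7 = j) (h8 : σ.reg 8 = 2 ^ j)
    (h23 : σ.reg 23 = V) (h24 : σ.reg 24 = V - 2 ^ j) (h12 : ∀ i < j, σ.arr 12 i = 2 ^ i) :
    Det f D powLoop (rem * 11 + 1) 0 σ fun τ =>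
      τ.reg 7 = d ∧ τ.reg 8 = 2 ^ d ∧ ∀ i < d, τ.arr 12 i = 2 ^ i := by
  induction rem generalizing σ j with
  | zero =>
    obtain rfl : j = d := by omega
    exact Tri.loop_zero (by omega) ⟨h7, h8, h12⟩
  | succ rem ih =>
    have := hlt j (by omega)
    refine Det.mono (Det.loop_succ (T := 9) (T' := rem * 11 + 1) (q := 0) (q' := 0)
      (R := fun τ => τ.reg 7 = j + 1 ∧ τ.reg 8 = 2 ^ (j + 1) ∧ τ.reg 24 = V - 2 ^ (j + 1) ∧
        τ.arr 12 = Function.update (σ.arr 12) j (2 ^ j)) (by omega) (det_ev _ _ _ rfl ?_) ?_)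
      (by omega) le_rfl fun _ _ h => h
    · simp [ev, h7, h8, h23, pow_succ, mul_two]
    · rintro τ hf ⟨h7', h8', h24', h12'⟩
      refine ih (by omega) h7' h8' (by rw [hf.reg 23 (by decide), h23]) h24' fun i hi => ?_
      rw [h12', Function.update_apply]
      split_ifs with h
      · rw [h]
      · exact h12 i (by omega)

/-- Compute the number of blocks. -/
def setBlocks : Prog :=
  .const 23 0 ;; forUp 20 21 6 (.add 23 23 6) ;;
    (.add 23 23 23 ;; .add 23 23 23 ;; .const 8 1 ;; .const 7 0 ;; .sub 24 23 8) ;; powLoop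

/-- The hypotheses make `d` minimal. The powers of two are stored on the way up because the binary
search needs them in descending order and there is no division. -/
theorem setBlocks_spec {k d : ℕ} {σ : St} (h6 : σ.reg 6 = k)
    (hlt : ∀ i < d, 2 ^ i < 4 * k ^ 2) (hle : 4 * k ^ 2 ≤ 2 ^ d) :
    Det f D setBlocks (k * 9 + d * 11 + 30) 0 σ fun τ =>
      τ.reg 7 = d ∧ τ.reg 8 = 2 ^ d ∧ ∀ i < d, τ.arr 12 i = 2 ^ i := by
  refine Det.mono (Det.seq (T := 1) (T' := (k * (1 + 8) + 6) + (9 + (d * 11 + 1) + 1) + 1) (q := 0)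
    (q' := 0) (R := fun τ => τ.reg 23 = 0) (det_ev _ _ _ rfl (by simp [ev]))
    ?_) (by omega) le_rfl fun _ _ h => h
  rintro τ₁ hf₁ h23
  have r6 : τ₁.reg 6 = k := by rw [hf₁.reg 6 (by decide), h6]
  refine Det.seq (T := k * (1 + 8) + 6) (T' := 9 + (d * 11 + 1) + 1) (q := 0) (q' := 0)
    (Det.mono (det_addLoop 20 21 6 23 6 τ₁ (by decide) (by decide) (by decide) (by decide)
    (by decide) (by decide) (by decide) (by decide) (by decide)) (by rw [r6]) le_rfl
    fun _ _ h => h) ?_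
  intro τ₂ hf₂ h23'
  rw [h23, r6, zero_add] at h23'
  refine Det.seq (T := 9) (T' := d * 11 + 1) (q := 0) (q' := 0) (R := fun τ => τ.reg 7 = 0 ∧
    τ.reg 8 = 1 ∧ τ.reg 23 = 4 * k ^ 2 ∧ τ.reg 24 = 4 * k ^ 2 - 1) (det_ev _ _ _ rfl ?_) ?_
  · have : 2 * (k * k + k * k) = 4 * k ^ 2 := by ring
    simp [ev, h23', ← two_mul, ← this]
  rintro τ₃ hf₃ ⟨h7, h8, h23, h24⟩
  exact powLoop_spec d (by omega) hlt hle h7 (by simpa using h8) h23 (by simpa using h24)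
    (fun i hi => absurd hi (by omega))

/-- Compute the numbers of rounds and mark all blocks. -/
def setRounds : Prog :=
  .const 9 0 ;; forUp 20 21 7 (.add 9 9 5) ;; (.const 10 0 ;; .add 10 10 9) ;;
    forUp 20 21 6 (.add 10 10 9) ;; .add 11 5 5 ;; forUp 20 21 1 (.add 11 11 5) ;; .const 22 1 ;;
    forUp 20 21 8 (.store 13 20 22)

/-- Here `E` stands for the content of register 5, which is 256 times the rounded reciprocal of the
distance parameter. -/
theorem setRounds_spec {s k d E m : ℕ} {σ : St} (h1 : σ.reg 1 = s) (h5 : σ.reg 5 = E)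
    (h6 : σ.reg 6 = k) (h7 : σ.reg 7 = d) (h8 : σ.reg 8 = m) :
    Det f D setRounds (d * 9 + k * 9 + s * 9 + m * 9 + 50) 0 σ fun τ =>
      τ.reg 9 = d * E ∧ τ.reg 10 = (k + 1) * (d * E) ∧ τ.reg 11 = (s + 2) * E ∧
        ∀ b < m, τ.arr 13 b = 1 := by
  refine Det.mono (Det.seq (T := 1) (T' := (d * (1 + 8) + 6) + (3 + ((k * (1 + 8) + 6) + (1 +
    ((s * (1 + 8) + 6) + (1 + (m * (1 + 8) + 6) + 1) + 1) + 1) + 1) + 1) + 1) (q := 0)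
    (q' := 0) (R := fun τ => τ.reg 9 = 0) (det_ev _ _ _ rfl (by simp [ev]))
    ?_) (by omega) le_rfl fun _ _ h => h
  rintro τ₁ hf₁ h9
  have r5 : τ₁.reg 5 = E := by rw [hf₁.reg 5 (by decide), h5]
  have r7 : τ₁.reg 7 = d := by rw [hf₁.reg 7 (by decide), h7]
  refine Det.seq (T := d * (1 + 8) + 6) (T' := 3 + ((k * (1 + 8) + 6) + (1 +
    ((s * (1 + 8) + 6) + (1 + (m * (1 + 8) + 6) + 1) + 1) + 1) + 1) + 1) (q := 0) (q' := 0)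
    (Det.mono (det_addLoop 20 21 7 9 5 τ₁ (by decide) (by decide) (by decide) (by decide)
    (by decide) (by decide) (by decide) (by decide) (by decide)) (by rw [r7]) le_rfl
    fun _ _ h => h) ?_
  intro τ₂ hf₂ h9'
  rw [h9, r5, r7, zero_add] at h9'
  refine Det.seq (T := 3) (T' := (k * (1 + 8) + 6) + (1 +
    ((s * (1 + 8) + 6) + (1 + (m * (1 + 8) + 6) + 1) + 1) + 1) + 1) (q := 0) (q' := 0)
    (R := fun τ => τ.reg 10 = d * E) (det_ev _ _ _ rfl (by simp [ev, h9'])) ?_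
  intro τ₃ hf₃ h10
  have r9 : τ₃.reg 9 = d * E := by rw [hf₃.reg 9 (by decide), h9']
  have r6 : τ₃.reg 6 = k := by
    rw [hf₃.reg 6 (by decide), hf₂.reg 6 (by decide), hf₁.reg 6 (by decide), h6]
  refine Det.seq (T := k * (1 + 8) + 6) (T' := 1 +
    ((s * (1 + 8) + 6) + (1 + (m * (1 + 8) + 6) + 1) + 1) + 1) (q := 0) (q' := 0)
    (Det.mono (det_addLoop 20 21 6 10 9 τ₃ (by decide) (by decide) (by decide) (by decide)
    (by decide) (by decide) (by decide) (by decide) (by decide)) (by rw [r6]) le_rfl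
    fun _ _ h => h) ?_
  intro τ₄ hf₄ h10'
  rw [h10, r9, r6] at h10'
  have r5 : τ₄.reg 5 = E := by
    rw [hf₄.reg 5 (by decide), hf₃.reg 5 (by decide), hf₂.reg 5 (by decide), r5]
  refine Det.seq (T := 1) (T' := (s * (1 + 8) + 6) + (1 + (m * (1 + 8) + 6) + 1) + 1) (q := 0)
    (q' := 0) (R := fun τ => τ.reg 11 = 2 * E) (det_ev _ _ _ rfl (by simp [ev, r5, two_mul])) ?_
  intro τ₅ hf₅ h11
  have r5 : τ₅.reg 5 = E := by rw [hf₅.reg 5 (by decide), r5]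
  have r1 : τ₅.reg 1 = s := by
    rw [hf₅.reg 1 (by decide), hf₄.reg 1 (by decide), hf₃.reg 1 (by decide), hf₂.reg 1 (by decide),
      hf₁.reg 1 (by decide), h1]
  refine Det.seq (T := s * (1 + 8) + 6) (T' := 1 + (m * (1 + 8) + 6) + 1) (q := 0) (q' := 0)
    (Det.mono (det_addLoop 20 21 1 11 5 τ₅ (by decide) (by decide) (by decide) (by decide)
    (by decide) (by decide) (by decide) (by decide) (by decide)) (by rw [r1]) le_rfl
    fun _ _ h => h) ?_
  intro τ₆ hf₆ h11'
  rw [h11, r5, r1] at h11'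
  refine Det.seq (T := 1) (T' := m * (1 + 8) + 6) (q := 0) (q' := 0) (R := fun τ => τ.reg 22 = 1)
    (det_ev _ _ _ rfl (by simp [ev])) ?_
  intro τ₇ hf₇ h22
  have r8 : τ₇.reg 8 = m := by
    rw [hf₇.reg 8 (by decide), hf₆.reg 8 (by decide), hf₅.reg 8 (by decide), hf₄.reg 8 (by decide),
      hf₃.reg 8 (by decide), hf₂.reg 8 (by decide), hf₁.reg 8 (by decide), h8]
  refine Det.mono (det_fill (A := 13) 0 (fun _ => 1) (by decide)
    (by decide) (by decide) (by decide) (by decide) rfl r8 ?_) le_rfl le_rfl ?_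
  · intro b _ τ hf h20 _
    have : τ.reg 22 = 1 := by rw [hf.reg 22 (by decide), h22]
    simp [ev, h20, this]
  · rintro τ hf ⟨h, -⟩
    refine ⟨?_, ?_, ?_, fun b hb => by simpa using h b hb⟩
    · rw [hf.reg 9 (by decide), hf₇.reg 9 (by decide), hf₆.reg 9 (by decide), hf₅.reg 9 (by decide),
        hf₄.reg 9 (by decide), r9]
    · rw [hf.reg 10 (by decide), hf₇.reg 10 (by decide), hf₆.reg 10 (by decide),
        hf₅.reg 10 (by decide), h10']
      ring
    · rw [hf.reg 11 (by decide), hf₇.reg 11 (by decide), h11']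
      ring

/-- Choose the partition into blocks at random. -/
def setHash : Prog :=
  forUp 64 65 7 (randStr 2 ;; forUp 20 21 0 (.load 22 5 20 ;; .add 22 22 22 ;; .load 23 2 20 ;;
    .add 22 22 23 ;; .store 5 20 22))

theorem setHash_spec {d : ℕ} {σ : St} (h0 : σ.reg 0 = n) (h7 : σ.reg 7 = d)
    (h5 : ∀ i < n, σ.arr 5 i = 0) :
    Tri f D setHash (d * (n * 28 + 21) + 6) 0 σ (hashGen n d) fun hv τ =>
      (∀ i : Fin n, τ.arr 5 i = hv i) ∧ ∀ i, hv i < 2 ^ d := by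
  refine Tri.mono (tri_for (Tb := (n * 11 + 6) + (n * (9 + 8) + 6) + 1) (qb := fun _ => 0 + 0) (M := d)
    (fun j (hv : Fin n → ℕ) τ => (∀ i : Fin n, τ.arr 5 i = hv i) ∧ ∀ i, hv i < 2 ^ j) (by decide)
    (by decide) (by decide) (by decide) (by decide) h7 ?_ ?_) (by ring_nf; omega) (by simp)
    fun _ _ _ h => h
  · intro τ _ ha _
    exact ⟨fun i => by rw [ha, h5 i i.2], fun i => by simp⟩
  · rintro j hj hv τ hf ⟨g5, glt⟩ - -
    have r0 : τ.reg 0 = n := by rw [hf.reg 0 (by decide), h0]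
    refine Tri.seq (randStr_spec 2 r0) ?_
    intro u τ₁ hf₁ hu
    have r0 : τ₁.reg 0 = n := by rw [hf₁.reg 0 (by decide), r0]
    have a5 : τ₁.arr 5 = τ.arr 5 := hf₁.arr 5 (by decide)
    refine Det.tri (det_fill (A := 5) 0 (fun i => if h : i < n then
      2 * hv ⟨i, h⟩ + (u ⟨i, h⟩).toNat else 0) (by decide) (by decide) (by decide) (by decide)
      (by decide) rfl r0 ?_) ?_
    · intro i hi τ' hf' h20 h5'
      have e5 : τ'.arr 5 i = hv ⟨i, hi⟩ := by rw [h5' i (by omega), a5]; exact g5 ⟨i, hi⟩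
      have e2 : τ'.arr 2 i = (u ⟨i, hi⟩).toNat := by rw [hf'.arr 2 (by decide)]; exact hu ⟨i, hi⟩
      rw [dif_pos hi]
      simp [ev, h20, e5, e2, two_mul]
    · rintro τ₂ - ⟨h, -⟩ τ₃ ha _
      refine ⟨fun i => ?_, fun i => ?_⟩
      · have := h i i.2
        rw [dif_pos i.2, zero_add] at this
        rw [ha, this]
      · have := glt i
        have : (u i).toNat ≤ 1 := Bool.toNat_le _
        change 2 * hv i + (u i).toNat < 2 ^ (j + 1)
        rw [pow_succ]; omega

end Setup

/-! ### Assembly of the tester. -/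

section Tester

variable {n : ℕ} {f : BoolFn n} {D : PMF (Fin n → Bool)}

def decideAnswer : Prog :=
  .sub 37 9 13 ;; .add 12 12 37 ;; .sub 37 13 9 ;; .add 12 12 37 ;; .ite 12 (.const 0 0) (.const 0 1)

def testProg (mono : Bool) : Prog :=
  setSizes ;; setBlocks ;; setRounds ;; setHash ;; progPhase1 ;; progPhase2 mono ;; decideAnswer

/-- If the parameter exceeds one, no function is far from the class and accepting is correct without
queries. -/
def tester (mono : Bool) : Prog := .sub 20 3 4 ;; .ite 20 (.const 0 1) (testProg mono)

def timeBound (n s r k d E R₁ R₂ : ℕ) : ℕ :=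
  E * 7 + s * 18 + k * 18 + d * 20 + 2 ^ d * 9 + d * (n * 28 + 21) +
    R₁ * (d * (n * 30 + 50) + 2 ^ d * 9 + n * 110 + 210) + R₂ * (time2 n s r d + 10) + 200

set_option maxRecDepth 2000 in
theorem testProg_spec (mono : Bool) {s r k d E m : ℕ} {σ : St} (h0 : σ.reg 0 = n) (h1 : σ.reg 1 = s)
    (h2 : σ.reg 2 = r) (h3 : σ.reg 3 = m) (hE : σ.reg 4 ≤ E * m) (hE' : E * m < σ.reg 4 + m)
    (hr : ∀ x, 12 ≤ x → x < 19 → σ.reg x = 0) (ha : σ.arr = fun _ _ => 0) (hk : k = s * r)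
    (hlt : ∀ i < d, 2 ^ i < 4 * k ^ 2) (hle : 4 * k ^ 2 ≤ 2 ^ d) :
    Tri f D (testProg mono) (timeBound n s r k d E ((k + 1) * (d * (256 * E))) ((s + 2) * (256 * E)))
      ((k + 1) * (d * (256 * E)) * (d + 4) + (s + 2) * (256 * E) * (8 * k + r * (d + 1) + 3)) σ
      (answer mono f D d k s r (d * (256 * E)) ((k + 1) * (d * (256 * E))) ((s + 2) * (256 * E)))
      fun b τ => τ.reg 0 = b.toNat := by
  set N := d * (256 * E)
  set R₁ := (k + 1) * N
  set R₂ := (s + 2) * (256 * E)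
  set T₁ := R₁ * (d * (n * 30 + 50) + 2 ^ d * 9 + n * 110 + 210) + 6 with hT₁
  set T₂ := R₂ * (time2 n s r d + 10) + 6 with hT₂
  set T₀ := d * (n * 28 + 21) + 6 with hT₀
  set q₁ := R₁ * (d + 4)
  set q₂ := R₂ * (8 * k + r * (d + 1) + 3)
  refine Tri.mono (Det.seq_tri (T := E * 7 + s * 9 + 40) (T' := (k * 9 + d * 11 + 30) +
    ((d * 9 + k * 9 + s * 9 + 2 ^ d * 9 + 50) + (T₀ + (T₁ + (T₂ + 15 + 1) + 1) + 1) + 1) + 1) (q := 0)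
    (q' := q₁ + q₂) (setSizes_spec h1 h2 h3 hE hE') ?_) (by rw [timeBound]; omega) (by omega)
    fun _ _ _ h => h
  rintro τ₁ hf₁ ⟨h5, h6⟩
  rw [← hk] at h6
  refine Tri.mono (Det.seq_tri (T := k * 9 + d * 11 + 30) (T' := (d * 9 + k * 9 + s * 9 + 2 ^ d * 9 + 50) +
    (T₀ + (T₁ + (T₂ + 15 + 1) + 1) + 1) + 1) (q := 0) (q' := q₁ + q₂) (setBlocks_spec h6 hlt hle) ?_)
    le_rfl (by omega) fun _ _ _ h => h
  rintro τ₂ hf₂ ⟨h7, h8, h12⟩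
  refine Tri.mono (Det.seq_tri (T := d * 9 + k * 9 + s * 9 + 2 ^ d * 9 + 50) (T' := T₀ + (T₁ + (T₂ + 15 + 1) + 1) + 1)
    (q := 0) (q' := q₁ + q₂) (setRounds_spec (s := s) (k := k)
    (by rw [hf₂.reg 1 (by decide), hf₁.reg 1 (by decide), h1]) (by rw [hf₂.reg 5 (by decide), h5])
    (by rw [hf₂.reg 6 (by decide), h6]) h7 h8) ?_) le_rfl (by omega) fun _ _ _ h => h
  rintro τ₃ hf₃ ⟨h9, h10, h11, h13⟩
  refine Tri.mono (Tri.seq (T := T₀) (T' := T₁ + (T₂ + 15 + 1) + 1) (q := 0) (q' := q₁ + q₂)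
    (setHash_spec (d := d) ?_ ?_ ?_) ?_) le_rfl (by omega) fun _ _ _ h => h
  · rw [hf₃.reg 0 (by decide), hf₂.reg 0 (by decide), hf₁.reg 0 (by decide), h0]
  · rw [hf₃.reg 7 (by decide), h7]
  · intro i _
    rw [hf₃.arr 5 (by decide), hf₂.arr 5 (by decide), hf₁.arr 5 (by decide), ha]
  rintro hv τ hf ⟨g5, glt⟩
  -- The two phases rely on the zero content of whatever the setup has not touched: empty sets, zero
  -- strings and zero counters.
  have har : ∀ a, a ∉ [2, 5, 12, 13] → τ.arr a = fun _ => 0 := fun a hna => by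
    have h : ∀ {P : Prog} {l : List ℕ}, wa P = l → (∀ x ∈ l, x ∈ [2, 5, 12, 13]) → a ∉ wa P :=
      fun hP hl hm => hna (hl a (hP ▸ hm))
    rw [hf.arr a (h (P := setHash) rfl (by decide)), hf₃.arr a (h (P := setRounds) rfl (by decide)),
      hf₂.arr a (h (P := setBlocks) rfl (by decide)), hf₁.arr a (h (P := setSizes) rfl (by decide)), ha]
  have hreg : ∀ x, 12 ≤ x → x < 19 → τ.reg x = 0 := fun x hx hx' => by
    have h : ∀ {P : Prog} {l : List ℕ}, wr P = l → (∀ y ∈ l, y < 12 ∨ 19 ≤ y) → x ∉ wr P :=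
      fun hP hl hm => by
        have := hl x (hP ▸ hm)
        omega
    rw [hf.reg x (h (P := setHash) rfl (by decide)), hf₃.reg x (h (P := setRounds) rfl (by decide)),
      hf₂.reg x (h (P := setBlocks) rfl (by decide)), hf₁.reg x (h (P := setSizes) rfl (by decide)),
      hr x hx hx']
  have hEnv : Env s r k d N hv τ := by
    refine ⟨?_, ?_, ?_, ?_, ?_, ?_, ?_, g5, ?_, ?_, ?_, glt⟩
    · rw [hf.reg 0 (by decide), hf₃.reg 0 (by decide), hf₂.reg 0 (by decide), hf₁.reg 0 (by decide), h0]
    · rw [hf.reg 1 (by decide), hf₃.reg 1 (by decide), hf₂.reg 1 (by decide), hf₁.reg 1 (by decide), h1]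
    · rw [hf.reg 2 (by decide), hf₃.reg 2 (by decide), hf₂.reg 2 (by decide), hf₁.reg 2 (by decide), h2]
    · rw [hf.reg 6 (by decide), hf₃.reg 6 (by decide), hf₂.reg 6 (by decide), h6]
    · rw [hf.reg 7 (by decide), hf₃.reg 7 (by decide), h7]
    · rw [hf.reg 8 (by decide), hf₃.reg 8 (by decide), h8]
    · rw [hf.reg 9 (by decide), h9]
    · rw [hf.arr 12 (by decide), hf₃.arr 12 (by decide)]; exact h12
    · intro b hb
      rw [hf.arr 13 (by decide), h13 b hb]; simp [every]
    · intro i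
      rw [har 15 (by decide)]; simp [zs]
  have hR1 : Rel1 k d (Phase1.first n) τ := by
    refine ⟨?_, ?_, by simp [Phase1.first], ?_, by simp [Phase1.first]⟩
    · intro i; rw [har 6 (by decide)]; simp [Phase1.first, zs]
    · intro b _; rw [har 7 (by decide)]; simp [Phase1.first, mem]
    · intro b _ i; rw [har 8 (by decide)]; simp [Phase1.first, zs]
  have hC1 : Count1 k N (Phase1.first n) τ := ⟨by rw [hreg 13 (by omega) (by omega)]; rfl,
    by rw [hreg 14 (by omega) (by omega)]; rfl, by simp [Phase1.first], Nat.zero_le _⟩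
  refine Tri.mono (Tri.seq (T := T₁) (T' := T₂ + 15 + 1) (q := q₁) (q' := q₂)
    (progPhase1_spec hEnv hR1 hC1 (by rw [hf.reg 10 (by decide), h10])) ?_) le_rfl le_rfl
    fun _ _ _ h => h
  rintro ρ τ₄ hf₄ ⟨hR, hC⟩
  have hE₄ := hEnv.fr hf₄ rfl
  have hR2 : Rel2 s d ⟨[], false⟩ τ₄ := by
    refine ⟨?_, ?_, ?_, by simp, Nat.zero_le _⟩
    · rw [hf₄.reg 15 (by decide), hreg 15 (by omega) (by omega)]; rfl
    · rw [hf₄.reg 16 (by decide), hreg 16 (by omega) (by omega)]; simp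
    · rw [hf₄.reg 12 (by decide), hreg 12 (by omega) (by omega)]; simp
  refine Tri.mono (Tri.seq (T := T₂) (T' := 15) (q := q₂) (q' := 0)
    (progPhase2_spec mono hE₄ hR hR2
    (by rw [hf₄.reg 11 (by decide), hf.reg 11 (by decide), h11])) ?_) le_rfl le_rfl fun _ _ _ h => h
  intro p τ₅ hf₅ h12'
  have hE₅ := hE₄.fr hf₅ (by cases mono <;> rfl)
  have r13 : τ₅.reg 13 = ρ.cnt := by rw [hf₅.reg 13 (by cases mono <;> decide), hC.cnt]
  refine Det.tri (det_ev _ _ (fun τ' => τ'.reg 0 = (decide (ρ.cnt = N) && !p.rej).toNat) rfl ?_)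
    fun _ _ h => h
  simp only [decideAnswer, ev, St.set_reg, Nat.reduceEqDiff, if_true, if_false, hE₅.N_eq, r13]
  by_cases hN : ρ.cnt = N
  · simp only [hN, Nat.sub_self, add_zero]
    cases hp : p.rej
    · have : τ₅.reg 12 = 0 := by
        by_contra h; rw [hp] at h12'; exact absurd (h12'.1 h) (by simp)
      simp [this]
    · have : τ₅.reg 12 ≠ 0 := h12'.2 hp
      simp [this]
  · have : τ₅.reg 12 + (N - ρ.cnt) + (ρ.cnt - N) ≠ 0 := by omega
    rw [if_pos this]
    simp [hN]

end Tester

/-! ### Error probabilities. -/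

section Correctness

theorem ex_map {α β : Type} (μ : PMF α) (g : α → β) (h : β → ENNReal) :
    ex (μ.map g) h = ex μ fun a => h (g a) := by
  rw [← PMF.bind_pure_comp, ex_bind]
  simp only [Function.comp_apply, ex_pure]

theorem two_thirds_le_prob {α : Type} (μ : PMF α) (S : Set α)
    (h : ex μ (fun a => chi (a ∉ S)) ≤ 1 / 3) : 2 / 3 ≤ prob μ S := by
  have h1 := ex_chi_add_not μ fun a => a ∈ S
  rw [ex_chi] at h1
  have h2 : μ.toOuterMeasure S ≠ ⊤ := by
    intro h'
    rw [show {a | a ∈ S} = S from rfl, h'] at h1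
    simp at h1
  have h3 : ex μ (fun a => chi (a ∉ S)) ≠ ⊤ := ne_top_of_le_ne_top (by norm_num) h
  have h4 := congrArg ENNReal.toReal h1
  rw [show {a | a ∈ S} = S from rfl, ENNReal.toReal_add h2 h3, ENNReal.toReal_one] at h4
  have h5 := ENNReal.toReal_mono (by norm_num) h
  rw [ENNReal.toReal_div] at h5
  norm_num at h5
  rw [prob]
  linarith

/-- In the coupling of the abstract answer with the run, the answer equals register 0 almost surely,
so error bounds for the abstract process hold for the machine. Support statements are read off the
coupling as well. -/
theorem isTester_of_tri {n s r : ℕ} {e : ℚ} {P : Prog} {C : Set (BoolFn n)} {ε : ℝ} {T q t : ℕ} {B : ℝ}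
    (h : ∀ (f : BoolFn n) (D : PMF (Fin n → Bool)), ∃ ν : PMF Bool,
      Tri f D P T q ⟨(start P n s r e).reg, (start P n s r e).arr⟩ ν (fun b τ => τ.reg 0 = b.toNat) ∧
      (f ∈ C → ex ν (fun b => chi (b = false)) ≤ 1 / 3) ∧
      (IsFarFromClass D ε f C → ex ν (fun b => chi (b = true)) ≤ 1 / 3))
    (hT : T ≤ t) (hq : (q : ℝ) ≤ B) : IsTester (start P n s r e) C ε t B := by
  have key : ∀ (f : BoolFn n) (D : PMF (Fin n → Bool)), ∃ μ : PMF (Bool × Config),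
      μ.map Prod.snd = run f D t (start P n s r e) ∧
      (∀ p ∈ μ.support, p.2.todo = [] ∧ p.2.queries ≤ q ∧ p.2.reg 0 = p.1.toNat) ∧
      (f ∈ C → ex μ (fun p => chi (p.1 = false)) ≤ 1 / 3) ∧
      (IsFarFromClass D ε f C → ex μ (fun p => chi (p.1 = true)) ≤ 1 / 3) := by
    intro f D
    obtain ⟨ν, h1, h2, h3⟩ := h f D
    obtain ⟨μ, m1, m2, m3⟩ := ((h1.mono hT le_rfl fun _ _ _ h => h) [] 0).exists_coupling (by
      rintro b c ⟨σ', m', rfl, -⟩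
      rfl)
    refine ⟨μ, m2, ?_, ?_, ?_⟩
    · intro p hp
      obtain ⟨σ', m', h, hm, -, hr⟩ := m3 p hp
      rw [h]
      exact ⟨rfl, by simpa using hm, hr⟩
    · rw [← m1, ex_map] at h2; exact h2
    · rw [← m1, ex_map] at h3; exact h3
  have supp : ∀ (f : BoolFn n) (D : PMF (Fin n → Bool)), ∀ c ∈ (run f D t (start P n s r e)).support,
      c.todo = [] ∧ c.queries ≤ q := by
    intro f D c hc
    obtain ⟨μ, m1, m2, -⟩ := key f D
    rw [← m1, PMF.mem_support_map_iff] at hc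
    obtain ⟨p, hp, rfl⟩ := hc
    exact ⟨(m2 p hp).1, (m2 p hp).2.1⟩
  refine ⟨fun f D c hc => (supp f D c hc).1, fun f D c hc => ?_, fun f D hf => ?_, fun f D hf => ?_⟩
  · exact (Nat.cast_le.2 (supp f D c hc).2).trans hq
  · obtain ⟨μ, m1, m2, m3, -⟩ := key f D
    refine two_thirds_le_prob _ _ ?_
    rw [← m1, ex_map]
    refine le_trans (ex_le_of_support _ fun p hp => chi_mono fun hn => ?_) (m3 hf)
    obtain ⟨h1, -, h2⟩ := m2 p hp
    by_contra hb
    exact hn ⟨h1, by rw [h2, Bool.eq_true_of_not_eq_false hb]; rfl⟩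
  · obtain ⟨μ, m1, m2, -, m3⟩ := key f D
    refine two_thirds_le_prob _ _ ?_
    rw [← m1, ex_map]
    refine le_trans (ex_le_of_support _ fun p hp => chi_mono fun hn => ?_) (m3 hf)
    obtain ⟨h1, -, h2⟩ := m2 p hp
    by_contra hb
    exact hn ⟨h1, by rw [h2, Bool.eq_false_of_not_eq_true hb]; rfl⟩

/-- The empty disjunction lies in the class, and no distance exceeds one. -/
theorem not_isFarFromClass {n s r : ℕ} {mono : Bool} {D : PMF (Fin n → Bool)} {f : BoolFn n} {ε : ℝ}
    (hε : 1 < ε) : ¬IsFarFromClass D ε f (cls mono n s r) := by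
  intro h
  have h1 := h (fun _ => false) (mem_cls.2 ⟨zs, ∅, fun _ => rfl, by simp, by simp, by simp⟩)
  have h2 : prob D {x | f x ≠ false} ≤ 1 := by
    rw [prob, ← ex_chi]
    refine ENNReal.toReal_le_of_le_ofReal zero_le_one ?_
    rw [ENNReal.ofReal_one]
    exact ex_le _ fun _ => chi_le_one _
  linarith

/-- By `1 - t ≤ exp (-t)` the power is at most `exp (-2)`, and `exp 1 ≥ 2`. -/
theorem pow_bound {ε : ℝ} {E : ℕ} (hε : ε ≤ 1) (hE : 1 ≤ ε * E) :
    (1 - ε / 128) ^ (256 * E) ≤ 1 / 4 := by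
  have h1 : 1 - ε / 128 ≤ Real.exp (-(ε / 128)) := by
    have := Real.add_one_le_exp (-(ε / 128)); linarith
  calc (1 - ε / 128) ^ (256 * E) ≤ Real.exp (-(ε / 128)) ^ (256 * E) :=
        pow_le_pow_left₀ (by linarith) h1 _
    _ = Real.exp (-(2 * (ε * E))) := by rw [← Real.exp_nat_mul]; congr 1; push_cast; ring
    _ ≤ Real.exp (-2) := Real.exp_le_exp.2 (by linarith)
    _ ≤ 1 / 4 := by
      have h := Real.add_one_le_exp (1 : ℝ)
      rw [Real.exp_neg, show (2 : ℝ) = 1 + 1 by norm_num, Real.exp_add, ← one_div]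
      refine one_div_le_one_div_of_le (by norm_num) ?_
      nlinarith

/-- The first phase has `d` batches and the second `s + 2` batches of `256 * E` rounds. Every batch
gains a factor 1/4, which beats the `k + 1` runs and the potential `2 ^ s`; the two errors are at
most 1/8 and 1/16. -/
theorem answer_sound_third {n s r k d E : ℕ} {mono : Bool} {D : PMF (Fin n → Bool)} {f : BoolFn n}
    {ε : ℝ} (hε0 : 0 < ε) (hE : 1 ≤ ε * E) (hfar : IsFarFromClass D ε f (cls mono n s r))
    (hk : 1 ≤ k) (hd : 4 * k ^ 2 ≤ 2 ^ d) (R₁ : ℕ) :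
    ex (answer mono f D d k s r (d * (256 * E)) R₁ ((s + 2) * (256 * E))) (fun b => chi (b = true)) ≤
      1 / 3 := by
  have hε : ε ≤ 1 := not_lt.1 fun h => not_isFarFromClass h hfar
  refine (answer_sound hε0 hε hfar d k _ _ _).trans ?_
  have hb := pow_bound hε hE
  have h0 : 0 ≤ 1 - ε / 128 := by linarith
  have h1 : (1 - ε / 2) ^ (d * (256 * E)) ≤ (1 / 4) ^ d := by
    rw [mul_comm, pow_mul]
    exact pow_le_pow_left₀ (by apply pow_nonneg; linarith)
      ((pow_le_pow_left₀ (by linarith) (by linarith) _).trans hb) d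
  have h2 : (1 - ε / 128) ^ ((s + 2) * (256 * E)) ≤ (1 / 4) ^ (s + 2) := by
    rw [mul_comm, pow_mul]
    exact pow_le_pow_left₀ (by positivity) hb _
  have hd' : 4 * (k : ℝ) ^ 2 ≤ 2 ^ d := by exact_mod_cast hd
  have hk' : (1 : ℝ) ≤ k := by exact_mod_cast hk
  -- Since `4 ^ d = 2 ^ d * 2 ^ d ≥ 16 * k ^ 2 ≥ 8 * (k + 1)`.
  have h3 : ((k : ℝ) + 1) * (1 / 4) ^ d ≤ 1 / 8 := by
    rw [one_div_pow, mul_one_div, div_le_div_iff₀ (by positivity) (by norm_num)]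
    have : (4 : ℝ) ^ d = 2 ^ d * 2 ^ d := by rw [← mul_pow]; norm_num
    rw [this]
    have h4 : (4 : ℝ) ≤ 2 ^ d := by nlinarith
    nlinarith [mul_le_mul hd' h4 (by norm_num) (by positivity)]
  have h4 : (2 : ℝ) ^ s * (1 / 4) ^ (s + 2) ≤ 1 / 16 := by
    rw [pow_add, ← mul_assoc, ← mul_pow]
    have : ((2 : ℝ) * (1 / 4)) ^ s ≤ 1 := pow_le_one₀ (by norm_num) (by norm_num)
    linarith
  calc ((k + 1 : ℕ) : ENNReal) * ENNReal.ofReal (1 - ε / 2) ^ (d * (256 * E)) +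
        2 ^ s * ENNReal.ofReal (1 - ε / 128) ^ ((s + 2) * (256 * E))
      = ENNReal.ofReal (((k : ℝ) + 1) * (1 - ε / 2) ^ (d * (256 * E)) +
        2 ^ s * (1 - ε / 128) ^ ((s + 2) * (256 * E))) := by
        rw [ENNReal.ofReal_add (mul_nonneg (by positivity) (pow_nonneg (by linarith) _))
          (by positivity), ENNReal.ofReal_mul (by positivity), ENNReal.ofReal_mul (by positivity),
          ENNReal.ofReal_pow (by linarith), ENNReal.ofReal_pow h0, ENNReal.ofReal_pow (by norm_num)]
        congr 2
        · rw [← Nat.cast_add_one, ENNReal.ofReal_natCast]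
        · norm_num
    _ ≤ ENNReal.ofReal (1 / 3) := by
        refine ENNReal.ofReal_le_ofReal ?_
        have := mul_le_mul_of_nonneg_left h1 (show (0 : ℝ) ≤ k + 1 by positivity)
        have := mul_le_mul_of_nonneg_left h2 (show (0 : ℝ) ≤ 2 ^ s by positivity)
        linarith
    _ = 1 / 3 := by
        rw [ENNReal.ofReal_div_of_pos (by norm_num)]; simp

end Correctness

/-! ### Time and number of queries. -/

section Resources

/-- With every parameter replaced by `Y` the bound is a polynomial of degree 5. -/
theorem timeBound_le {n s r k d E Y : ℕ} (hY : 1 ≤ Y) (hn : n ≤ Y) (hs : s ≤ Y) (hr : r ≤ Y)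
    (hk : k ≤ Y) (hd : 2 ^ d ≤ Y) (hE : 256 * E ≤ Y) :
    timeBound n s r k d E ((k + 1) * (d * (256 * E))) ((s + 2) * (256 * E)) + 10 ≤ 10000 * Y ^ 5 := by
  have hd' : d ≤ Y := d.lt_two_pow_self.le.trans hd
  have hE' : E ≤ Y := by omega
  have h1 : timeBound n s r k d E ((k + 1) * (d * (256 * E))) ((s + 2) * (256 * E)) + 10 ≤
      Y * 7 + Y * 18 + Y * 18 + Y * 20 + Y * 9 + Y * (Y * 28 + 21) +
      (Y + 1) * (Y * Y) * (Y * (Y * 30 + 50) + Y * 9 + Y * 110 + 210) +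
      (Y + 2) * Y * ((Y * (Y * 240 + 270) + Y * (Y * 30 + 30) + Y * 30 +
        Y * (Y * (Y * 30 + 50) + Y * 30 + 60) + Y * 173 + 300) + 10) + 210 := by
    unfold timeBound time2
    rw [Nat.add_assoc _ 200 10]
    gcongr
  refine h1.trans ?_
  obtain ⟨y, rfl⟩ : ∃ y, Y = y + 1 := ⟨Y - 1, by omega⟩
  ring_nf
  nlinarith [Nat.zero_le y]

theorem queries_le {s r d E : ℕ} {ε : ℝ} (hs : 1 ≤ s) (hr : 1 ≤ r) (hε0 : 0 < ε) (hε2 : ε ≤ 2)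
    (hE : ε * E ≤ 4) (hd : 4 * (s * r) ^ 2 ≤ 2 ^ d) (hd' : 2 ^ d ≤ 8 * (s * r) ^ 2) :
    (((s * r + 1) * (d * (256 * E)) * (d + 4) +
      (s + 2) * (256 * E) * (8 * (s * r) + r * (d + 1) + 3) : ℕ) : ℝ) ≤
      (6000000 : ℕ) * ((r : ℝ) * (s : ℝ) ^ 2 / ε * Real.log ((r : ℝ) * (s : ℝ) ^ 2 / ε + 2) ^ 2) := by
  have hk : 1 ≤ s * r := Nat.mul_pos hs hr
  have hd2 : 2 ≤ d := by
    by_contra h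
    have h1 : d ≤ 1 := by omega
    have h2 := Nat.pow_le_pow_right (n := 2) (by norm_num) h1
    have h3 := Nat.pow_le_pow_left hk 2
    omega
  have hnat : (s * r + 1) * (d * (256 * E)) * (d + 4) +
      -- Here `6912 = 256 * 27`. Substituting `s + 1`, `r + 1`, `d + 2` makes it a comparison of
      -- coefficients.
      (s + 2) * (256 * E) * (8 * (s * r) + r * (d + 1) + 3) ≤ 6912 * (E * (r * s ^ 2 * d ^ 2)) := by
    obtain ⟨s, rfl⟩ : ∃ t, s = t + 1 := ⟨s - 1, by omega⟩
    obtain ⟨r, rfl⟩ : ∃ t, r = t + 1 := ⟨r - 1, by omega⟩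
    obtain ⟨d, rfl⟩ : ∃ t, d = t + 2 := ⟨d - 2, by omega⟩
    ring_nf
    omega
  set Q := (r : ℝ) * (s : ℝ) ^ 2 / ε with hQ
  have hrs : (0 : ℝ) < (r : ℝ) * (s : ℝ) ^ 2 := by positivity
  have hQ0 : 0 < Q := by positivity
  have hEQ : (E : ℝ) * ((r : ℝ) * (s : ℝ) ^ 2) ≤ 4 * Q := by
    rw [hQ, ← mul_div_assoc, le_div_iff₀ hε0]
    nlinarith
  have hkQ : ((s * r : ℕ) : ℝ) ≤ 2 * Q := by
    rw [hQ, ← mul_div_assoc, le_div_iff₀ hε0]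
    have h1 : ((s * r : ℕ) : ℝ) ≤ r * (s : ℝ) ^ 2 := by
      have : s * r ≤ r * s ^ 2 := by nlinarith [Nat.mul_le_mul_left (s * r) hs]
      exact_mod_cast this
    have h2 : (0 : ℝ) ≤ ((s * r : ℕ) : ℝ) := by positivity
    nlinarith
  -- From `2 ^ d ≤ 8 * k ^ 2` and `k ≤ 2 * Q` follows `2 ^ d ≤ 32 * Q ^ 2 ≤ (Q + 2) ^ 7`, and `log 2
  -- ≥ 1/2`. In the end `6912 * 4 * 14 ^ 2 ≤ 6000000`.
  have hL : (d : ℝ) ≤ 14 * Real.log (Q + 2) := by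
    have h1 : (2 : ℝ) ^ d ≤ (Q + 2) ^ 7 := by
      have h2 : (2 : ℝ) ^ d ≤ 8 * ((s * r : ℕ) : ℝ) ^ 2 := by exact_mod_cast hd'
      have h3 : ((s * r : ℕ) : ℝ) ^ 2 ≤ (2 * Q) ^ 2 := pow_le_pow_left₀ (by positivity) hkQ 2
      have h4 : (2 : ℝ) ^ 5 ≤ (Q + 2) ^ 5 := pow_le_pow_left₀ (by norm_num) (by linarith) 5
      have h5 : Q ^ 2 ≤ (Q + 2) ^ 2 := pow_le_pow_left₀ hQ0.le (by linarith) 2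
      calc (2 : ℝ) ^ d ≤ 2 ^ 5 * Q ^ 2 := by nlinarith
        _ ≤ (Q + 2) ^ 5 * (Q + 2) ^ 2 := mul_le_mul h4 h5 (by positivity) (by positivity)
        _ = (Q + 2) ^ 7 := by ring
    have h2 := Real.log_le_log (by positivity) h1
    rw [Real.log_pow, Real.log_pow] at h2
    have h3 : (1 : ℝ) / 2 ≤ Real.log 2 := by have := Real.log_two_gt_d9; linarith
    have h4 : (0 : ℝ) ≤ d := by positivity
    push_cast at h2
    nlinarith
  have hd2 : (d : ℝ) ^ 2 ≤ (14 * Real.log (Q + 2)) ^ 2 := pow_le_pow_left₀ (by positivity) hL 2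
  calc (((s * r + 1) * (d * (256 * E)) * (d + 4) +
        (s + 2) * (256 * E) * (8 * (s * r) + r * (d + 1) + 3) : ℕ) : ℝ)
      ≤ ((6912 * (E * (r * s ^ 2 * d ^ 2)) : ℕ) : ℝ) := Nat.cast_le.2 hnat
    _ = 6912 * (((E : ℝ) * ((r : ℝ) * (s : ℝ) ^ 2)) * (d : ℝ) ^ 2) := by push_cast; ring
    _ ≤ 6912 * ((4 * Q) * (14 * Real.log (Q + 2)) ^ 2) := by gcongr
    _ ≤ (6000000 : ℕ) * (Q * Real.log (Q + 2) ^ 2) := by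
      have : 0 ≤ Q * Real.log (Q + 2) ^ 2 := by positivity
      push_cast
      nlinarith

theorem time_le {n s r d E : ℕ} {ε : ℝ} (hs : 1 ≤ s) (hr : 1 ≤ r) (hε0 : 0 < ε) (hE : ε * E ≤ 4)
    (hd' : 2 ^ d ≤ 8 * (s * r) ^ 2) :
    timeBound n s r (s * r) d E ((s * r + 1) * (d * (256 * E))) ((s + 2) * (256 * E)) + 10 ≤
      (10000 * 1024 ^ 5) * (n + s + r + ⌈1 / ε⌉₊ + 1) ^ 20 := by
  have hE' : E ≤ 4 * ⌈1 / ε⌉₊ := by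
    have h1 : (E : ℝ) ≤ 4 * (1 / ε) := by rw [mul_one_div, le_div_iff₀ hε0]; linarith
    have h2 := Nat.le_ceil (1 / ε)
    have h3 : (E : ℝ) ≤ ((4 * ⌈1 / ε⌉₊ : ℕ) : ℝ) := by push_cast; linarith
    exact_mod_cast h3
  generalize ⌈1 / ε⌉₊ = c at hE' ⊢
  obtain ⟨Z, hZ⟩ : ∃ Z, Z = n + s + r + c + 1 := ⟨_, rfl⟩
  rw [← hZ]
  have hZ1 : 1 ≤ Z := by omega
  have hZ4 : Z ≤ Z ^ 4 := Nat.le_self_pow (by norm_num) Z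
  have hZ24 : Z ^ 2 ≤ Z ^ 4 := Nat.pow_le_pow_right hZ1 (by norm_num)
  have hk : s * r ≤ Z ^ 2 := by rw [sq]; exact Nat.mul_le_mul (by omega) (by omega)
  have hk2 : (s * r) ^ 2 ≤ Z ^ 4 := by
    calc (s * r) ^ 2 ≤ (Z ^ 2) ^ 2 := Nat.pow_le_pow_left hk 2
      _ = Z ^ 4 := by ring
  -- The value `1024 * Z ^ 4` dominates both `2 ^ d ≤ 8 * Z ^ 4` and `256 * E ≤ 1024 * Z`.
  have h := timeBound_le (n := n) (s := s) (r := r) (k := s * r) (d := d) (E := E)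
    (Y := 1024 * Z ^ 4) (by omega) (by omega) (by omega) (by omega) (by omega) (by omega) (by omega)
  rwa [show 10000 * (1024 * Z ^ 4) ^ 5 = (10000 * 1024 ^ 5) * Z ^ 20 by ring] at h

end Resources

/-- The program is a tester for the monotone or the unate class. -/
theorem hasPolyTimeTester_cls (mono : Bool) :
    HasPolyTimeTester (fun n s r => cls mono n s r) (fun s r ε => (r : ℝ) * (s : ℝ) ^ 2 / ε) := by
  refine ⟨tester mono, 10000 * 1024 ^ 5, 20, 6000000, 2, ?_⟩
  intro n s r hs hr ε e he heε hεe
  have hε0 : 0 < ε := lt_of_lt_of_le (by exact_mod_cast he) heε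
  have hm : 0 < e.num.toNat := by have := Rat.num_pos.2 he; omega
  have hen : (e : ℝ) * e.den = e.num.toNat := by
    have h1 : (e.num.toNat : ℤ) = e.num := Int.toNat_of_nonneg (Rat.num_pos.2 he).le
    have h2 := Rat.mul_den_eq_num e
    have h3 : ((e * e.den : ℚ) : ℝ) = ((e.num.toNat : ℤ) : ℝ) := by rw [h2, h1]; norm_cast
    push_cast at h3
    exact_mod_cast h3
  by_cases hle : e.num.toNat ≤ e.den
  · set m := e.num.toNat with hm'
    set E := (e.den + m - 1) / m with hE
    have hE1 : e.den ≤ E * m := by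
      have h1 := Nat.div_add_mod (e.den + m - 1) m
      have h2 := Nat.mod_lt (e.den + m - 1) hm
      rw [← hE, mul_comm] at h1
      omega
    have hE2 : E * m < e.den + m := by
      have := Nat.div_mul_le_self (e.den + m - 1) m
      rw [← hE] at this
      omega
    have hden : (0 : ℝ) < e.den := by exact_mod_cast e.den_pos
    have he0 : (0 : ℝ) < e := by exact_mod_cast he
    have hE1' : (e.den : ℝ) ≤ E * m := by exact_mod_cast hE1
    -- Rounding up at most doubles the quotient because `m ≤ e.den`; hence `1 ≤ e * E ≤ 2`, and `ε *
    -- E ≤ 4` by `ε ≤ 2 * e`.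
    have hE2' : (E : ℝ) * m ≤ 2 * e.den := by
      have : E * m ≤ 2 * e.den := by omega
      exact_mod_cast this
    rw [← hen] at hE1' hE2'
    have heE1 : (1 : ℝ) ≤ (e : ℝ) * E := by
      by_contra h
      nlinarith
    have heE2 : (e : ℝ) * E ≤ 2 := by
      by_contra h
      nlinarith
    have hE0 : (0 : ℝ) ≤ E := by positivity
    have he1 : (e : ℝ) ≤ 1 := by
      by_contra h
      have : (m : ℝ) ≤ e.den := by exact_mod_cast hle
      nlinarith
    have hεE1 : 1 ≤ ε * E := by
      have := mul_le_mul_of_nonneg_right heε hE0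
      linarith
    have hεE2 : ε * E ≤ 4 := by nlinarith
    have hk : 1 ≤ s * r := Nat.mul_pos hs hr
    -- Minimality of `d` gives the upper bound `2 ^ d ≤ 8 * (s * r) ^ 2`, which both the time and
    -- the query estimates require.
    obtain ⟨d, hd1, hd2⟩ : ∃ d, (∀ i < d, 2 ^ i < 4 * (s * r) ^ 2) ∧ 4 * (s * r) ^ 2 ≤ 2 ^ d :=
      ⟨Nat.clog 2 (4 * (s * r) ^ 2), fun i hi => (Nat.lt_clog_iff_pow_lt (by norm_num)).1 hi,
        Nat.le_pow_clog (by norm_num) _⟩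
    have hd3 : 2 ^ d ≤ 8 * (s * r) ^ 2 := by
      cases d with
      | zero => have := Nat.pow_le_pow_left hk 2; simp; omega
      | succ d => have := hd1 d (by omega); rw [pow_succ]; omega
    refine isTester_of_tri (T := timeBound n s r (s * r) d E ((s * r + 1) * (d * (256 * E)))
      ((s + 2) * (256 * E)) + 10) (q := (s * r + 1) * (d * (256 * E)) * (d + 4) +
      (s + 2) * (256 * E) * (8 * (s * r) + r * (d + 1) + 3)) (fun f D => ⟨answer mono f D d (s * r) s r
      (d * (256 * E)) ((s * r + 1) * (d * (256 * E))) ((s + 2) * (256 * E)), ?_, ?_, ?_⟩)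
      (time_le hs hr hε0 hεE2 hd3) (queries_le hs hr hε0 (by linarith) hεE2 hd2 hd3)
    · refine Tri.mono (Det.seq_tri (T := 1) (q := 0) (R := fun τ => τ.reg 20 = m - e.den)
        (det_ev _ _ _ rfl (by simp [ev, start, hm'])) ?_) (T := 1 + (timeBound n s r (s * r) d E
        ((s * r + 1) * (d * (256 * E))) ((s + 2) * (256 * E)) + 1) + 1) (by omega)
        (q := 0 + ((s * r + 1) * (d * (256 * E)) * (d + 4) +
        (s + 2) * (256 * E) * (8 * (s * r) + r * (d + 1) + 3))) (by omega) fun _ _ _ h => h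
      intro τ hf h20
      refine Tri.ite (fun h => absurd h (by omega)) fun _ => ?_
      refine testProg_spec mono (m := m) ?_ ?_ ?_ ?_ ?_ ?_ ?_ ?_ rfl hd1 hd2
      · rw [hf.reg 0 (by decide)]; rfl
      · rw [hf.reg 1 (by decide)]; rfl
      · rw [hf.reg 2 (by decide)]; rfl
      · rw [hf.reg 3 (by decide)]; rfl
      · rw [hf.reg 4 (by decide)]; exact hE1
      · rw [hf.reg 4 (by decide)]; exact hE2
      · intro x hx hx'
        rw [hf.reg x (by simp [wr]; omega)]
        simp only [start]
        rw [List.getD_eq_default]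
        simp; omega
      · ext a
        rw [hf.arr a (by simp [wa])]; rfl
    · intro hf
      exact (answer_complete hf D le_rfl hd2 _ _).trans
        (ENNReal.div_le_div_left (by norm_num) 1)
    · intro hfar
      exact answer_sound_third hε0 hεE1 hfar hk hd2 _
  · have hε1 : 1 < ε := by
      refine lt_of_lt_of_le ?_ heε
      by_contra h
      have h1 : (e.den : ℝ) < e.num.toNat := by exact_mod_cast not_le.1 hle
      have h2 : (0 : ℝ) < e.den := by exact_mod_cast e.den_pos
      nlinarith
    refine isTester_of_tri (T := 10) (q := 0) (fun f D => ⟨PMF.pure true, ?_, ?_, ?_⟩) ?_ ?_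
    · refine Tri.mono (Det.seq_tri (T := 1) (q := 0) (R := fun τ => τ.reg 20 = e.num.toNat - e.den)
        (det_ev _ _ _ rfl (by simp [ev, start])) ?_) (T := 1 + (1 + 1) + 1) (by omega)
        (q := 0 + 0) (by omega) fun _ _ _ h => h
      intro τ hf h20
      refine Tri.ite (fun _ => ?_) fun h => absurd h (by omega)
      exact Det.tri (det_ev _ _ (fun τ' => τ'.reg 0 = 1) rfl (by simp [ev])) fun _ _ h => h
    · intro _
      rw [ex_pure, chi_not (by simp)]
      exact zero_le
    · intro hfar
      exact absurd hfar (not_isFarFromClass hε1)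
    · have : 1 ≤ (n + s + r + ⌈1 / ε⌉₊ + 1) ^ 20 := Nat.one_le_pow _ _ (by omega)
      omega
    · push_cast
      have : 0 ≤ (r : ℝ) * (s : ℝ) ^ 2 / ε := by positivity
      positivity

end DistFree

theorem mainTheorem5 :
    DistFree.HasPolyTimeTester DistFree.sTermMonotoneRDNF
      (fun s r ε => (r : ℝ) * (s : ℝ) ^ 2 / ε) ∧
    DistFree.HasPolyTimeTester DistFree.sTermUnateRDNF
      (fun s r ε => (r : ℝ) * (s : ℝ) ^ 2 / ε) :=
  ⟨DistFree.hasPolyTimeTester_cls true, DistFree.hasPolyTimeTester_cls false⟩
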